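/- **Joins.** A join is a hypergraph $\mathcal Q=(\mathcal V,\mathcal E)$ with a finite set $\mathcal V$ of attributes and a set $\mathcal E\subseteq 2^{\mathcal V}$ of hyperedges (relations). For an attribute $x$ let $\mathcal E_x=\{e\in\mathcal E: x\in e\}$. The join is *hierarchical* if for all $x,y\in\mathcal V$ one has $\mathcal E_x\subseteq\mathcal E_y$, or $\mathcal E_y\subseteq\mathcal E_x$, or $\mathcal E_x\cap\mathcal E_y=\emptyset$. It is *r-hierarchical* if it becomes hierarchical after repeatedly removing edges that are contained in another edge, until no such edge is left. An instance $\mathcal R$ consists of a finite set $R(e)$ of tuples for every $e\in\mathcal E$, where a tuple over $e$ assigns to every $x\in e$ a value from a domain $\mathrm{dom}(x)$; $\mathrm{IN}=\sum_{e}|R(e)|$. The join results $\mathcal Q(\mathcal R)$ are the combinations of tuples, one from each $R(e)$, that agree on common attributes. For $S\subseteq\mathcal E$, let $\mathcal Q(\mathcal R,S)$ be the set of join results of the relations in $S$ that are part of a full join result, and $$L_{\mathrm{instance}}(p,\mathcal R)=\max_{\emptyset\ne S\subseteq\mathcal E}\Bigl(\frac{|\mathcal Q(\mathcal R,S)|}{p}\Bigr)^{1/|S|}.$$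 **Model (MPC).** The input tuples are initially distributed over $p$ servers, in an arbitrary way with at most $\lceil \mathrm{IN}/p\rceil$ tuples on each. In each round every server sends a message to every server, computed (without restriction on local computation) from its identity and from everything it has seen so far. A message is a sequence of units, each being a tuple or an integer. Algorithms are *tuple-based*: a server can send only copies of tuples that it holds. The algorithm *computes* $\mathcal Q(\mathcal R)$ if for every join result all of its tuples are present on the same server at some point. The *load* is the maximum over all servers of the number of tuples held initially and of the number of units received in any one round. **Theorem.** Let $\mathcal Q$ be an r-hierarchical join and $\epsilon>0$. There are constants $k,c,C$, depending only on $\mathcal Q$ and $\epsilon$, such that for every $p\ge1$ and all domains there is a deterministic tuple-based MPC algorithm $\mathcal A$ on $p$ servers with at most $k$ rounds which, on every instance $\mathcal R$ with $\mathrm{IN}\ge p^{1+\epsilon}$ and every initial distribution as above, computes $\mathcal Q(\mathcal R)$, sends only non-negative integers smaller than $(\mathrm{IN}+1)^c$ (that is, of $O(\log \mathrm{IN})$ bits), and has load at most $$C\cdot\Bigl(\frac{\mathrm{IN}}{p}+L_{\mathrm{instance}}(p,\mathcal R)\Bigr).$$ This is instance-optimal up to a constant factor: for every $k'$ there are constants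 $C_1,C_2$, depending only on $\mathcal Q$, $\epsilon$ and $k'$, such that for every such $p$, all such domains and every such $\mathcal R$, every deterministic tuple-based $k'$-round algorithm $\mathcal A'$ on $p$ servers that computes $\mathcal Q(\mathcal R)$ from some initial distribution as above has load $L'$ satisfying $L_{\mathrm{instance}}(p,\mathcal R)\le C_1L'$, and the load of $\mathcal A$ on $\mathcal R$, from any initial distribution as above, is at most $C_2L'$. This holds even if for $\mathcal A'$ only tuples are counted as units in the load and arbitrary other information is communicated for free. -/

import Mathlib

open scoped NNReal

universe u v w

namespace MPCJoin

/-! ### Joins, instances and join results -/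

/-- A (natural) join: its set of hyperedges (relations), each a finite set of attributes. -/
abbrev Query (V : Type u) := Finset (Finset V)

/-- A tuple over the attribute set `e`: an assignment of a value of `dom x` to every `x ∈ e`. -/
abbrev Tuple {V : Type u} (dom : V → Type v) (e : Finset V) := ∀ x : {x // x ∈ e}, dom x.1

/-- A tuple of some relation of the join, tagged with its relation. -/
abbrev AnyTuple {V : Type u} (E : Query V) (dom : V → Type v) :=
  Σ e : {e // e ∈ E}, Tuple dom e.1

namespace Query

variable {V : Type u}

/-- The hyperedges that contain the attribute `x`. -/
def edgesAt (E : Query V) (x : V) : Set (Finset V) := {e | e ∈ E ∧ x ∈ e}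

/-- Hierarchical joins. -/
def Hierarchical (E : Query V) : Prop :=
  ∀ x y : V, E.edgesAt x ⊆ E.edgesAt y ∨ E.edgesAt y ⊆ E.edgesAt x ∨
    E.edgesAt x ∩ E.edgesAt y = ∅

/-- One application of the reduce procedure: remove an edge contained in another edge. -/
def ReduceStep [DecidableEq V] (E E' : Query V) : Prop :=
  ∃ e ∈ E, ∃ e' ∈ E, e ≠ e' ∧ e ⊆ e' ∧ E' = E.erase e

/-- A join is reduced if the reduce procedure cannot be applied any more. -/
def Reduced [DecidableEq V] (E : Query V) : Prop := ∀ E' : Query V, ¬ E.ReduceStep E'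

/-- A join is r-hierarchical if repeatedly applying the reduce procedure, until no edge can be
removed, leads to a hierarchical join. -/
def RHierarchical [DecidableEq V] (E : Query V) : Prop :=
  ∃ E' : Query V, Relation.ReflTransGen ReduceStep E E' ∧ E'.Reduced ∧ E'.Hierarchical

end Query

/-- An instance of the join `E`: a finite set of tuples for every relation. -/
structure Instance {V : Type u} (E : Query V) (dom : V → Type v) where
  /-- the tuples of the relation of `e` -/
  rel : ∀ e : {e // e ∈ E}, Finset (Tuple dom e.1)

/-- A family of tuples shares common values on common attributes. -/
def Consistent {V : Type u} {dom : V → Type v} {ι : Type u} {f : ι → Finset V}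
    (t : ∀ i, Tuple dom (f i)) : Prop :=
  ∀ (i j : ι) (x : V) (hi : x ∈ f i) (hj : x ∈ f j), t i ⟨x, hi⟩ = t j ⟨x, hj⟩

namespace Instance

variable {V : Type u} {E : Query V} {dom : V → Type v}

/-- The input size `IN`. -/
def size (R : Instance E dom) : ℕ := ∑ e, (R.rel e).card

/-- The join results: all combinations of tuples, one from each relation, that share common values
on their common attributes. -/
def joinResults (R : Instance E dom) : Set (∀ e : {e // e ∈ E}, Tuple dom e.1) :=
  {t | (∀ e, t e ∈ R.rel e) ∧ Consistent t}

/-- `Q(R, S)`: the join results of the relations in `S` that are part of a full join result. -/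
def partialResults (R : Instance E dom) (S : Finset {e // e ∈ E}) :
    Set (∀ e : {e // e ∈ S}, Tuple dom e.1.1) :=
  {s | (∀ e, s e ∈ R.rel e.1) ∧ Consistent s ∧
    ∃ t ∈ R.joinResults, ∀ e : {e // e ∈ S}, t e.1 = s e}

/-- `L_instance(p, R)`, the maximum over the nonempty sets `S` of relations of
`(|Q(R, S)| / p) ^ (1 / |S|)`. -/
noncomputable def lInstance (p : ℕ) (R : Instance E dom) : ℝ≥0 :=
  ((Finset.univ : Finset (Finset {e // e ∈ E})).filter fun S => S.Nonempty).sup fun S =>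
    (((R.partialResults S).ncard : ℝ≥0) / (p : ℝ≥0)) ^ (1 / (S.card : ℝ))

/-- The input is distributed evenly over the `p` servers: every input tuple is on exactly one
server, no other tuple is on any server, and no server holds more than `⌈IN / p⌉` tuples. -/
def EvenlyDistributed (R : Instance E dom) {p : ℕ} (D : Fin p → Finset (AnyTuple E dom)) : Prop :=
  (∀ τ : AnyTuple E dom, τ.2 ∈ R.rel τ.1 ↔ ∃ i, τ ∈ D i) ∧
  (∀ i j, i ≠ j → ∀ τ ∈ D i, τ ∉ D j) ∧
  ∀ i, (D i).card ≤ ⌈(R.size : ℝ) / (p : ℝ)⌉₊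

end Instance

/-! ### The MPC model -/

/-- A message is a list of units; a unit is a tuple or a piece of other information, of type `Γ`
(for `Γ = ℕ`: an integer). -/
abbrev Message {V : Type u} (E : Query V) (dom : V → Type v) (Γ : Type w) :=
  List (AnyTuple E dom ⊕ Γ)

/-- What a server has seen so far: the tuples it held initially and, for every past round in
chronological order, the message received from each of the `p` servers. -/
structure History {V : Type u} (E : Query V) (dom : V → Type v) (Γ : Type w) (p : ℕ) where
  /-- the tuples held initially -/
  initial : Finset (AnyTuple E dom)
  /-- the messages received, round by round, indexed by the sender -/
  received : List (Fin p → Message E dom Γ)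

/-- The tuple `τ`, or a copy of it, is present in the history `h`. -/
def History.Holds {V : Type u} {E : Query V} {dom : V → Type v} {Γ : Type w} {p : ℕ}
    (h : History E dom Γ p) (τ : AnyTuple E dom) : Prop :=
  τ ∈ h.initial ∨ ∃ m ∈ h.received, ∃ j, Sum.inl τ ∈ m j

/-- A deterministic tuple-based MPC algorithm on `p` servers. In each round every server sends to
every server a message which it computes, without restriction on local computation, from its own
identity and from what it has seen so far. Tuples are atomic: a server can only send copies of
tuples that it holds. -/
structure Algorithm {V : Type u} (E : Query V) (dom : V → Type v) (Γ : Type w) (p : ℕ) where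
  /-- the number of rounds -/
  rounds : ℕ
  /-- the message from a server with a given history to another server -/
  send : Fin p → History E dom Γ p → Fin p → Message E dom Γ
  /-- tuples are only created by copying -/
  tupleBased : ∀ i h j τ, Sum.inl τ ∈ send i h j → h.Holds τ

namespace Algorithm

variable {V : Type u} {E : Query V} {dom : V → Type v} {Γ : Type w} {p : ℕ}

/-- The history of server `i` after `t` rounds, starting from the distribution `D`. -/
def history (A : Algorithm E dom Γ p) (D : Fin p → Finset (AnyTuple E dom)) :
    ℕ → Fin p → History E dom Γ p
  | 0, i => ⟨D i, []⟩
  | t + 1, i => ⟨D i, (history A D t i).received ++ [fun j => A.send j (history A D t j) i]⟩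

/-- The message which server `j` sends to server `i` in round `t` (rounds are counted from `0`). -/
def message (A : Algorithm E dom Γ p) (D : Fin p → Finset (AnyTuple E dom)) (t : ℕ)
    (j i : Fin p) : Message E dom Γ :=
  A.send j (A.history D t j) i

/-- The algorithm computes the join on `R`: for every join result, all its tuples are present on
one server at some point. -/
def Computes (A : Algorithm E dom Γ p) (R : Instance E dom)
    (D : Fin p → Finset (AnyTuple E dom)) : Prop :=
  ∀ t ∈ R.joinResults, ∃ i, ∃ s ≤ A.rounds, ∀ e, (A.history D s i).Holds ⟨e, t e⟩

/-- The load: the maximum, over all servers, of the number of tuples held initially and of the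
number of units received in any one round. -/
def load (A : Algorithm E dom Γ p) (D : Fin p → Finset (AnyTuple E dom)) : ℕ :=
  Finset.univ.sup fun i : Fin p => max (D i).card
    ((Finset.range A.rounds).sup fun t => ∑ j, (A.message D t j i).length)

/-- The load when only tuples are counted and all other information is communicated for free. -/
def tupleLoad (A : Algorithm E dom Γ p) (D : Fin p → Finset (AnyTuple E dom)) : ℕ :=
  Finset.univ.sup fun i : Fin p => max (D i).card
    ((Finset.range A.rounds).sup fun t => ∑ j, (A.message D t j i).countP Sum.isLeft)

/-- All integers sent during the execution are smaller than `B`. -/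
def IntegersBelow (A : Algorithm E dom ℕ p) (D : Fin p → Finset (AnyTuple E dom)) (B : ℕ) : Prop :=
  ∀ t < A.rounds, ∀ i j, ∀ n, Sum.inr n ∈ A.message D t i j → n < B

end Algorithm

end MPCJoin

open MPCJoin

namespace MPCJoin

open scoped Classical

/-! ### Building algorithms round by round -/

section Protocols

variable {V : Type u} {E : Query V} {dom : V → Type v} {p m : ℕ}

/-! Lower bound. In `r` rounds at load `L'` a server sees at most `(r + 1) * L'` tuples. Each join
result must have all its tuples on one server, so `|Q(R, S)| ≤ p * ((r + 1) * L') ^ |S|` for every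
`S` (`Computes.ncard_partialResults_le`), that is, `L_instance ≤ (r + 1) * L'`. The initial tuples
give `IN / p ≤ L'`. It remains to find an algorithm with load `O(IN / p + L_instance)`.

Reduction. A relation contained in another one is treated as in a semijoin: every tuple fetches its
restrictions to the relations inside its own (its companions), and tuples lacking one of them are
dropped. What is left is a hierarchical join. It decomposes recursively (`Plan`): either all
relations share a further attribute, whose values define groups, or the relations split into two
sets that share only fixed attributes, until all attributes of a single relation are fixed.

Allocation. For a target load `L`, the tuples with common fixed values have a demand `need`, the sum
of `N_S / L ^ |S|` over nonempty `S`, where `N_S` counts partial results. Under grouping demands add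
up, and the subgroups are packed on a line of slots (`Spec.group`). Under products `1 + need`
multiplies, and the slots form a grid (`Spec.prod`). A slot receives `O(L)` tuples, and the tuples
of every join result meet in some slot. Since `N_S ≤ p * L_instance ^ |S|`, the whole demand fits
once `L` is a suitable multiple of `L_instance` (`need_lt`).

Statistics. Counts and offsets are sums of weights over the tuples with equal or smaller keys. They
are computed on a grid of nodes of side `s` and constant dimension `m > 2 / ε`, by a recursion over
the dimension resembling sample sort (`solves_succ`, `solves_level`). Dealing out the tuples in
sorted order makes every node a fair sample of its block, so the splitters of one node serve all.
Tuples sharing a key with a splitter are settled by class totals; the others move to smaller blocks.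
The cost is `O(IN / p + s ^ 2)`, and `s ^ 2 ≤ p ^ ε ≤ IN / p` is where the assumption on `IN`
enters. With `min` in place of addition the same protocol fetches tuples.

Local computation is unrestricted, so to compute a value means that the value is determined by the
history, over all inputs under consideration. `exists_round` turns this notion of knowledge into
actual messages. -/

/-- A family of inputs `X` for algorithms on `p` servers, with the initial distribution, the allowed
load and the bound for the integers of each of them, and an embedding of a grid of nodes into the
servers. -/
structure Env {V : Type u} (E : Query V) (dom : V → Type v) (p m : ℕ) where
  /-- the inputs -/
  X : Type (max u v)
  /-- the initial distribution -/
  D : X → Fin p → Finset (AnyTuple E dom)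
  /-- the number of units that a server may receive in a round -/
  maxLoad : X → ℕ
  /-- strict upper bound for the integers -/
  intBound : X → ℕ
  /-- side length of the grid of nodes -/
  s : ℕ
  /-- the server which plays the role of a node -/
  emb : (Fin m → Fin s) → Fin p
  emb_inj : Function.Injective emb

namespace Env

variable (G : Env E dom p m)

/-- The nodes of the grid. -/
abbrev Node (G : Env E dom p m) := Fin m → Fin G.s

/-- What a server has seen at the end. -/
def final (A : Algorithm E dom ℕ p) (x : G.X) (i : Fin p) : History E dom ℕ p :=
  A.history (G.D x) A.rounds i

/-- The algorithm respects the bounds on the load and on the integers. -/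
def Good (A : Algorithm E dom ℕ p) : Prop :=
  ∀ x, (∀ t < A.rounds, ∀ i, ∑ j, (A.message (G.D x) t j i).length ≤ G.maxLoad x) ∧
    A.IntegersBelow (G.D x) (G.intBound x)

/-- `A'` continues `A` for at most `k` more rounds. -/
structure Extends (k : ℕ) (A A' : Algorithm E dom ℕ p) : Prop where
  good : G.Good A'
  rounds_le : A'.rounds ≤ A.rounds + k
  final_eq : ∀ x y i, G.final A' x i = G.final A' y i → G.final A x i = G.final A y i
  holds : ∀ x i τ, (G.final A x i).Holds τ → (G.final A' x i).Holds τ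

variable {G}

theorem Extends.refl {A : Algorithm E dom ℕ p} (hA : G.Good A) : G.Extends 0 A A :=
  ⟨hA, le_rfl, fun _ _ _ h => h, fun _ _ _ h => h⟩

theorem Extends.trans {k l : ℕ} {A B C : Algorithm E dom ℕ p} (h : G.Extends k A B)
    (h' : G.Extends l B C) : G.Extends (k + l) A C :=
  ⟨h'.good, by have := h.rounds_le; have := h'.rounds_le; omega,
    fun x y i e => h.final_eq x y i (h'.final_eq x y i e),
    fun x i τ e => h'.holds x i τ (h.holds x i τ e)⟩

theorem Extends.mono {k l : ℕ} {A B : Algorithm E dom ℕ p} (h : G.Extends k A B) (hkl : k ≤ l) :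
    G.Extends l A B :=
  ⟨h.good, h.rounds_le.trans (by omega), h.final_eq, h.holds⟩

theorem length_received_history (A : Algorithm E dom ℕ p) (D : Fin p → Finset (AnyTuple E dom))
    (t : ℕ) (i : Fin p) : (A.history D t i).received.length = t := by
  induction t with
  | zero => rfl
  | succ t ih => simp [Algorithm.history, ih]

theorem initial_history (A : Algorithm E dom ℕ p) (D : Fin p → Finset (AnyTuple E dom))
    (t : ℕ) (i : Fin p) : (A.history D t i).initial = D i := by
  cases t <;> rfl

theorem initial_eq_of_final_eq {A : Algorithm E dom ℕ p} {x y : G.X} {i : Fin p}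
    (h : G.final A x i = G.final A y i) : G.D x i = G.D y i := by
  have := congrArg History.initial h
  rwa [final, final, initial_history, initial_history] at this

/-- One more round: the servers send messages which are determined by what they have seen. -/
theorem exists_round {A : Algorithm E dom ℕ p} (hA : G.Good A)
    (msg : G.X → Fin p → Fin p → Message E dom ℕ)
    (hdet : ∀ x y i, G.final A x i = G.final A y i → msg x i = msg y i)
    (hheld : ∀ x i j τ, Sum.inl τ ∈ msg x i j → (G.final A x i).Holds τ)
    (hload : ∀ x i, ∑ j, (msg x j i).length ≤ G.maxLoad x)
    (hint : ∀ x i j n, Sum.inr n ∈ msg x i j → n < G.intBound x) :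
    ∃ A', G.Extends 1 A A' ∧
      (∀ x y i, G.final A' x i = G.final A' y i → ∀ j, msg x j i = msg y j i) ∧
      ∀ x i j τ, Sum.inl τ ∈ msg x j i → (G.final A' x i).Holds τ := by
  -- The number of messages received tells a server which round it is in. In the new round it picks
  -- any input compatible with its history; by `hdet` the choice does not affect the message.
  let A' : Algorithm E dom ℕ p :=
    { rounds := A.rounds + 1
      send := fun i h j =>
        if h.received.length = A.rounds then
          if hx : ∃ x, G.final A x i = h then msg hx.choose i j else []
        else A.send i h j
      tupleBased := by
        intro i h j τ hτ
        split_ifs at hτ with h1 h2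
        · have := hheld _ _ _ _ hτ
          rwa [h2.choose_spec] at this
        · simp at hτ
        · exact A.tupleBased _ _ _ _ hτ }
  have hhist : ∀ x t, t ≤ A.rounds → ∀ i, A'.history (G.D x) t i = A.history (G.D x) t i := by
    intro x t
    induction t with
    | zero => intro _ i; rfl
    | succ t ih =>
      intro ht i
      have ih' := ih (by omega)
      simp only [Algorithm.history, ih']
      congr 3
      funext j
      have : (A.history (G.D x) t j).received.length ≠ A.rounds := by
        rw [length_received_history]; omega
      simp [A', this]
  have hmsg : ∀ x t, t < A.rounds → ∀ i j,
      A'.message (G.D x) t j i = A.message (G.D x) t j i := by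
    intro x t ht i j
    have : (A.history (G.D x) t j).received.length ≠ A.rounds := by
      rw [length_received_history]; omega
    simp [Algorithm.message, hhist x t ht.le, A', this]
  have hlast : ∀ x i j, A'.message (G.D x) A.rounds j i = msg x j i := by
    intro x i j
    have h1 : (A.history (G.D x) A.rounds j).received.length = A.rounds :=
      length_received_history _ _ _ _
    have h2 : ∃ y, G.final A y j = A.history (G.D x) A.rounds j := ⟨x, rfl⟩
    have h3 : A'.message (G.D x) A.rounds j i = msg h2.choose j i := by
      rw [Algorithm.message, hhist x _ le_rfl]
      simp only [A']
      rw [if_pos h1, dif_pos h2]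
    rw [h3, hdet _ x j h2.choose_spec]
  have hfin : ∀ x i, G.final A' x i =
      ⟨G.D x i, (G.final A x i).received ++ [fun j => msg x j i]⟩ := by
    intro x i
    change A'.history (G.D x) (A.rounds + 1) i = _
    rw [Algorithm.history, hhist x _ le_rfl]
    have : (fun j => A'.send j (A'.history (G.D x) A.rounds j) i) = fun j => msg x j i := by
      funext j; exact hlast x i j
    rw [this]
    rfl
  refine ⟨A', ⟨?_, le_rfl, ?_, ?_⟩, ?_, ?_⟩
  · intro x
    constructor
    · intro t ht i
      rcases Nat.lt_succ_iff_lt_or_eq.mp ht with h | rfl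
      · simpa only [hmsg x t h] using (hA x).1 t h i
      · simpa only [hlast] using hload x i
    · intro t ht i j n hn
      rcases Nat.lt_succ_iff_lt_or_eq.mp ht with h | rfl
      · rw [hmsg x t h] at hn
        exact (hA x).2 t h i j n hn
      · rw [hlast] at hn
        exact hint _ _ _ _ hn
  · intro x y i h
    have h0 := initial_eq_of_final_eq h
    rw [hfin, hfin] at h
    injection h with _ h
    have h1 := (List.append_inj' h rfl).1
    have e : ∀ z, G.final A z i = ⟨G.D z i, (G.final A z i).received⟩ := by
      intro z
      have := initial_history A (G.D z) A.rounds i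
      rw [← this]; rfl
    rw [e x, e y, h0, h1]
  · intro x i τ h
    rw [hfin]
    rcases h with h | ⟨μ, hμ, j, hj⟩
    · left
      rwa [final, initial_history] at h
    · right
      exact ⟨μ, List.mem_append_left _ hμ, j, hj⟩
  · intro x y i h j
    rw [hfin, hfin] at h
    injection h with _ h
    have h1 := (List.append_inj' h rfl).2
    injection h1 with h1 _
    exact congrFun h1 j
  · intro x i j τ h
    rw [hfin]
    right
    exact ⟨_, List.mem_append_right _ (List.mem_singleton_self _), j, h⟩

/-! ### Knowledge of the nodes -/

/-- The value `f x i` is determined by what node `i` has seen. -/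
def Knows {β : Sort*} (A : Algorithm E dom ℕ p) (f : G.X → G.Node → β) : Prop :=
  ∀ x y i, G.final A x (G.emb i) = G.final A y (G.emb i) → f x i = f y i

/-- The values `f x i τ` for the tuples `τ ∈ loc x i` are determined by what node `i` has seen. -/
def KnowsOn {β : Sort*} (A : Algorithm E dom ℕ p) (loc : G.X → G.Node → Finset (AnyTuple E dom))
    (f : G.X → G.Node → AnyTuple E dom → β) : Prop :=
  ∀ x y i, G.final A x (G.emb i) = G.final A y (G.emb i) → ∀ τ ∈ loc x i, f x i τ = f y i τ

/-- Node `i` holds the tuple `τ`. -/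
def NodeHolds (A : Algorithm E dom ℕ p) (x : G.X) (i : G.Node) (τ : AnyTuple E dom) : Prop :=
  (G.final A x (G.emb i)).Holds τ

theorem Extends.knows {β : Sort*} {k : ℕ} {A A' : Algorithm E dom ℕ p} (h : G.Extends k A A')
    {f : G.X → G.Node → β} (hf : G.Knows A f) : G.Knows A' f :=
  fun x y i e => hf x y i (h.final_eq x y _ e)

theorem Extends.knowsOn {β : Sort*} {k : ℕ} {A A' : Algorithm E dom ℕ p} (h : G.Extends k A A')
    {loc : G.X → G.Node → Finset (AnyTuple E dom)}
    {f : G.X → G.Node → AnyTuple E dom → β} (hf : G.KnowsOn A loc f) : G.KnowsOn A' loc f :=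
  fun x y i e => hf x y i (h.final_eq x y _ e)

theorem Extends.nodeHolds {k : ℕ} {A A' : Algorithm E dom ℕ p} (h : G.Extends k A A')
    {x : G.X} {i : G.Node} {τ : AnyTuple E dom} (hf : G.NodeHolds A x i τ) :
    G.NodeHolds A' x i τ := h.holds _ _ _ hf

/-- One more round of messages between nodes. -/
theorem exists_node_round {A : Algorithm E dom ℕ p} (hA : G.Good A)
    (msg : G.X → G.Node → G.Node → Message E dom ℕ)
    (hdet : G.Knows A msg)
    (hheld : ∀ x i j τ, Sum.inl τ ∈ msg x i j → G.NodeHolds A x i τ)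
    (hload : ∀ x i, ∑ j, (msg x j i).length ≤ G.maxLoad x)
    (hint : ∀ x i j n, Sum.inr n ∈ msg x i j → n < G.intBound x) :
    ∃ A', G.Extends 1 A A' ∧ G.Knows A' (fun x j i => msg x i j) ∧
      ∀ x i j τ, Sum.inl τ ∈ msg x j i → G.NodeHolds A' x i τ := by
  let M : G.X → Fin p → Fin p → Message E dom ℕ := fun x a b =>
    if h : (∃ i, G.emb i = a) ∧ ∃ j, G.emb j = b then msg x h.1.choose h.2.choose else []
  have hM : ∀ x i j, M x (G.emb i) (G.emb j) = msg x i j := by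
    intro x i j
    have h : (∃ i', G.emb i' = G.emb i) ∧ ∃ j', G.emb j' = G.emb j := ⟨⟨i, rfl⟩, ⟨j, rfl⟩⟩
    have h1 := G.emb_inj h.1.choose_spec
    have h2 := G.emb_inj h.2.choose_spec
    simp only [M]
    rw [dif_pos h, h1, h2]
  have hM0 : ∀ x a b, M x a b ≠ [] → ∃ i j, G.emb i = a ∧ G.emb j = b := by
    intro x a b h
    by_contra hc
    apply h
    simp only [M]
    rw [dif_neg]
    rintro ⟨⟨i, hi⟩, ⟨j, hj⟩⟩
    exact hc ⟨i, j, hi, hj⟩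
  have hM1 : ∀ x a b u, u ∈ M x a b → ∃ i j, G.emb i = a ∧ G.emb j = b ∧ u ∈ msg x i j := by
    intro x a b u hu
    obtain ⟨i, j, rfl, rfl⟩ := hM0 x a b (List.ne_nil_of_mem hu)
    exact ⟨i, j, rfl, rfl, by rwa [hM] at hu⟩
  have k1 : ∀ x y i, G.final A x i = G.final A y i → M x i = M y i := by
    intro x y a h
    funext b
    by_cases hc : (∃ i, G.emb i = a) ∧ ∃ j, G.emb j = b
    · obtain ⟨⟨i, rfl⟩, ⟨j, rfl⟩⟩ := hc
      rw [hM, hM, hdet x y i h]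
    · simp only [M]
      rw [dif_neg hc, dif_neg hc]
  have k2 : ∀ x i j τ, Sum.inl τ ∈ M x i j → (G.final A x i).Holds τ := by
    intro x a b τ h
    obtain ⟨i, j, rfl, rfl, h'⟩ := hM1 _ _ _ _ h
    exact hheld _ _ _ _ h'
  have k3 : ∀ x i, ∑ j, (M x j i).length ≤ G.maxLoad x := by
    intro x b
    by_cases hb : ∃ j, G.emb j = b
    · obtain ⟨j, rfl⟩ := hb
      refine le_trans (le_of_eq ?_) (hload x j)
      symm
      apply Finset.sum_of_injOn G.emb (G.emb_inj.injOn) (by simp)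
      · intro a _ ha
        have : M x a (G.emb j) = [] := by
          by_contra hc
          obtain ⟨i, _, rfl, _⟩ := hM0 _ _ _ hc
          exact ha ⟨i, by simp, rfl⟩
        rw [this]; rfl
      · intro i _
        rw [hM]
    · have : ∀ a, M x a b = [] := by
        intro a
        by_contra hc
        obtain ⟨_, j, _, rfl⟩ := hM0 _ _ _ hc
        exact hb ⟨j, rfl⟩
      simp [this]
  have k4 : ∀ x i j n, Sum.inr n ∈ M x i j → n < G.intBound x := by
    intro x a b n h
    obtain ⟨i, j, rfl, rfl, h'⟩ := hM1 _ _ _ _ h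
    exact hint _ _ _ _ h'
  obtain ⟨A', h1, h2, h3⟩ := exists_round hA M k1 k2 k3 k4
  refine ⟨A', h1, ?_, ?_⟩
  · intro x y j h
    funext i
    have := h2 x y _ h (G.emb i)
    rwa [hM, hM] at this
  · intro x i j τ h
    exact h3 x _ (G.emb j) τ (by rwa [hM])

/-- One more round in which nodes send sets of tuples to each other. -/
theorem exists_tuple_round {A : Algorithm E dom ℕ p} (hA : G.Good A)
    (S : G.X → G.Node → G.Node → Finset (AnyTuple E dom)) (hdet : G.Knows A S)
    (hheld : ∀ x i j, ∀ τ ∈ S x i j, G.NodeHolds A x i τ)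
    (hload : ∀ x i, ∑ j, (S x j i).card ≤ G.maxLoad x) :
    ∃ A', G.Extends 1 A A' ∧ G.Knows A' (fun x j i => S x i j) ∧
      ∀ x i j, ∀ τ ∈ S x j i, G.NodeHolds A' x i τ := by
  have k1 : G.Knows A (fun x i j => (S x i j).toList.map
      (Sum.inl : _ → AnyTuple E dom ⊕ ℕ)) := by
    intro x y i h
    simp only [hdet x y i h]
  have k2 : ∀ x i j τ, Sum.inl τ ∈ (S x i j).toList.map (Sum.inl : _ → AnyTuple E dom ⊕ ℕ) →
      τ ∈ S x i j := by
    intro x i j τ h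
    obtain ⟨σ, hσ, e⟩ := List.mem_map.mp h
    cases e
    exact Finset.mem_toList.mp hσ
  obtain ⟨A', h1, h2, h3⟩ := exists_node_round hA _ k1
    (fun x i j τ h => hheld _ _ _ _ (k2 _ _ _ _ h)) (fun x i => by simpa using hload x i)
    (fun x i j n h => by
      obtain ⟨σ, hσ, e⟩ := List.mem_map.mp h
      cases e)
  refine ⟨A', h1, ?_, ?_⟩
  · intro x y j h
    funext i
    have h5 := List.map_injective_iff.mpr Sum.inl_injective (congrFun (h2 x y j h) i)
    change S x i j = S y i j
    rw [← Finset.toList_toFinset (S x i j), ← Finset.toList_toFinset (S y i j), h5]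
  · intro x i j τ hτ
    exact h3 x i j τ (List.mem_map_of_mem (Finset.mem_toList.mpr hτ))

end Env

end Protocols


/-! ### Sending values, moving tuples, and summing over blocks of nodes -/

section Values

variable {V : Type u} {E : Query V} {dom : V → Type v} {p m : ℕ}

/-- An encoding of the elements of a commutative monoid by single units of communication, such that
a server which holds the tuples occurring in the codes of two elements also holds those of the code
of the sum. -/
structure UnitCode {V : Type u} (E : Query V) (dom : V → Type v) (M : Type*) [AddCommMonoid M] where
  /-- the unit encoding an element -/
  enc : M → AnyTuple E dom ⊕ ℕ
  enc_inj : Function.Injective enc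
  enc_zero : ∀ τ, enc 0 ≠ Sum.inl τ
  enc_add : ∀ a b τ, enc (a + b) = Sum.inl τ → enc a = Sum.inl τ ∨ enc b = Sum.inl τ

namespace Env

variable {G : Env E dom p m} {M : Type*} [AddCommMonoid M] (c : UnitCode E dom M)

/-- Node `i` holds the tuple in the code of `a`, if there is one. -/
def HoldsVal (A : Algorithm E dom ℕ p) (x : G.X) (i : G.Node) (a : M) : Prop :=
  ∀ τ, c.enc a = Sum.inl τ → G.NodeHolds A x i τ

/-- The integer in the code of `a`, if there is one, may be sent. -/
def IntOK (x : G.X) (a : M) : Prop := ∀ n, c.enc a = Sum.inr n → n < G.intBound x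

variable {c}

/-- The code of a sum contains a tuple only if the code of some summand does, so sums can be formed
locally without creating tuples. -/
theorem HoldsVal.sum {A : Algorithm E dom ℕ p} {x : G.X} {i : G.Node} {ι : Type*} {s : Finset ι}
    {f : ι → M} (h : ∀ a ∈ s, HoldsVal c A x i (f a)) : HoldsVal c A x i (∑ a ∈ s, f a) := by
  induction s using Finset.induction_on with
  | empty => intro τ hτ; exact absurd hτ (c.enc_zero τ)
  | insert a s ha ih =>
    intro τ hτ
    rw [Finset.sum_insert ha] at hτ
    rcases c.enc_add _ _ _ hτ with h1 | h1
    · exact h a (Finset.mem_insert_self _ _) τ h1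
    · exact ih (fun b hb => h b (Finset.mem_insert_of_mem hb)) τ h1

theorem Extends.holdsVal {k : ℕ} {A A' : Algorithm E dom ℕ p} (h : G.Extends k A A')
    {x : G.X} {i : G.Node} {a : M} (hf : HoldsVal c A x i a) : HoldsVal c A' x i a :=
  fun τ hτ => h.nodeHolds (hf τ hτ)

/-- A round in which node `i` sends the values `v x i τ`, `τ ∈ S x i j`, to node `j`, who knows the
set `S x i j` already. -/
theorem exists_value_round {A : Algorithm E dom ℕ p} (hA : G.Good A) {T : Type*}
    (S : G.X → G.Node → G.Node → Finset T) (v : G.X → G.Node → T → M)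
    (hS : G.Knows A S) (hS' : G.Knows A fun x j i => S x i j)
    (hv : ∀ x y i, G.final A x (G.emb i) = G.final A y (G.emb i) →
      ∀ j, ∀ τ ∈ S x i j, v x i τ = v y i τ)
    (hheld : ∀ x i j, ∀ τ ∈ S x i j, HoldsVal c A x i (v x i τ))
    (hint : ∀ x i j, ∀ τ ∈ S x i j, IntOK c x (v x i τ))
    (hload : ∀ x j, ∑ i, (S x i j).card ≤ G.maxLoad x) :
    ∃ A', G.Extends 1 A A' ∧
      (∀ x y j, G.final A' x (G.emb j) = G.final A' y (G.emb j) →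
        ∀ i, ∀ τ ∈ S x i j, v x i τ = v y i τ) ∧
      ∀ x i j, ∀ τ ∈ S x i j, HoldsVal c A' x j (v x i τ) := by
  -- Both ends know `S x i j`, hence its enumeration `toList`; the values are sent bare in this
  -- order, one unit each.
  have k1 : G.Knows A (fun x i j => (S x i j).toList.map fun τ => c.enc (v x i τ)) := by
    intro x y i h
    funext j
    have h1 := congrFun (hS x y i h) j
    have h2 := hv x y i h j
    change (S x i j).toList.map (fun τ => c.enc (v x i τ)) =
      (S y i j).toList.map (fun τ => c.enc (v y i τ))
    rw [← h1]
    apply List.map_congr_left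
    intro τ hτ
    rw [h2 τ (Finset.mem_toList.mp hτ)]
  obtain ⟨A', h1, h2, h3⟩ := exists_node_round hA _ k1
    (fun x i j τ h => by
      obtain ⟨σ, hσ, e⟩ := List.mem_map.mp h
      exact hheld _ _ _ _ (Finset.mem_toList.mp hσ) _ e) (fun x i => by simpa using hload x i)
    (fun x i j n h => by
      obtain ⟨σ, hσ, e⟩ := List.mem_map.mp h
      exact hint _ _ _ _ (Finset.mem_toList.mp hσ) _ e)
  refine ⟨A', h1, ?_, ?_⟩
  · intro x y j h i τ hτ
    have e1 : S x i j = S y i j := congrFun (h1.knows hS' x y j h) i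
    have e2 : (S x i j).toList.map (fun τ => c.enc (v x i τ)) =
      (S y i j).toList.map (fun τ => c.enc (v y i τ)) := congrFun (h2 x y j h) i
    rw [← e1] at e2
    exact c.enc_inj (List.map_inj_left.mp e2 τ (Finset.mem_toList.mpr hτ))
  · intro x i j τ hτ σ hσ
    exact h3 x j i σ (List.mem_map.mpr ⟨τ, Finset.mem_toList.mpr hτ, hσ⟩)

/-! ### Moving tuples and their weights between the nodes -/

variable (c) in
/-- The nodes know and hold the tuples located at them, and know the weights of these tuples. -/
structure Located (A : Algorithm E dom ℕ p) (loc : G.X → G.Node → Finset (AnyTuple E dom))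
    (w : G.X → AnyTuple E dom → M) : Prop where
  knows : G.Knows A loc
  holds : ∀ x i, ∀ τ ∈ loc x i, G.NodeHolds A x i τ
  val : G.KnowsOn A loc fun x _ => w x
  holdsVal : ∀ x i, ∀ τ ∈ loc x i, HoldsVal c A x i (w x τ)

theorem Extends.located {k : ℕ} {A A' : Algorithm E dom ℕ p} (h : G.Extends k A A')
    {loc : G.X → G.Node → Finset (AnyTuple E dom)}
    {w : G.X → AnyTuple E dom → M} (hl : Located c A loc w) : Located c A' loc w :=
  ⟨h.knows hl.knows, fun x i τ hτ => h.nodeHolds (hl.holds x i τ hτ), h.knowsOn hl.val,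
    fun x i τ hτ => h.holdsVal (hl.holdsVal x i τ hτ)⟩

/-- The tuples which move from node `i` to node `j`. -/
noncomputable def movedPart {ι : Type*} {α : Type*} (loc : ι → Finset α) (dest : ι → α → ι)
    (i j : ι) : Finset α := (loc i).filter fun τ => dest i τ = j

theorem mem_movedPart {ι : Type*} {α : Type*} {loc : ι → Finset α} {dest : ι → α → ι}
    {i j : ι} {τ : α} : τ ∈ movedPart loc dest i j ↔ τ ∈ loc i ∧ dest i τ = j := by
  simp [movedPart]

/-- The location of the tuples after a move. -/
noncomputable def moved {ι : Type*} [Fintype ι] {α : Type*} (loc : ι → Finset α)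
    (dest : ι → α → ι) (j : ι) : Finset α :=
  Finset.univ.biUnion fun i => movedPart loc dest i j

theorem mem_moved {ι : Type*} [Fintype ι] {α : Type*} {loc : ι → Finset α}
    {dest : ι → α → ι} {j : ι} {τ : α} :
    τ ∈ moved loc dest j ↔ ∃ i, τ ∈ loc i ∧ dest i τ = j := by
  simp [moved, movedPart]

theorem sum_card_movedPart {ι : Type*} [Fintype ι] {α : Type*} (loc : ι → Finset α)
    (dest : ι → α → ι) (i : ι) : ∑ j, (movedPart loc dest i j).card = (loc i).card := by
  rw [Finset.card_eq_sum_card_fiberwise (f := dest i) (t := Finset.univ) (by simp)]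
  rfl

theorem card_moved {ι : Type*} [Fintype ι] {α : Type*} {loc : ι → Finset α}
    (hdisj : ∀ i j, i ≠ j → Disjoint (loc i) (loc j)) (dest : ι → α → ι) (j : ι) :
    (moved loc dest j).card = ∑ i, (movedPart loc dest i j).card := by
  rw [moved, Finset.card_biUnion]
  intro a _ b _ hab
  exact Finset.disjoint_filter_filter (hdisj a b hab)

theorem disjoint_moved {ι : Type*} [Fintype ι] {α : Type*} {loc : ι → Finset α}
    (hdisj : ∀ i j, i ≠ j → Disjoint (loc i) (loc j)) (dest : ι → α → ι) (i j : ι) (hij : i ≠ j) :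
    Disjoint (moved loc dest i) (moved loc dest j) := by
  rw [Finset.disjoint_left]
  intro τ h1 h2
  obtain ⟨a, ha, rfl⟩ := mem_moved.mp h1
  obtain ⟨b, hb, rfl⟩ := mem_moved.mp h2
  by_cases hab : a = b
  · subst hab; exact hij rfl
  · exact Finset.disjoint_left.mp (hdisj a b hab) ha hb

theorem knows_movedPart {A : Algorithm E dom ℕ p}
    {loc : G.X → G.Node → Finset (AnyTuple E dom)} (hl : G.Knows A loc)
    {dest : G.X → G.Node → AnyTuple E dom → G.Node} (hdest : G.KnowsOn A loc dest) :
    G.Knows A fun x i j => movedPart (loc x) (dest x) i j := by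
  intro x y i h
  funext j
  have h1 := hl x y i h
  ext τ
  simp only [mem_movedPart, ← h1]
  refine and_congr_right fun hτ => ?_
  rw [hdest x y i h τ hτ]

/-- Every node sends its tuples, with their weights, to known destinations. -/
theorem exists_move {A : Algorithm E dom ℕ p} (hA : G.Good A)
    {loc : G.X → G.Node → Finset (AnyTuple E dom)} {w : G.X → AnyTuple E dom → M}
    (hl : Located c A loc w) (hdisj : ∀ x i j, i ≠ j → Disjoint (loc x i) (loc x j))
    (hint : ∀ x τ, IntOK c x (w x τ))
    {dest : G.X → G.Node → AnyTuple E dom → G.Node} (hdest : G.KnowsOn A loc dest)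
    (hload : ∀ x j, (moved (loc x) (dest x) j).card ≤ G.maxLoad x) :
    ∃ A', G.Extends 2 A A' ∧ Located c A' (fun x => moved (loc x) (dest x)) w ∧
      G.Knows A' fun x j i => movedPart (loc x) (dest x) i j := by
  have hpart := knows_movedPart hl.knows hdest
  have hsub : ∀ x i j, movedPart (loc x) (dest x) i j ⊆ loc x i :=
    fun x i j τ hτ => (mem_movedPart.mp hτ).1
  have hload' : ∀ x j, ∑ i, (movedPart (loc x) (dest x) i j).card ≤ G.maxLoad x := by
    intro x j
    rw [← card_moved (hdisj x)]
    exact hload x j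
  -- The tuples travel one round ahead: the receiver needs them to decode the bare list of weights.
  obtain ⟨A₁, e1, k1, h1⟩ := exists_tuple_round hA _ hpart
    (fun x i j τ hτ => hl.holds x i τ (hsub _ _ _ hτ)) hload'
  obtain ⟨A₂, e2, k2, h2⟩ := exists_value_round (c := c) e1.good
    (fun x i j => movedPart (loc x) (dest x) i j) (fun x _ τ => w x τ) (e1.knows hpart) k1
    (fun x y i h j τ hτ => e1.knowsOn hl.val x y i h τ (hsub _ _ _ hτ))
    (fun x i j τ hτ => e1.holdsVal (hl.holdsVal x i τ (hsub _ _ _ hτ)))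
    (fun x i j τ hτ => hint x τ) hload'
  refine ⟨A₂, e1.trans e2, ⟨?_, ?_, ?_, ?_⟩, e2.knows k1⟩
  · intro x y j h
    have := e2.knows k1 x y j h
    simp only [moved]
    congr 1
  · intro x j τ hτ
    obtain ⟨i, hi, hij⟩ := mem_moved.mp hτ
    exact e2.nodeHolds (h1 x j i τ (mem_movedPart.mpr ⟨hi, hij⟩))
  · intro x y j h τ hτ
    obtain ⟨i, hi, hij⟩ := mem_moved.mp hτ
    exact k2 x y j h i τ (mem_movedPart.mpr ⟨hi, hij⟩)
  · intro x j τ hτ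
    obtain ⟨i, hi, hij⟩ := mem_moved.mp hτ
    exact h2 x i j τ (mem_movedPart.mpr ⟨hi, hij⟩)

/-- After a move, pairs of values known at the new locations are sent back to the old ones. -/
theorem exists_moveBack {A : Algorithm E dom ℕ p} (hA : G.Good A)
    {loc : G.X → G.Node → Finset (AnyTuple E dom)}
    {dest : G.X → G.Node → AnyTuple E dom → G.Node}
    (hpart : G.Knows A fun x i j => movedPart (loc x) (dest x) i j)
    (hpart' : G.Knows A fun x j i => movedPart (loc x) (dest x) i j)
    (F : G.X → G.Node → AnyTuple E dom → Bool → M)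
    (hF : G.KnowsOn A (fun x => moved (loc x) (dest x)) F)
    (hheld : ∀ x j, ∀ τ ∈ moved (loc x) (dest x) j, ∀ b, HoldsVal c A x j (F x j τ b))
    (hint : ∀ x j, ∀ τ ∈ moved (loc x) (dest x) j, ∀ b, IntOK c x (F x j τ b))
    (hload : ∀ x i, (loc x i).card * 2 ≤ G.maxLoad x) :
    ∃ A', G.Extends 1 A A' ∧ G.KnowsOn A' loc (fun x i τ => F x (dest x i τ) τ) ∧
      ∀ x i, ∀ τ ∈ loc x i, ∀ b, HoldsVal c A' x i (F x (dest x i τ) τ b) := by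
  have hm : ∀ x i j τ, τ ∈ movedPart (loc x) (dest x) i j → τ ∈ moved (loc x) (dest x) j := by
    intro x i j τ hτ
    exact mem_moved.mpr ⟨i, mem_movedPart.mp hτ⟩
  -- Both ends remember which tuples moved, so only values return, two per tuple.
  obtain ⟨A', e, k, h⟩ := exists_value_round (c := c) hA
    (fun x j i => movedPart (loc x) (dest x) i j ×ˢ (Finset.univ : Finset Bool))
    (fun x j τ => F x j τ.1 τ.2)
    (fun x y j h => by
      have := hpart' x y j h
      funext i
      exact congrArg (· ×ˢ (Finset.univ : Finset Bool)) (congrFun this i))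
    (fun x y i h => by
      have := hpart x y i h
      funext j
      exact congrArg (· ×ˢ (Finset.univ : Finset Bool)) (congrFun this j))
    (fun x y j h i τ hτ => by
      rw [hF x y j h τ.1 (hm _ _ _ _ (Finset.mem_product.mp hτ).1)])
    (fun x j i τ hτ => hheld x j _ (hm _ _ _ _ (Finset.mem_product.mp hτ).1) _)
    (fun x j i τ hτ => hint x j _ (hm _ _ _ _ (Finset.mem_product.mp hτ).1) _)
    (fun x i => by
      simp only [Finset.card_product, Finset.card_univ, Fintype.card_bool]
      rw [← Finset.sum_mul, sum_card_movedPart]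
      exact hload x i)
  refine ⟨A', e, ?_, ?_⟩
  · intro x y i hxy τ hτ
    have hτ' : τ ∈ movedPart (loc x) (dest x) i (dest x i τ) :=
      mem_movedPart.mpr ⟨hτ, rfl⟩
    have hd : dest x i τ = dest y i τ := by
      have := congrFun (e.knows hpart x y i hxy) (dest x i τ)
      beta_reduce at this
      rw [this] at hτ'
      exact (mem_movedPart.mp hτ').2.symm
    funext b
    have := k x y i hxy (dest x i τ) (τ, b) (Finset.mem_product.mpr ⟨hτ', Finset.mem_univ _⟩)
    beta_reduce
    rw [← hd]
    exact this
  · intro x i τ hτ b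
    exact h x (dest x i τ) i (τ, b)
      (Finset.mem_product.mpr ⟨mem_movedPart.mpr ⟨hτ, rfl⟩, Finset.mem_univ _⟩)

/-! ### Blocks of nodes -/

/-- The nodes which agree with `i` in all but the first `d` coordinates. -/
noncomputable def block {s : ℕ} (d : ℕ) (i : Fin m → Fin s) : Finset (Fin m → Fin s) :=
  Finset.univ.filter fun j => ∀ t : Fin m, d ≤ t.val → j t = i t

theorem mem_block {s d : ℕ} {i j : Fin m → Fin s} :
    j ∈ block d i ↔ ∀ t : Fin m, d ≤ t.val → j t = i t := by simp [block]

theorem self_mem_block {s d : ℕ} (i : Fin m → Fin s) : i ∈ block d i :=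
  mem_block.mpr fun _ _ => rfl

theorem block_zero {s : ℕ} (i : Fin m → Fin s) : block 0 i = {i} := by
  ext j
  simp [mem_block, funext_iff]

theorem block_top {s : ℕ} (i : Fin m → Fin s) : block m i = Finset.univ := by
  ext j
  simp only [mem_block, Finset.mem_univ, iff_true]
  intro t ht
  omega

theorem block_eq {s d : ℕ} {i j : Fin m → Fin s} (h : j ∈ block d i) : block d j = block d i := by
  ext k
  rw [mem_block] at *
  simp only [mem_block]
  constructor
  · intro hk t ht; rw [hk t ht, h t ht]
  · intro hk t ht; rw [hk t ht, h t ht]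

theorem update_mem_block {s d : ℕ} {t : Fin m} (ht : t.val < d) (i : Fin m → Fin s) (a : Fin s) :
    Function.update i t a ∈ block d i := by
  rw [mem_block]
  intro r hr
  rw [Function.update_of_ne]
  rintro rfl
  omega

theorem filter_block_succ {s : ℕ} (t : Fin m) (i : Fin m → Fin s) (a : Fin s) :
    ((block (t.val + 1) i).filter fun j => j t = a) = block t.val (Function.update i t a) := by
  ext j
  simp only [Finset.mem_filter, mem_block]
  constructor
  · rintro ⟨h, rfl⟩ r hr
    by_cases hrt : r = t
    · subst hrt; simp
    · rw [Function.update_of_ne hrt]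
      apply h
      have : r.val ≠ t.val := fun h => hrt (Fin.ext h)
      omega
  · intro h
    refine ⟨fun r hr => ?_, ?_⟩
    · rw [h r (by omega), Function.update_of_ne]
      rintro rfl
      omega
    · rw [h t le_rfl]; simp

/-- A block of dimension `t + 1` consists of `s` blocks of dimension `t`, one for each value of the
coordinate `t`. -/
theorem sum_block_succ {s : ℕ} (t : Fin m) (i : Fin m → Fin s) {N : Type*} [AddCommMonoid N]
    (f : (Fin m → Fin s) → N) :
    ∑ j ∈ block (t.val + 1) i, f j = ∑ a, ∑ j ∈ block t.val (Function.update i t a), f j := by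
  rw [← Finset.sum_fiberwise (block (t.val + 1) i) (fun j => j t)]
  simp only [filter_block_succ]

/-- All nodes learn the sum of the values of the nodes of their block. -/
theorem exists_allReduce {A : Algorithm E dom ℕ p} (hA : G.Good A) {T : Type*} [Fintype T]
    (f : G.X → G.Node → T → M) (hf : G.Knows A f)
    (hheld : ∀ x i t, HoldsVal c A x i (f x i t))
    (hint : ∀ x d i t, IntOK c x (∑ j ∈ block d i, f x j t))
    (hload : ∀ x, G.s * Fintype.card T ≤ G.maxLoad x) (d : ℕ) (hd : d ≤ m) :
    ∃ A', G.Extends d A A' ∧ G.Knows A' (fun x i t => ∑ j ∈ block d i, f x j t) ∧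
      ∀ x i t, HoldsVal c A' x i (∑ j ∈ block d i, f x j t) := by
  induction d with
  | zero =>
    refine ⟨A, Extends.refl hA, ?_, ?_⟩
    · simpa only [block_zero, Finset.sum_singleton] using hf
    · simpa only [block_zero, Finset.sum_singleton] using hheld
  | succ d ih =>
    obtain ⟨A₁, e1, k1, h1⟩ := ih (by omega)
    let t : Fin m := ⟨d, by omega⟩
    -- Exchange along the line through `j` in direction `t`: its `s` nodes hold the sums over the
    -- `s` subblocks. A node thus hears from only `s` nodes in a round.
    let S : G.X → G.Node → G.Node → Finset T := fun _ i j =>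
      if ∃ a, i = Function.update j t a then Finset.univ else ∅
    obtain ⟨A₂, e2, k2, h2⟩ := exists_value_round (c := c) e1.good S
      (fun x i r => ∑ j ∈ block d i, f x j r) (fun _ _ _ _ => rfl) (fun _ _ _ _ => rfl)
      (fun x y i h j τ _ => congrFun (k1 x y i h) τ) (fun x i j τ _ => h1 x i τ)
      (fun x i j τ _ => hint x d i τ)
      (fun x j => by
        have : ∀ i, (S x i j).card =
            if i ∈ Finset.univ.image (fun a => Function.update j t a) then Fintype.card T else 0 := by
          intro i
          simp only [S, Finset.mem_image, Finset.mem_univ, true_and, eq_comm (a := i)]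
          split_ifs <;> simp
        simp only [this]
        rw [Finset.sum_ite_mem, Finset.univ_inter, Finset.sum_const, smul_eq_mul]
        refine le_trans (Nat.mul_le_mul_right _ Finset.card_image_le) ?_
        simpa using hload x)
    have hS : ∀ x j a r, r ∈ S x (Function.update j t a) j := by
      intro x j a r
      simp only [S]
      rw [if_pos ⟨a, rfl⟩]
      exact Finset.mem_univ _
    refine ⟨A₂, e1.trans e2, ?_, ?_⟩
    · intro x y j h
      funext r
      have := sum_block_succ t j (fun j => f x j r)
      have h' := sum_block_succ t j (fun j => f y j r)
      simp only [t] at this h'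
      simp only
      rw [this, h']
      refine Finset.sum_congr rfl fun a _ => ?_
      exact k2 x y j h _ r (hS x j a r)
    · intro x j r
      have := sum_block_succ t j (fun j => f x j r)
      simp only [t] at this
      rw [this]
      exact HoldsVal.sum fun a _ => h2 x _ j r (hS x j a r)

end Env

end Values


/-! ### Equidistributing and splitting ordered sets -/

section Dealing

variable {α : Type*} [LinearOrder α]

/-- The number of elements of `S` below `a`. -/
def rank (S : Finset α) (a : α) : ℕ := (S.filter (· < a)).card

theorem rank_lt_rank {S : Finset α} {a b : α} (ha : a ∈ S) (hab : a < b) : rank S a < rank S b := by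
  apply Finset.card_lt_card
  refine Finset.ssubset_iff_of_subset ?_ |>.mpr ⟨a, by simp [ha, hab], by simp⟩
  intro c hc
  simp only [Finset.mem_filter] at *
  exact ⟨hc.1, hc.2.trans hab⟩

theorem rank_injOn (S : Finset α) : Set.InjOn (rank S) S := by
  intro a ha b hb h
  rcases lt_trichotomy a b with h1 | h1 | h1
  · exact absurd h (rank_lt_rank ha h1).ne
  · exact h1
  · exact absurd h (ne_of_lt (rank_lt_rank hb h1)).symm

/-- Ranks enumerate initial segments. -/
theorem card_filter_rank (S : Finset α) {P : α → Prop} (hP : ∀ a b, a ≤ b → P b → P a)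
    (Q : ℕ → Prop) : (S.filter fun a => P a ∧ Q (rank S a)).card =
      ((Finset.range (S.filter P).card).filter Q).card := by
  have himg : (S.filter P).image (rank S) = Finset.range (S.filter P).card := by
    apply Finset.eq_of_subset_of_card_le
    · intro r hr
      obtain ⟨a, ha, rfl⟩ := Finset.mem_image.mp hr
      rw [Finset.mem_filter] at ha
      rw [Finset.mem_range]
      apply Finset.card_lt_card
      refine Finset.ssubset_iff_of_subset ?_ |>.mpr ⟨a, by simp [ha], by simp⟩
      intro c hc
      simp only [Finset.mem_filter] at *
      exact ⟨hc.1, hP c a hc.2.le ha.2⟩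
    · rw [Finset.card_range, Finset.card_image_of_injOn]
      exact (rank_injOn S).mono (by intro a ha; simp at ha; exact ha.1)
  rw [← himg, Finset.filter_image, Finset.card_image_of_injOn, Finset.filter_filter]
  exact (rank_injOn S).mono (by intro a ha; simp at ha; exact ha.1.1)

/-- Each residue occurs `c / s` times among the numbers below `c`, up to one. Without division the
bounds can be summed over a line of nodes. -/
theorem mul_card_filter_mod_le {s z : ℕ} (c : ℕ) (hz : z < s) :
    s * ((Finset.range c).filter fun r => r % s = z).card ≤ c + s ∧
      c ≤ s * ((Finset.range c).filter fun r => r % s = z).card + s := by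
  have h : ((Finset.range c).filter fun r => r % s = z).card =
      c / s + if z % s < c % s then 1 else 0 := by
    rw [← Nat.count_modEq_card c (by omega : 0 < s) z, Nat.count_eq_card_filter_range]
    congr 1
    apply Finset.filter_congr
    intro r _
    rw [Nat.ModEq, Nat.mod_eq_of_lt hz]
  rw [h]
  have h1 := Nat.div_add_mod c s
  have h2 := Nat.mod_lt c (by omega : 0 < s)
  split_ifs with h3
  · rw [mul_add, mul_one]
    constructor <;> omega
  · rw [add_zero]
    constructor <;> omega

variable {m s : ℕ}

open Env

/-- The destination of `a ∈ loc i` when the elements at each node are dealt out in increasing order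
along the coordinate `t`. -/
def dealDest (loc : (Fin m → Fin s) → Finset α) (t : Fin m) (i : Fin m → Fin s) (a : α) :
    Fin m → Fin s :=
  Function.update i t ⟨rank (loc i) a % s, Nat.mod_lt _ (i t).pos⟩

/-- The new location of the elements after dealing along coordinate `t`. -/
noncomputable def deal (loc : (Fin m → Fin s) → Finset α) (t : Fin m) :
    (Fin m → Fin s) → Finset α := moved loc (dealDest loc t)

/-- A function that vanishes outside of a line of nodes is summed along that line. -/
theorem sum_eq_sum_line {N : Type*} [AddCommMonoid N] (t : Fin m) (j : Fin m → Fin s)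
    (f : (Fin m → Fin s) → N) (hf : ∀ i, (∀ a, Function.update j t a ≠ i) → f i = 0) :
    ∑ i, f i = ∑ a, f (Function.update j t a) := by
  symm
  apply Finset.sum_of_injOn (fun a => Function.update j t a)
  · exact (Function.update_injective j t).injOn
  · simp
  · intro i _ hi
    apply hf
    intro a ha
    exact hi ⟨a, by simp, ha⟩
  · simp

theorem card_filter_moved {ι : Type*} [Fintype ι] {loc : ι → Finset α}
    (hdisj : ∀ i j, i ≠ j → Disjoint (loc i) (loc j)) (dest : ι → α → ι) (j : ι) (P : α → Prop) :
    ((moved loc dest j).filter P).card =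
      ∑ i, ((loc i).filter fun a => P a ∧ dest i a = j).card := by
  have : (moved loc dest j).filter P =
      Finset.univ.biUnion fun i => (loc i).filter fun a => P a ∧ dest i a = j := by
    ext a
    simp only [Finset.mem_filter, mem_moved, Finset.mem_biUnion, Finset.mem_univ, true_and]
    constructor
    · rintro ⟨⟨i, h1, h2⟩, h3⟩
      exact ⟨i, h1, h3, h2⟩
    · rintro ⟨i, h1, h3, h2⟩
      exact ⟨⟨i, h1, h2⟩, h3⟩
  rw [this, Finset.card_biUnion]
  intro a _ b _ hab
  exact Finset.disjoint_filter_filter (hdisj a b hab)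

/-- At each node an initial segment `P` occupies exactly the first ranks, so what `j` receives of it
depends only on the numbers of its elements at the nodes of the line. -/
theorem card_filter_deal {loc : (Fin m → Fin s) → Finset α}
    (hdisj : ∀ i j, i ≠ j → Disjoint (loc i) (loc j)) (t : Fin m) {P : α → Prop}
    (hP : ∀ a b, a ≤ b → P b → P a) (j : Fin m → Fin s) :
    ((deal loc t j).filter P).card = ∑ a, ((Finset.range
      ((loc (Function.update j t a)).filter P).card).filter fun r => r % s = (j t).val).card := by
  rw [deal, card_filter_moved hdisj, sum_eq_sum_line t j]
  · refine Finset.sum_congr rfl fun a _ => ?_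
    have hc := card_filter_rank (loc (Function.update j t a)) hP fun r => r % s = (j t).val
    refine Eq.trans ?_ (hc.trans (by congr!))
    congr 1
    ext b
    simp only [Finset.mem_filter]
    refine and_congr_right fun _ => and_congr_right fun _ => ?_
    rw [dealDest, Function.update_idem]
    constructor
    · intro h
      have := congrFun h t
      rw [Function.update_self] at this
      rw [← this]
    · intro h
      conv_rhs => rw [← Function.update_eq_self t j]
      congr 1
      exact Fin.ext h
  · intro i hi
    rw [Finset.card_eq_zero, Finset.eq_empty_iff_forall_notMem]
    intro a ha
    simp only [Finset.mem_filter] at ha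
    obtain ⟨_, _, h⟩ := ha
    apply hi (i t)
    rw [← h, dealDest, Function.update_idem, Function.update_eq_self]

/-- Inside each block of dimension `d`, the numbers of elements of the nodes in any initial segment
differ by at most `δ`. -/
def EquiDist (loc : (Fin m → Fin s) → Finset α) (d δ : ℕ) : Prop :=
  ∀ P : α → Prop, (∀ a b, a ≤ b → P b → P a) → ∀ i, ∀ j ∈ block d i,
    ((loc i).filter P).card ≤ ((loc j).filter P).card + δ

theorem equiDist_zero (loc : (Fin m → Fin s) → Finset α) : EquiDist loc 0 0 := by
  intro P _ i j hj
  rw [block_zero, Finset.mem_singleton] at hj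
  rw [hj]
  rfl

/-- The nodes of the lines through `j` and `j'` with the same coordinate `t` lie in a common block
of dimension `t`, so their counts differ by at most `δ`. Rounding costs one element per node of
either line, together `2 * s`. -/
theorem EquiDist.deal {loc : (Fin m → Fin s) → Finset α}
    (hdisj : ∀ i j, i ≠ j → Disjoint (loc i) (loc j)) {t : Fin m} {δ : ℕ}
    (h : EquiDist loc t.val δ) : EquiDist (deal loc t) (t.val + 1) (δ + 2 * s) := by
  intro P hP j j' hj
  have hs : 0 < s := (j t).pos
  rw [card_filter_deal hdisj t hP, card_filter_deal hdisj t hP]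
  apply Nat.le_of_mul_le_mul_left _ hs
  rw [Finset.mul_sum, mul_add, Finset.mul_sum]
  have e : s * (δ + 2 * s) = ∑ _a : Fin s, (δ + 2 * s) := by simp
  rw [e, ← Finset.sum_add_distrib]
  apply Finset.sum_le_sum
  intro a _
  have h1 := (mul_card_filter_mod_le ((loc (Function.update j t a)).filter P).card (j t).isLt).1
  have h2 := (mul_card_filter_mod_le ((loc (Function.update j' t a)).filter P).card (j' t).isLt).2
  have h3 := h P hP (Function.update j t a) (Function.update j' t a) (by
    rw [← filter_block_succ, Finset.mem_filter]
    refine ⟨?_, by simp⟩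
    rw [← block_eq hj]
    exact update_mem_block (by omega) _ _)
  omega

theorem card_deal_le {loc : (Fin m → Fin s) → Finset α}
    (hdisj : ∀ i j, i ≠ j → Disjoint (loc i) (loc j)) (t : Fin m) {n : ℕ}
    (hn : ∀ i, (loc i).card ≤ n) (j : Fin m → Fin s) : (deal loc t j).card ≤ n + s := by
  have hs : 0 < s := (j t).pos
  have := card_filter_deal hdisj t (P := fun _ => True) (by simp) j
  simp only [Finset.filter_true] at this
  rw [this]
  apply Nat.le_of_mul_le_mul_left _ hs
  rw [Finset.mul_sum]
  have e : s * (n + s) = ∑ _a : Fin s, (n + s) := by simp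
  rw [e]
  apply Finset.sum_le_sum
  intro a _
  have h1 := (mul_card_filter_mod_le (loc (Function.update j t a)).card (j t).isLt).1
  have := hn (Function.update j t a)
  omega

/-! ### Splitters -/

/-- Every `(|S| / s + 1)`-th element of `S`. -/
def splitters (S : Finset α) (s : ℕ) : Finset α :=
  S.filter fun a => (S.card / s + 1) ∣ rank S a + 1

/-- The `+ 1` in the step width keeps the number strictly below `s`, so that the buckets can be
numbered by the `s` values of a coordinate. -/
theorem card_splitters_lt (S : Finset α) {s : ℕ} (hs : 0 < s) : (splitters S s).card < s := by
  have := card_filter_rank S (P := fun _ => True) (by simp) (fun r => (S.card / s + 1) ∣ r + 1)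
  simp only [true_and, Finset.filter_true] at this
  have h2 := Nat.card_multiples S.card (S.card / s + 1)
  have h3 : S.card / (S.card / s + 1) < s := by
    rw [Nat.div_lt_iff_lt_mul (Nat.succ_pos _)]
    exact Nat.lt_mul_div_succ _ hs
  calc (splitters S s).card = S.card / (S.card / s + 1) := by
        rw [← h2, splitters]
        exact this.trans (by congr!)
    _ < s := h3

end Dealing

/-! ### Classes of keys cut out by splitters -/

section Classes

variable {α : Type*} {K : Type*} [LinearOrder K] (κ : α → K) {s : ℕ}

/-- The number of splitters with a smaller key. -/
noncomputable def bucket (Z : Finset α) (a : α) : ℕ := (Z.filter fun z => κ z < κ a).card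

/-- There is a splitter with the same key. -/
def Hit (Z : Finset α) (a : α) : Prop := ∃ z ∈ Z, κ z = κ a

variable {κ}

theorem bucket_lt_of_card {Z : Finset α} (hZ : Z.card < s) (a : α) : bucket κ Z a < s :=
  (Finset.card_filter_le _ _).trans_lt hZ

theorem bucket_mono {Z : Finset α} {a b : α} (h : κ a ≤ κ b) : bucket κ Z a ≤ bucket κ Z b := by
  apply Finset.card_le_card
  intro z hz
  simp only [Finset.mem_filter] at *
  exact ⟨hz.1, hz.2.trans_le h⟩

theorem bucket_lt_bucket {Z : Finset α} {a b : α} (h : κ a < κ b) (ha : Hit κ Z a) :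
    bucket κ Z a < bucket κ Z b := by
  obtain ⟨z, hz, e⟩ := ha
  apply Finset.card_lt_card
  refine Finset.ssubset_iff_of_subset ?_ |>.mpr ⟨z, by simp [hz, e, h], by simp [e]⟩
  intro z hz
  simp only [Finset.mem_filter] at *
  exact ⟨hz.1, hz.2.trans h⟩

theorem filter_eq_of_bucket_eq {Z : Finset α} {a b : α} (h : bucket κ Z a = bucket κ Z b) :
    (Z.filter fun z => κ z < κ a) = Z.filter fun z => κ z < κ b := by
  rcases le_total (κ a) (κ b) with hab | hab
  · apply Finset.eq_of_subset_of_card_le _ h.ge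
    intro z hz
    simp only [Finset.mem_filter] at *
    exact ⟨hz.1, hz.2.trans_le hab⟩
  · symm
    apply Finset.eq_of_subset_of_card_le _ h.le
    intro z hz
    simp only [Finset.mem_filter] at *
    exact ⟨hz.1, hz.2.trans_le hab⟩

/-! ### Sums below a key, by classes -/

variable (κ) in
/-- The class of `a`: elements between consecutive splitters are in one class, and elements with the
same key as a splitter are in one class. -/
noncomputable def keyClass (Z : Finset α) (a : α) : ℕ := 2 * bucket κ Z a + if Hit κ Z a then 1 else 0

theorem keyClass_lt {Z : Finset α} (hZ : Z.card < s) (a : α) : keyClass κ Z a < 2 * s := by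
  have := bucket_lt_of_card (κ := κ) hZ a
  rw [keyClass]
  split_ifs <;> omega

theorem keyClass_congr {Z : Finset α} {a b : α} (h : κ a = κ b) :
    keyClass κ Z a = keyClass κ Z b := by
  have : Hit κ Z a ↔ Hit κ Z b := by simp only [Hit, h]
  simp only [keyClass, bucket, h, this]

theorem bucket_eq_of_keyClass_eq {Z : Finset α} {a b : α} (h : keyClass κ Z a = keyClass κ Z b) :
    bucket κ Z a = bucket κ Z b ∧ (Hit κ Z a ↔ Hit κ Z b) := by
  rw [keyClass, keyClass] at h
  split_ifs at h with h1 h2 h2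
  · exact ⟨by omega, by tauto⟩
  · omega
  · omega
  · exact ⟨by omega, by tauto⟩

/-- A larger key lies beyond the splitter and has a larger `bucket`. So a class with a splitter's
key consists of one key, however many tuples have it. -/
theorem eq_of_keyClass_eq {Z : Finset α} {a b : α} (h : keyClass κ Z a = keyClass κ Z b)
    (hb : Hit κ Z b) : κ a = κ b := by
  obtain ⟨h1, h2⟩ := bucket_eq_of_keyClass_eq h
  rcases lt_trichotomy (κ a) (κ b) with h3 | h3 | h3
  · exact absurd h1 (bucket_lt_bucket h3 (h2.mpr hb)).ne
  · exact h3
  · exact absurd h1 (bucket_lt_bucket h3 hb).ne'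

theorem lt_of_keyClass_lt {Z : Finset α} {a b : α} (h : keyClass κ Z a < keyClass κ Z b) :
    κ a < κ b := by
  by_contra hc
  rcases (not_lt.mp hc).eq_or_lt with h1 | h1
  · exact absurd h (keyClass_congr h1).le.not_gt
  · have h2 := bucket_mono (Z := Z) h1.le
    by_cases hb : Hit κ Z b
    · have h3 := bucket_lt_bucket h1 hb
      rw [keyClass, keyClass] at h
      split_ifs at h <;> omega
    · rw [keyClass, keyClass, if_neg hb] at h
      omega

/-- Classes are intervals of keys in increasing order: lower classes enter only through their
totals, and keys need to be compared only within the class of `a`. -/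
theorem sum_lt_eq {N : Type*} [AddCommMonoid N] (W : Finset α) (w : α → N) (Z : Finset α) (a : α) :
    ∑ b ∈ W.filter (fun b => κ b < κ a), w b =
      ∑ b ∈ W.filter (fun b => keyClass κ Z b < keyClass κ Z a), w b +
      ∑ b ∈ (W.filter fun b => keyClass κ Z b = keyClass κ Z a).filter (fun b => κ b < κ a), w b := by
  rw [← Finset.sum_union]
  · congr 1
    ext b
    simp only [Finset.mem_filter, Finset.mem_union]
    have h1 := @lt_of_keyClass_lt _ _ _ κ Z b a
    have h2 := @lt_of_keyClass_lt _ _ _ κ Z a b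
    constructor
    · rintro ⟨hb, h⟩
      rcases lt_trichotomy (keyClass κ Z b) (keyClass κ Z a) with h3 | h3 | h3
      · exact Or.inl ⟨hb, h3⟩
      · exact Or.inr ⟨⟨hb, h3⟩, h⟩
      · exact absurd h (h2 h3).not_gt
    · rintro (⟨hb, h⟩ | ⟨⟨hb, _⟩, h⟩)
      · exact ⟨hb, h1 h⟩
      · exact ⟨hb, h⟩
  · rw [Finset.disjoint_left]
    intro b hb hb'
    simp only [Finset.mem_filter] at hb hb'
    omega

theorem sum_eq_eq {N : Type*} [AddCommMonoid N] (W : Finset α) (w : α → N) (Z : Finset α) (a : α) :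
    ∑ b ∈ W.filter (fun b => κ b = κ a), w b =
      ∑ b ∈ (W.filter fun b => keyClass κ Z b = keyClass κ Z a).filter (fun b => κ b = κ a), w b := by
  congr 1
  ext b
  simp only [Finset.mem_filter]
  have h1 := @keyClass_congr _ _ _ κ Z b a
  tauto

end Classes

/-! ### Sizes of the buckets between splitters -/

section Buckets

variable {α : Type*} [LinearOrder α] {K : Type*} [LinearOrder K] {κ : α → K} {m s : ℕ}

open Env

/-- Few elements at the node which selects the splitters lie between two consecutive splitters. -/
theorem card_bucket_le_self (hκ : Monotone κ) (S : Finset α) (s b : ℕ) :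
    (S.filter fun a => ¬ Hit κ (splitters S s) a ∧ bucket κ (splitters S s) a = b).card ≤
      S.card / s + 1 := by
  set t := S.card / s + 1 with ht
  -- If no splitter shares the key of `a`, the splitters with smaller keys are those of smaller
  -- rank, one for each positive multiple of `t` up to `rank S a`. So a bucket is an interval of `t`
  -- ranks.
  have hb : ∀ a, ¬ Hit κ (splitters S s) a → bucket κ (splitters S s) a = rank S a / t := by
    intro a hnot
    have := card_filter_rank S (P := fun z => z < a) (fun x y h h' => h.trans_lt h')
      (fun r => t ∣ r + 1)
    have h2 := Nat.card_multiples (rank S a) t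
    rw [← h2, bucket, splitters, Finset.filter_filter]
    refine Eq.trans ?_ (this.trans (by rw [rank]; congr!))
    congr 1
    ext z
    simp only [Finset.mem_filter]
    refine and_congr_right fun hz => ?_
    rw [and_comm]
    refine and_congr_left fun hz' => ?_
    constructor
    · intro h
      by_contra h'
      exact absurd h (not_lt.mpr (hκ (not_lt.mp h')))
    · intro h
      refine lt_of_le_of_ne (hκ h.le) fun e => hnot ⟨z, ?_, e⟩
      exact Finset.mem_filter.mpr ⟨hz, hz'⟩
  calc _ ≤ (Finset.Ico (b * t) (b * t + t)).card := by
        apply Finset.card_le_card_of_injOn (rank S)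
        · intro a ha
          simp only [Finset.coe_filter, Set.mem_ofPred_eq] at ha
          obtain ⟨_, h1, h2⟩ := ha
          rw [hb a h1] at h2
          simp only [Finset.coe_Ico, Set.mem_Ico]
          have h3 := Nat.div_add_mod (rank S a) t
          have ht0 : 0 < t := Nat.succ_pos _
          have h4 := Nat.mod_lt (rank S a) ht0
          rw [h2, mul_comm] at h3
          exact ⟨by omega, by omega⟩
        · exact (rank_injOn S).mono (by intro a ha; simp at ha; exact ha.1)
    _ = t := by simp

/-- A bucket is the difference of two initial segments. `EquiDist` compares each of them with its
counterpart at the node `i` that chose the splitters, hence `2 * δ`. -/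
theorem card_bucket_le (hκ : Monotone κ) {loc : (Fin m → Fin s) → Finset α} {d δ : ℕ}
    (h : EquiDist loc d δ) {i j : Fin m → Fin s} (hj : j ∈ block d i) (b : ℕ) :
    ((loc j).filter fun a => ¬ Hit κ (splitters (loc i) s) a ∧
      bucket κ (splitters (loc i) s) a = b).card ≤ (loc i).card / s + 1 + 2 * δ := by
  set Z := splitters (loc i) s with hZ
  rcases Finset.eq_empty_or_nonempty ((loc j).filter fun a => ¬ Hit κ Z a ∧ bucket κ Z a = b)
    with h0 | ⟨τ, hτ⟩
  · rw [h0]; simp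
  rw [Finset.mem_filter] at hτ
  obtain ⟨-, hτ1, rfl⟩ := hτ
  -- `P₁` ends before the next splitter key above that of `τ`, and `P₀` ends with the last splitter
  -- key below it.
  obtain ⟨P₁, eP₁⟩ : ∃ P : α → Prop, P = fun a => ∀ z ∈ Z, κ τ < κ z → κ a < κ z := ⟨_, rfl⟩
  obtain ⟨P₀, eP₀⟩ : ∃ P : α → Prop, P = fun a => ∃ z ∈ Z, κ z < κ τ ∧ κ a ≤ κ z := ⟨_, rfl⟩
  have hP₁ : ∀ a b, a ≤ b → P₁ b → P₁ a := by
    rw [eP₁]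
    exact fun a b hab hb z hz hz' => (hκ hab).trans_lt (hb z hz hz')
  have hP₀ : ∀ a b, a ≤ b → P₀ b → P₀ a := by
    rw [eP₀]
    rintro a b hab ⟨z, hz, h1, h2⟩
    exact ⟨z, hz, h1, (hκ hab).trans h2⟩
  have h01 : ∀ a, P₀ a → P₁ a := by
    rw [eP₀, eP₁]
    rintro a ⟨z, hz, h1, h2⟩ z' _ h'
    exact h2.trans_lt (h1.trans h')
  have hset : ∀ a, (¬ Hit κ Z a ∧ bucket κ Z a = bucket κ Z τ) ↔ P₁ a ∧ ¬ P₀ a := by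
    intro a
    rw [eP₀, eP₁]
    constructor
    · rintro ⟨hn, he⟩
      have he := filter_eq_of_bucket_eq he
      constructor
      · intro z hz hz'
        have : z ∉ Z.filter fun z => κ z < κ a := by
          rw [he]; simp [hz'.le]
        simp only [Finset.mem_filter, hz, true_and, not_lt] at this
        exact lt_of_le_of_ne this fun e => hn ⟨z, hz, e.symm⟩
      · rintro ⟨z, hz, h1, h2⟩
        have : z ∈ Z.filter fun z => κ z < κ a := by
          rw [he]; simp [hz, h1]
        simp only [Finset.mem_filter, hz, true_and] at this
        exact absurd h2 (not_le.mpr this)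
    · rintro ⟨h1, h0⟩
      have key : ∀ z ∈ Z, (κ z < κ τ → κ z < κ a) ∧ (κ τ < κ z → κ a < κ z) := by
        intro z hz
        refine ⟨fun hlt => ?_, h1 z hz⟩
        by_contra hc
        exact h0 ⟨z, hz, hlt, not_lt.mp hc⟩
      have hne : ∀ z ∈ Z, κ z < κ τ ∨ κ τ < κ z := by
        intro z hz
        exact lt_or_gt_of_ne fun e => hτ1 ⟨z, hz, e⟩
      constructor
      · rintro ⟨z, hz, e⟩
        rcases hne z hz with hh | hh
        · exact absurd e ((key z hz).1 hh).ne
        · exact absurd e ((key z hz).2 hh).ne'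
      · rw [bucket, bucket]
        congr 1
        apply Finset.filter_congr
        intro z hz
        constructor
        · intro hlt
          rcases hne z hz with hh | hh
          · exact hh
          · exact absurd hlt ((key z hz).2 hh).not_gt
        · exact (key z hz).1
  have hcard : ∀ S : Finset α, (S.filter fun a => ¬ Hit κ Z a ∧ bucket κ Z a = bucket κ Z τ).card +
      (S.filter P₀).card = (S.filter P₁).card := by
    intro S
    rw [← Finset.card_union_of_disjoint]
    · congr 1
      ext a
      simp only [Finset.mem_union, Finset.mem_filter, hset]
      have := h01 a
      tauto
    · rw [Finset.disjoint_filter]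
      intro a _ ha h0
      exact ((hset a).mp ha).2 h0
  have e1 := hcard (loc i)
  have e2 := hcard (loc j)
  have e3 := h P₁ hP₁ j i (by rw [block_eq hj]; exact self_mem_block i)
  have e4 := h P₀ hP₀ i j hj
  have e5 := card_bucket_le_self hκ (loc i) s (bucket κ Z τ)
  rw [← hZ] at e5
  omega

end Buckets


/-! ### Sums over the tuples with smaller or equal keys -/

section Prefix

/-- The sum of `w` over the elements of `W` whose key is equal to (`true`) or less than (`false`)
that of `a`. -/
noncomputable def keySum {α K N : Type*} [LinearOrder K] [AddCommMonoid N] (κ : α → K)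
    (W : Finset α) (w : α → N) (a : α) : Bool → N
  | true => ∑ b ∈ W.filter (fun b => κ b = κ a), w b
  | false => ∑ b ∈ W.filter (fun b => κ b < κ a), w b

/-- The elements located in the block of `i`. -/
noncomputable def blockItems {α : Type*} {m s : ℕ} (loc : (Fin m → Fin s) → Finset α) (d : ℕ)
    (i : Fin m → Fin s) : Finset α := (Env.block d i).biUnion loc

theorem mem_blockItems {α : Type*} {m s : ℕ} {loc : (Fin m → Fin s) → Finset α} {d : ℕ}
    {i : Fin m → Fin s} {a : α} : a ∈ blockItems loc d i ↔ ∃ j ∈ Env.block d i, a ∈ loc j := by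
  simp [blockItems]

theorem blockItems_moved {α : Type*} {m s : ℕ} {loc : (Fin m → Fin s) → Finset α} {d : ℕ}
    {dest : (Fin m → Fin s) → α → (Fin m → Fin s)} (h : ∀ i, ∀ a ∈ loc i, dest i a ∈ Env.block d i)
    (i : Fin m → Fin s) : blockItems (Env.moved loc dest) d i = blockItems loc d i := by
  ext a
  simp only [mem_blockItems, Env.mem_moved]
  constructor
  · rintro ⟨j, hj, k, hk, rfl⟩
    refine ⟨k, ?_, hk⟩
    rw [← Env.block_eq hj, Env.block_eq (h k a hk)]
    exact Env.self_mem_block k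
  · rintro ⟨k, hk, ha⟩
    refine ⟨dest k a, ?_, k, ha, rfl⟩
    rw [← Env.block_eq hk]
    exact h k a ha

theorem blockItems_congr {α : Type*} {m s : ℕ} {loc : (Fin m → Fin s) → Finset α} {d : ℕ}
    {i j : Fin m → Fin s} (h : j ∈ Env.block d i) : blockItems loc d j = blockItems loc d i := by
  rw [blockItems, blockItems, Env.block_eq h]

theorem sum_block_eq {α N : Type*} [AddCommMonoid N] {m s : ℕ} {loc : (Fin m → Fin s) → Finset α}
    (hdisj : ∀ i j, i ≠ j → Disjoint (loc i) (loc j)) (B : Finset (Fin m → Fin s))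
    {S : (Fin m → Fin s) → Finset α} (hS : ∀ j, S j ⊆ loc j) (w : α → N) :
    ∑ j ∈ B, ∑ a ∈ S j, w a = ∑ a ∈ B.biUnion S, w a := by
  rw [Finset.sum_biUnion]
  intro i _ j _ hij
  exact Finset.disjoint_of_subset_left (hS i) (Finset.disjoint_of_subset_right (hS j) (hdisj i j hij))

variable {V : Type u} {E : Query V} {dom : V → Type v} {p m : ℕ}

namespace Env

variable {G : Env E dom p m} {M : Type*} [AddCommMonoid M] {c : UnitCode E dom M}
  {K : Type*} [LinearOrder K]

variable (c) in
/-- Within `k` rounds, every node can compute for all of its tuples the sums of the weights over the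
tuples of its block with smaller or equal keys. -/
def Solves (κ : AnyTuple E dom → K) (k : ℕ) (loc : G.X → G.Node → Finset (AnyTuple E dom))
    (w : G.X → AnyTuple E dom → M) (d : ℕ) : Prop :=
  ∀ A, G.Good A → Located c A loc w → ∃ A', G.Extends k A A' ∧
    G.KnowsOn A' loc (fun x i τ => keySum κ (blockItems (loc x) d i) (w x) τ) ∧
    ∀ x i, ∀ τ ∈ loc x i, ∀ b,
      HoldsVal c A' x i (keySum κ (blockItems (loc x) d i) (w x) τ b)

theorem solves_zero (κ : AnyTuple E dom → K) (loc : G.X → G.Node → Finset (AnyTuple E dom))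
    (w : G.X → AnyTuple E dom → M) : Solves c κ 0 loc w 0 := by
  have hb : ∀ x i, blockItems (loc x) 0 i = loc x i := by
    intro x i
    simp [blockItems, block_zero]
  intro A hA hl
  refine ⟨A, Extends.refl hA, ?_, ?_⟩
  · intro x y i h τ hτ
    have h1 := hl.knows x y i h
    have h2 := hl.val x y i h
    funext b
    simp only [hb, ← h1]
    cases b <;> exact Finset.sum_congr rfl fun σ hσ => h2 σ (Finset.mem_filter.mp hσ).1
  · intro x i τ hτ b
    simp only [hb]
    cases b <;> exact HoldsVal.sum fun σ hσ => hl.holdsVal x i σ (Finset.mem_filter.mp hσ).1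

theorem intOK_keySum {κ : AnyTuple E dom → K} {w : G.X → AnyTuple E dom → M}
    (hint : ∀ x (T : Finset (AnyTuple E dom)), IntOK c x (∑ τ ∈ T, w x τ)) (x : G.X)
    (W : Finset (AnyTuple E dom)) (τ : AnyTuple E dom) (b : Bool) :
    IntOK c x (keySum κ W (w x) τ b) := by
  cases b <;> exact hint x _

/-- Moving tuples inside a block does not change its contents, hence not the sums. Two of the three
rounds are for the move and one for the way back. -/
theorem solves_of_moved {κ : AnyTuple E dom → K} {k d : ℕ}
    {loc : G.X → G.Node → Finset (AnyTuple E dom)}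
    {w : G.X → AnyTuple E dom → M}
    (hint : ∀ x (T : Finset (AnyTuple E dom)), IntOK c x (∑ τ ∈ T, w x τ))
    (hdisj : ∀ x i j, i ≠ j → Disjoint (loc x i) (loc x j))
    {dest : G.X → G.Node → AnyTuple E dom → G.Node}
    (hdest : ∀ x y i, loc x i = loc y i → ∀ τ ∈ loc x i, dest x i τ = dest y i τ)
    (hblock : ∀ x i, ∀ τ ∈ loc x i, dest x i τ ∈ block d i)
    (hload : ∀ x i, (loc x i).card * 2 ≤ G.maxLoad x)
    (hload' : ∀ x i, (moved (loc x) (dest x) i).card ≤ G.maxLoad x)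
    (h : Solves c κ k (fun x => moved (loc x) (dest x)) w d) : Solves c κ (k + 3) loc w d := by
  intro A hA hl
  have hd : G.KnowsOn A loc dest := fun x y i e => hdest x y i (hl.knows x y i e)
  obtain ⟨A₁, e1, l1, k1⟩ := exists_move hA hl hdisj
    (fun x τ => by simpa using hint x {τ}) hd hload'
  obtain ⟨A₂, e2, k2, h2⟩ := h A₁ e1.good l1
  obtain ⟨A₃, e3, k3, h3⟩ := exists_moveBack (c := c) e2.good
    (e2.knows (e1.knows (knows_movedPart hl.knows hd))) (e2.knows k1) _ k2 h2
    (fun x j τ _ b => intOK_keySum hint x _ τ b) hload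
  have hb : ∀ x i, ∀ τ ∈ loc x i, blockItems (moved (loc x) (dest x)) d (dest x i τ) =
      blockItems (loc x) d i := by
    intro x i τ hτ
    rw [blockItems_moved (hblock x), blockItems_congr (hblock x i τ hτ)]
  refine ⟨A₃, ((e1.trans e2).trans e3).mono (by omega), ?_, ?_⟩
  · intro x y i e τ hτ
    have hτ' : τ ∈ loc y i := by
      rw [← ((e1.trans e2).trans e3).knows hl.knows x y i e]
      exact hτ
    have := k3 x y i e τ hτ
    simp only at this
    rwa [hb x i τ hτ, hb y i τ hτ'] at this
  · intro x i τ hτ b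
    have := h3 x i τ hτ b
    rwa [hb x i τ hτ] at this

/-- The first node of a block. -/
def leader {m s : ℕ} (d : ℕ) (i : Fin m → Fin s) : Fin m → Fin s :=
  fun r => if r.val < d then ⟨0, (i r).pos⟩ else i r

theorem leader_mem_block {m s : ℕ} (d : ℕ) (i : Fin m → Fin s) : leader d i ∈ block d i := by
  rw [mem_block]
  intro t ht
  rw [leader, if_neg (by omega)]

theorem leader_congr {m s d : ℕ} {i j : Fin m → Fin s} (h : j ∈ block d i) :
    leader d j = leader d i := by
  funext r
  rw [leader, leader]
  split_ifs with h1
  · rfl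
  · exact mem_block.mp h r (by omega)

/-- The class sums determine the sums below a key, up to the tuples of the same class. -/
theorem keySum_eq {κ : AnyTuple E dom → K} {s : ℕ} (W Z : Finset (AnyTuple E dom))
    (hZ : Z.card < s) (w : AnyTuple E dom → M) (τ : AnyTuple E dom) (b : Bool) :
    keySum κ W w τ b =
      (if b then 0 else ∑ t : Fin (2 * s), if t.val < keyClass κ Z τ then
        ∑ σ ∈ W.filter (fun σ => keyClass κ Z σ = t.val), w σ else 0) +
      keySum κ (W.filter fun σ => keyClass κ Z σ = keyClass κ Z τ) w τ b := by
  cases b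
  · simp only [keySum]
    rw [sum_lt_eq W w Z τ]
    simp only [Bool.false_eq_true, if_false]
    congr 1
    rw [← Finset.sum_filter]
    rw [← Finset.sum_biUnion]
    · congr 1
      ext σ
      simp only [Finset.mem_filter, Finset.mem_biUnion, Finset.mem_univ, true_and]
      constructor
      · rintro ⟨h1, h2⟩
        exact ⟨⟨keyClass κ Z σ, keyClass_lt hZ σ⟩, h2, h1, rfl⟩
      · rintro ⟨t, h1, h2, h3⟩
        exact ⟨h2, by omega⟩
    · intro a _ b _ hab
      rw [Function.onFun, Finset.disjoint_filter]
      intro σ _ h1 h2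
      exact hab (Fin.ext (h1.symm.trans h2))
  · simp only [keySum, if_true, zero_add]
    exact sum_eq_eq W w Z τ

/-- All tuples in the class of a hit tuple have its key: none is smaller, and the class total is the
sum over equal keys. -/
theorem keySum_of_hit {κ : AnyTuple E dom → K} (W Z : Finset (AnyTuple E dom))
    (w : AnyTuple E dom → M) {τ : AnyTuple E dom} (hτ : Hit κ Z τ) (b : Bool) :
    keySum κ (W.filter fun σ => keyClass κ Z σ = keyClass κ Z τ) w τ b =
      if b then ∑ σ ∈ W.filter (fun σ => keyClass κ Z σ = keyClass κ Z τ), w σ else 0 := by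
  cases b
  · simp only [keySum, Bool.false_eq_true, if_false]
    rw [Finset.sum_eq_zero]
    intro σ hσ
    simp only [Finset.mem_filter] at hσ
    exact absurd hσ.2 (eq_of_keyClass_eq hσ.1.2 hτ).not_lt
  · simp only [keySum, if_true]
    congr 1
    apply Finset.filter_true_of_mem
    intro σ hσ
    simp only [Finset.mem_filter] at hσ
    exact eq_of_keyClass_eq hσ.2 hτ

/-- A node gets one bucket from each of the `s` nodes of its line, with at most `n / s + 1 + 2 * δ`
tuples. Hit tuples must stay, since a single frequent key could exceed any such bound. -/
theorem card_moved_bucket_le {α : Type*} [LinearOrder α] {s : ℕ} {κ : α → K} (hκ : Monotone κ)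
    {loc : (Fin m → Fin s) → Finset α} (hdisj : ∀ i j, i ≠ j → Disjoint (loc i) (loc j))
    {t : Fin m} {δ n : ℕ} (hcard : ∀ i, (loc i).card ≤ n) (hequi : EquiDist loc (t.val + 1) δ)
    (j : Fin m → Fin s) :
    (moved (fun i => (loc i).filter fun τ => ¬ Hit κ (splitters (loc (leader (t.val + 1) i)) s) τ)
      (fun i τ => Function.update i t
        ⟨bucket κ (splitters (loc (leader (t.val + 1) i)) s) τ % s, Nat.mod_lt _ (i t).pos⟩)
      j).card ≤ n + s + 2 * δ * s := by
  have hs : 0 < s := (j t).pos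
  rw [card_moved (fun a b hab => Finset.disjoint_filter_filter (hdisj a b hab)),
    sum_eq_sum_line t j]
  · have hle : ∀ a : Fin s, a ∈ Finset.univ → (movedPart
        (fun i => (loc i).filter fun τ => ¬ Hit κ (splitters (loc (leader (t.val + 1) i)) s) τ)
        (fun i τ => Function.update i t
        ⟨bucket κ (splitters (loc (leader (t.val + 1) i)) s) τ % s, Nat.mod_lt _ (i t).pos⟩)
        (Function.update j t a) j).card ≤ n / s + 1 + 2 * δ := by
      intro a _
      have hmem : Function.update j t a ∈ block (t.val + 1) (leader (t.val + 1) j) := by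
        rw [block_eq (leader_mem_block _ _)]
        exact update_mem_block (by omega) _ _
      have hlead : leader (t.val + 1) (Function.update j t a) = leader (t.val + 1) j :=
        leader_congr (update_mem_block (by omega) _ _)
      have h1 := card_bucket_le hκ hequi hmem (j t).val
      have h2 : (loc (leader (t.val + 1) j)).card / s ≤ n / s := Nat.div_le_div_right (hcard _)
      refine le_trans (Finset.card_le_card ?_) (h1.trans (by omega))
      intro τ hτ
      rw [mem_movedPart, Finset.mem_filter, hlead] at hτ
      obtain ⟨⟨h3, h4⟩, h5⟩ := hτ
      refine Finset.mem_filter.mpr ⟨h3, h4, ?_⟩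
      have h6 := congrArg Fin.val (congrFun h5 t)
      rw [Function.update_self] at h6
      rw [← h6]
      exact (Nat.mod_eq_of_lt (bucket_lt_of_card (card_splitters_lt _ hs) τ)).symm
    refine (Finset.sum_le_sum hle).trans ?_
    rw [Finset.sum_const, Finset.card_univ, Fintype.card_fin, smul_eq_mul]
    have := Nat.mul_div_le n s
    nlinarith
  · intro i hi
    rw [Finset.card_eq_zero, Finset.eq_empty_iff_forall_notMem]
    intro τ hτ
    rw [mem_movedPart] at hτ
    apply hi (i t)
    rw [← hτ.2, Function.update_idem, Function.update_eq_self]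

/-- The subblock receives exactly the class of `τ`, so the sums within a class become the same
problem on a block of one dimension less. -/
theorem blockItems_moved_bucket {α : Type*} [LinearOrder α] {s : ℕ} {κ : α → K}
    {loc : (Fin m → Fin s) → Finset α} {t : Fin m} {i : Fin m → Fin s} {τ : α}
    (hτ : ¬ Hit κ (splitters (loc (leader (t.val + 1) i)) s) τ) :
    blockItems (moved
      (fun i => (loc i).filter fun τ => ¬ Hit κ (splitters (loc (leader (t.val + 1) i)) s) τ)
      (fun i τ => Function.update i t
        ⟨bucket κ (splitters (loc (leader (t.val + 1) i)) s) τ % s, Nat.mod_lt _ (i t).pos⟩))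
      t.val (Function.update i t
        ⟨bucket κ (splitters (loc (leader (t.val + 1) i)) s) τ % s, Nat.mod_lt _ (i t).pos⟩) =
    (blockItems loc (t.val + 1) i).filter fun σ =>
      keyClass κ (splitters (loc (leader (t.val + 1) i)) s) σ =
        keyClass κ (splitters (loc (leader (t.val + 1) i)) s) τ := by
  have hs : 0 < s := (i t).pos
  have hb : ∀ σ, bucket κ (splitters (loc (leader (t.val + 1) i)) s) σ % s =
      bucket κ (splitters (loc (leader (t.val + 1) i)) s) σ :=
    fun σ => Nat.mod_eq_of_lt (bucket_lt_of_card (card_splitters_lt _ hs) σ)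
  ext σ
  simp only [mem_blockItems, mem_moved, Finset.mem_filter]
  constructor
  · rintro ⟨j, hj, l, ⟨hl, hσ⟩, rfl⟩
    rw [← filter_block_succ, Finset.mem_filter] at hj
    have hli : l ∈ block (t.val + 1) i := by
      rw [← block_eq hj.1, block_eq (update_mem_block (by omega) l _)]
      exact self_mem_block l
    rw [leader_congr hli] at hσ hj
    refine ⟨⟨l, hli, hl⟩, ?_⟩
    have := congrArg Fin.val hj.2
    rw [Function.update_self] at this
    simp only [hb] at this
    rw [keyClass, keyClass, if_neg hσ, if_neg hτ, this]
  · rintro ⟨⟨l, hli, hl⟩, hc⟩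
    obtain ⟨h1, h2⟩ := bucket_eq_of_keyClass_eq hc
    refine ⟨_, ?_, l, ⟨hl, ?_⟩, rfl⟩
    · rw [← filter_block_succ, Finset.mem_filter]
      constructor
      · rw [← block_eq hli]
        exact update_mem_block (by omega) l _
      · rw [Function.update_self, leader_congr hli, h1]
    · rw [leader_congr hli, h2]
      exact hτ

theorem HoldsVal.zero {A : Algorithm E dom ℕ p} {x : G.X} {i : G.Node} :
    HoldsVal c A x i (0 : M) := fun τ hτ => absurd hτ (c.enc_zero τ)

theorem HoldsVal.add {A : Algorithm E dom ℕ p} {x : G.X} {i : G.Node} {a b : M}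
    (ha : HoldsVal c A x i a) (hb : HoldsVal c A x i b) : HoldsVal c A x i (a + b) :=
  fun τ hτ => (c.enc_add a b τ hτ).elim (ha τ) (hb τ)

theorem HoldsVal.ite {A : Algorithm E dom ℕ p} {x : G.X} {i : G.Node} {a b : M} {P : Prop}
    [Decidable P] (ha : P → HoldsVal c A x i a) (hb : ¬ P → HoldsVal c A x i b) :
    HoldsVal c A x i (if P then a else b) := by
  split_ifs with h
  · exact ha h
  · exact hb h

variable [LinearOrder (AnyTuple E dom)]

/-- It suffices to treat tuples that have been dealt out along all `D` coordinates. Here `e`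
coordinates are done and `r` remain; each deal adds at most `s` tuples to a node and `2 * s` to the
discrepancy. -/
theorem solves_of_dealt {κ : AnyTuple E dom → K} {k D : ℕ} (hD : D ≤ m) (n : G.X → ℕ)
    {w : G.X → AnyTuple E dom → M}
    (hint : ∀ x (T : Finset (AnyTuple E dom)), IntOK c x (∑ τ ∈ T, w x τ))
    (hload : ∀ x, (n x + D * G.s) * 2 ≤ G.maxLoad x)
    (h : ∀ loc : G.X → G.Node → Finset (AnyTuple E dom),
      (∀ x i j, i ≠ j → Disjoint (loc x i) (loc x j)) →
      (∀ x i, (loc x i).card ≤ n x + D * G.s) → (∀ x, EquiDist (loc x) D (D * (2 * G.s))) →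
        Solves c κ k loc w D) (r : ℕ) :
    ∀ (e : ℕ) (loc : G.X → G.Node → Finset (AnyTuple E dom)), e + r = D →
      (∀ x i j, i ≠ j → Disjoint (loc x i) (loc x j)) →
      (∀ x i, (loc x i).card ≤ n x + e * G.s) → (∀ x, EquiDist (loc x) e (e * (2 * G.s))) →
        Solves c κ (k + 3 * r) loc w D := by
  induction r with
  | zero =>
    intro e loc he
    rw [add_zero] at he
    subst he
    exact h loc
  | succ r ih =>
    intro e loc he hdisj hcard hequi
    let t : Fin m := ⟨e, by omega⟩
    have hcard' : ∀ x i, (deal (loc x) t i).card ≤ n x + (e + 1) * G.s := by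
      intro x i
      refine (card_deal_le (hdisj x) t (hcard x) i).trans (le_of_eq ?_)
      ring
    have hle : ∀ x, n x + (e + 1) * G.s ≤ n x + D * G.s := by
      intro x
      have : (e + 1) * G.s ≤ D * G.s := Nat.mul_le_mul_right _ (by omega)
      omega
    have := ih (e + 1) (fun x => deal (loc x) t) (by omega)
      (fun x => disjoint_moved (hdisj x) _) hcard'
      (fun x => by
        have := EquiDist.deal (hdisj x) (t := t) (hequi x)
        convert this using 1
        ring)
    refine solves_of_moved hint hdisj (dest := fun x => dealDest (loc x) t) ?_ ?_ ?_ ?_ this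
    · intro x y i e τ _
      simp only [dealDest, e]
    · intro x i τ _
      exact update_mem_block (by simp only [t]; omega) _ _
    · intro x i
      have h1 := hcard x i
      have h2 := hload x
      have h3 := hle x
      have : e * G.s ≤ (e + 1) * G.s := Nat.mul_le_mul_right _ (by omega)
      omega
    · intro x i
      have h1 := hcard' x i
      have h2 := hload x
      have h3 := hle x
      rw [deal] at h1
      omega

/-- One level of the recursion over the dimension: hit tuples are settled by the class totals, all
others by the recursive call in the subblock of their bucket. The rounds are one for the splitters,
`t + 1` for the totals, two for the move and one for the way back. -/
theorem solves_succ {κ : AnyTuple E dom → K} (hκ : Monotone κ) {k : ℕ} (t : Fin m) (n : G.X → ℕ)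
    (δ : ℕ) {w : G.X → AnyTuple E dom → M}
    (hint : ∀ x (T : Finset (AnyTuple E dom)), IntOK c x (∑ τ ∈ T, w x τ))
    (ih : ∀ loc : G.X → G.Node → Finset (AnyTuple E dom),
      (∀ x i j, i ≠ j → Disjoint (loc x i) (loc x j)) →
      (∀ x i, (loc x i).card ≤ n x + G.s + 2 * δ * G.s) → Solves c κ k loc w t.val)
    {loc : G.X → G.Node → Finset (AnyTuple E dom)}
    (hdisj : ∀ x i j, i ≠ j → Disjoint (loc x i) (loc x j))
    (hcard : ∀ x i, (loc x i).card ≤ n x) (hequi : ∀ x, EquiDist (loc x) (t.val + 1) δ)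
    (hload : ∀ x, (n x + G.s + 2 * δ * G.s) * 2 ≤ G.maxLoad x)
    (hload' : ∀ x, G.s * (2 * G.s) ≤ G.maxLoad x) :
    Solves c κ (k + (t.val + 5)) loc w (t.val + 1) := by
  intro A hA hl
  obtain ⟨Z, hZdef⟩ : ∃ Z : G.X → G.Node → Finset (AnyTuple E dom),
    Z = fun x i => splitters (loc x (leader (t.val + 1) i)) G.s := ⟨_, rfl⟩
  have hZ : ∀ x i, (Z x i).card < G.s := by
    intro x i
    rw [hZdef]
    exact card_splitters_lt _ (i t).pos
  have hZb : ∀ x i j, j ∈ block (t.val + 1) i → Z x j = Z x i := by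
    intro x i j hj
    simp only [hZdef, leader_congr hj]
  -- the leaders of the blocks announce the splitters
  let S : G.X → G.Node → G.Node → Finset (AnyTuple E dom) := fun x a j =>
    if leader (t.val + 1) j = a then splitters (loc x a) G.s else ∅
  have hS : ∀ x j, S x (leader (t.val + 1) j) j = Z x j := by
    intro x j
    simp only [S, hZdef, if_true]
  obtain ⟨A₁, e1, kS, -⟩ := exists_tuple_round hA S
    (fun x y i h => by
      funext j
      simp only [S, hl.knows x y i h])
    (fun x i j τ hτ => by
      simp only [S] at hτ
      split_ifs at hτ
      · exact hl.holds x i τ (Finset.mem_filter.mp hτ).1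
      · simp at hτ)
    (fun x j => by
      rw [Finset.sum_eq_single (leader (t.val + 1) j)]
      · rw [hS]
        have h1 := hZ x j
        have h2 := hload' x
        have h3 : 0 < G.s := (j t).pos
        nlinarith
      · intro a _ ha
        simp only [S]
        rw [if_neg (Ne.symm ha)]
        rfl
      · simp)
  have kZ : G.Knows A₁ Z := by
    intro x y j h
    have := congrFun (kS x y j h) (leader (t.val + 1) j)
    simp only at this
    rwa [hS, hS] at this
  have l1 := e1.located hl
  -- the sums of the weights over the classes
  let f : G.X → G.Node → Fin (2 * G.s) → M := fun x i r =>
    ∑ τ ∈ (loc x i).filter (fun τ => keyClass κ (Z x i) τ = r.val), w x τ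
  obtain ⟨A₂, e2, kV, hV⟩ := exists_allReduce (c := c) e1.good f
    (fun x y i h => by
      funext r
      simp only [f, l1.knows x y i h, kZ x y i h]
      refine Finset.sum_congr rfl fun τ hτ => l1.val x y i h τ ?_
      rw [l1.knows x y i h]
      exact (Finset.mem_filter.mp hτ).1)
    (fun x i r => HoldsVal.sum fun τ hτ => l1.holdsVal x i τ (Finset.mem_filter.mp hτ).1)
    (fun x d i r => by
      simp only [f]
      rw [sum_block_eq (hdisj x) _ (fun j => Finset.filter_subset _ _)]
      exact hint x _)
    (fun x => by simpa using hload' x) (t.val + 1) (by omega)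
  obtain ⟨Vc, hVc⟩ : ∃ Vc : G.X → G.Node → Fin (2 * G.s) → M, Vc = fun x i r =>
    ∑ σ ∈ (blockItems (loc x) (t.val + 1) i).filter (fun σ => keyClass κ (Z x i) σ = r.val),
      w x σ := ⟨_, rfl⟩
  have hVeq : ∀ x i r, ∑ j ∈ block (t.val + 1) i, f x j r = Vc x i r := by
    intro x i r
    simp only [f, hVc]
    rw [sum_block_eq (hdisj x) _ (fun j => Finset.filter_subset _ _)]
    congr 1
    ext σ
    simp only [Finset.mem_biUnion, Finset.mem_filter, mem_blockItems]
    constructor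
    · rintro ⟨j, hj, h1, h2⟩
      rw [hZb x i j hj] at h2
      exact ⟨⟨j, hj, h1⟩, h2⟩
    · rintro ⟨⟨j, hj, h1⟩, h2⟩
      rw [← hZb x i j hj] at h2
      exact ⟨j, hj, h1, h2⟩
  simp only [hVeq] at kV hV
  -- the other tuples are sent to smaller blocks
  let locU : G.X → G.Node → Finset (AnyTuple E dom) := fun x i =>
    (loc x i).filter fun τ => ¬ Hit κ (splitters (loc x (leader (t.val + 1) i)) G.s) τ
  let dest : G.X → G.Node → AnyTuple E dom → G.Node := fun x i τ => Function.update i t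
    ⟨bucket κ (splitters (loc x (leader (t.val + 1) i)) G.s) τ % G.s, Nat.mod_lt _ (i t).pos⟩
  have hdisjU : ∀ x i j, i ≠ j → Disjoint (locU x i) (locU x j) := fun x i j hij =>
    Finset.disjoint_filter_filter (hdisj x i j hij)
  have l2 := e2.located l1
  have kZ2 : G.Knows A₂ fun x i => splitters (loc x (leader (t.val + 1) i)) G.s := by
    have := e2.knows kZ
    rwa [hZdef] at this
  have lU : Located c A₂ locU w := by
    refine ⟨?_, fun x i τ hτ => l2.holds x i τ (Finset.mem_filter.mp hτ).1,
      fun x y i h τ hτ => l2.val x y i h τ (Finset.mem_filter.mp hτ).1,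
      fun x i τ hτ => l2.holdsVal x i τ (Finset.mem_filter.mp hτ).1⟩
    intro x y i h
    have h1 := kZ2 x y i h
    have h2 := l2.knows x y i h
    simp only at h1
    simp only [locU, h1, h2]
  have hd : G.KnowsOn A₂ locU dest := by
    intro x y i h τ _
    have h1 := kZ2 x y i h
    simp only at h1
    simp only [dest, h1]
  have hcard' : ∀ x j, (moved (locU x) (dest x) j).card ≤ n x + G.s + 2 * δ * G.s :=
    fun x j => card_moved_bucket_le hκ (hdisj x) (hcard x) (hequi x) j
  obtain ⟨A₃, e3, l3, k3⟩ := exists_move e2.good lU hdisjU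
    (fun x τ => by simpa using hint x {τ}) hd
    (fun x j => by
      have h1 := hcard' x j
      have h2 := hload x
      omega)
  obtain ⟨A₄, e4, k4, h4⟩ := ih _ (fun x => disjoint_moved (hdisjU x) (dest x)) hcard' A₃ e3.good l3
  obtain ⟨A₅, e5, k5, h5⟩ := exists_moveBack (c := c) e4.good
    (e4.knows (e3.knows (knows_movedPart lU.knows hd))) (e4.knows k3) _ k4 h4
    (fun x j τ _ b => intOK_keySum hint x _ τ b)
    (fun x i => by
      have h1 := hcard x i
      have h2 := hload x
      have h3 : (locU x i).card ≤ (loc x i).card := Finset.card_filter_le _ _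
      omega)
  have hitems : ∀ x i, ∀ τ ∈ locU x i, blockItems (moved (locU x) (dest x)) t.val (dest x i τ) =
      (blockItems (loc x) (t.val + 1) i).filter fun σ =>
        keyClass κ (Z x i) σ = keyClass κ (Z x i) τ := by
    intro x i τ hτ
    rw [hZdef]
    exact blockItems_moved_bucket (Finset.mem_filter.mp hτ).2
  have hmemU : ∀ x i τ, τ ∈ loc x i → ¬ Hit κ (Z x i) τ → τ ∈ locU x i := by
    intro x i τ h1 h2
    rw [hZdef] at h2
    exact Finset.mem_filter.mpr ⟨h1, h2⟩
  have e345 := (e3.trans e4).trans e5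
  -- The answer in terms of what the node knows: the totals of lower classes, and for its own class
  -- either the total (hit) or the recursive answer.
  have hval : ∀ x i τ b, keySum κ (blockItems (loc x) (t.val + 1) i) (w x) τ b =
      (if b then 0 else ∑ r : Fin (2 * G.s), if r.val < keyClass κ (Z x i) τ then Vc x i r else 0) +
      if Hit κ (Z x i) τ then
        (if b then Vc x i ⟨keyClass κ (Z x i) τ, keyClass_lt (hZ x i) τ⟩ else 0)
      else keySum κ ((blockItems (loc x) (t.val + 1) i).filter fun σ =>
        keyClass κ (Z x i) σ = keyClass κ (Z x i) τ) (w x) τ b := by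
    intro x i τ b
    rw [keySum_eq _ (Z x i) (hZ x i)]
    simp only [hVc]
    congr 1
    split_ifs with h1 h2
    · rw [keySum_of_hit _ _ _ h1, if_pos h2]
    · rw [keySum_of_hit _ _ _ h1, if_neg h2]
    · rfl
  have kVe := e345.knows kV
  have kZe := e345.knows (e2.knows kZ)
  have kle := e345.knows l2.knows
  refine ⟨A₅, ((e1.trans e2).trans e345).mono (by omega), ?_, ?_⟩
  · intro x y i h τ hτ
    have h1 := kZe x y i h
    have h2 := kVe x y i h
    simp only at h2
    funext b
    simp only
    rw [hval, hval]
    simp only [← h1]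
    have h2' : ∀ r, Vc x i r = Vc y i r := fun r => congrFun h2 r
    simp only [← h2']
    congr 1
    split_ifs with h3 h4
    · rfl
    · rfl
    · have hx := hmemU x i τ hτ h3
      have hy : τ ∈ locU y i := hmemU y i τ (by rw [← kle x y i h]; exact hτ) (by rwa [← h1])
      have := congrFun (k5 x y i h τ hx) b
      simp only at this
      rw [hitems x i τ hx, hitems y i τ hy, ← h1] at this
      exact this
  · intro x i τ hτ b
    rw [hval]
    refine HoldsVal.add (HoldsVal.ite (fun _ => HoldsVal.zero) fun _ => HoldsVal.sum fun r _ =>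
      HoldsVal.ite (fun _ => e345.holdsVal (hV x i r)) fun _ => HoldsVal.zero) ?_
    refine HoldsVal.ite (fun _ => HoldsVal.ite (fun _ => e345.holdsVal (hV x i _))
      fun _ => HoldsVal.zero) fun h3 => ?_
    have hx := hmemU x i τ hτ h3
    have := h5 x i τ hx b
    rwa [hitems x i τ hx] at this

end Env

end Prefix


/-! ### Composable computations of values at the tuples -/

section Computed

variable {V : Type u} {E : Query V} {dom : V → Type v} {p m : ℕ}

namespace Env

/-- Dealing and splitters use a linear order of the tuples along which keys must be monotone; ties
between equal keys are broken arbitrarily. -/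
theorem exists_linearOrder_monotone {α K : Type*} [LinearOrder K] (κ : α → K) :
    ∃ _ : LinearOrder α, Monotone κ := by
  have aux : ∀ o : LinearOrder α, ∃ _ : LinearOrder α, Monotone κ := fun o =>
    ⟨LinearOrder.lift' (fun τ : α => toLex (κ τ, τ)) fun a b h => congrArg (fun z => (ofLex z).2) h,
      fun a b (hab : toLex (κ a, a) ≤ toLex (κ b, b)) => by
        rcases Prod.Lex.le_iff.mp hab with h | h
        · exact h.le
        · exact h.1.le⟩
  exact aux (IsWellOrder.linearOrder WellOrderingRel)

/-- The number of rounds for the sums by keys inside a block of dimension `d`. -/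
def levelRounds : ℕ → ℕ
  | 0 => 0
  -- `d + 5` rounds for the level itself and three for each of the `d + 1` deals.
  | d + 1 => levelRounds d + (d + 5) + 3 * (d + 1)

variable {G : Env E dom p m} {M : Type*} [AddCommMonoid M] {c : UnitCode E dom M}
  {K : Type*} [LinearOrder K]

/-- A level adds at most `(5 * m + 1) * s ^ 2` tuples to a node: `m * s` by dealing, `s` by rounding
in the buckets, and `4 * m * s ^ 2` by the discrepancy `2 * (d + 1) * s`. -/
theorem solves_level [LinearOrder (AnyTuple E dom)] {κ : AnyTuple E dom → K} (hκ : Monotone κ)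
    {w : G.X → AnyTuple E dom → M}
    (hint : ∀ x (T : Finset (AnyTuple E dom)), IntOK c x (∑ τ ∈ T, w x τ))
    (hload' : ∀ x, G.s * (2 * G.s) ≤ G.maxLoad x) (d : ℕ) (hd : d ≤ m) :
    ∀ (n : G.X → ℕ) (loc : G.X → G.Node → Finset (AnyTuple E dom)),
      (∀ x i j, i ≠ j → Disjoint (loc x i) (loc x j)) → (∀ x i, (loc x i).card ≤ n x) →
      (∀ x, (n x + d * ((5 * m + 1) * (G.s * G.s))) * 2 ≤ G.maxLoad x) →
        Solves c κ (levelRounds d) loc w d := by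
  induction d with
  | zero => intro n loc _ _ _; exact solves_zero κ loc w
  | succ d ih =>
    intro n loc hdisj hcard hload
    have hss : G.s ≤ G.s * G.s := Nat.le_mul_self _
    have hds : (d + 1) * G.s ≤ m * (G.s * G.s) := Nat.mul_le_mul hd hss
    have hds2 : (d + 1) * (G.s * G.s) ≤ m * (G.s * G.s) := Nat.mul_le_mul_right _ hd
    have h2 : 2 * ((d + 1) * (2 * G.s)) * G.s = 4 * ((d + 1) * (G.s * G.s)) := by ring
    have h3 : (5 * m + 1) * (G.s * G.s) = 5 * (m * (G.s * G.s)) + G.s * G.s := by ring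
    have h4 : (d + 1) * ((5 * m + 1) * (G.s * G.s)) =
      d * ((5 * m + 1) * (G.s * G.s)) + (5 * m + 1) * (G.s * G.s) := by ring
    have key := solves_of_dealt (c := c) (κ := κ) (k := levelRounds d + (d + 5)) hd n hint
      (fun x => by have := hload x; omega)
      (fun loc' hdisj' hcard' hequi' => by
        refine solves_succ hκ ⟨d, hd⟩ (fun x => n x + (d + 1) * G.s) ((d + 1) * (2 * G.s)) hint ?_
          hdisj' hcard' hequi' (fun x => ?_) hload'
        · intro loc'' hdisj'' hcard''
          refine ih (by omega) _ loc'' hdisj'' hcard'' fun x => ?_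
          have := hload x
          change (n x + (d + 1) * G.s + G.s + 2 * ((d + 1) * (2 * G.s)) * G.s +
            d * ((5 * m + 1) * (G.s * G.s))) * 2 ≤ _
          omega
        · have := hload x
          omega)
      (d + 1) 0 loc (by omega) hdisj (fun x i => by simpa using hcard x i)
      (fun x => by simpa using equiDist_zero (loc x))
    exact key

/-- A distribution of tuples over the nodes which allows to compute sums by keys. -/
structure Home (G : Env E dom p m) where
  /-- the tuples at a node -/
  loc : G.X → G.Node → Finset (AnyTuple E dom)
  /-- upper bound for the number of tuples at a node -/
  n : G.X → ℕ
  disj : ∀ x i j, i ≠ j → Disjoint (loc x i) (loc x j)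
  card_le : ∀ x i, (loc x i).card ≤ n x
  load : ∀ x, (n x + m * ((5 * m + 1) * (G.s * G.s))) * 2 ≤ G.maxLoad x
  load' : ∀ x, G.s * (2 * G.s) ≤ G.maxLoad x
  intBound_pos : ∀ x, 0 < G.intBound x

namespace Home

variable (H : G.Home)

/-- All tuples. -/
noncomputable def items (x : G.X) : Finset (AnyTuple E dom) := Finset.univ.biUnion (H.loc x)

/-- The nodes know and hold their tuples. -/
structure Base (A : Algorithm E dom ℕ p) : Prop where
  good : G.Good A
  knows : G.Knows A H.loc
  holds : ∀ x i, ∀ τ ∈ H.loc x i, G.NodeHolds A x i τ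

/-- Within `k` rounds, the nodes can compute the values of `f` at their tuples. -/
def Computed {β : Sort*} (k : ℕ) (f : G.X → AnyTuple E dom → β) : Prop :=
  ∀ A, H.Base A → ∃ A', G.Extends k A A' ∧ G.KnowsOn A' H.loc fun x _ => f x

variable {H}

theorem Base.extends {A A' : Algorithm E dom ℕ p} {k : ℕ} (hA : H.Base A) (h : G.Extends k A A') :
    H.Base A' :=
  ⟨h.good, h.knows hA.knows, fun x i τ hτ => h.nodeHolds (hA.holds x i τ hτ)⟩

theorem Computed.const {β : Sort*} (f : AnyTuple E dom → β) : H.Computed 0 fun _ => f :=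
  fun A hA => ⟨A, Extends.refl hA.good, fun _ _ _ _ _ _ => rfl⟩

theorem Computed.map {β γ : Sort*} {k : ℕ} {f : G.X → AnyTuple E dom → β}
    {g : G.X → AnyTuple E dom → γ} (hf : H.Computed k f)
    (h : ∀ x y τ, f x τ = f y τ → g x τ = g y τ) : H.Computed k g := by
  intro A hA
  obtain ⟨A', e, k'⟩ := hf A hA
  exact ⟨A', e, fun x y i hxy τ hτ => h x y τ (k' x y i hxy τ hτ)⟩

theorem Computed.mono {β : Sort*} {k l : ℕ} {f : G.X → AnyTuple E dom → β}
    (hf : H.Computed k f) (hkl : k ≤ l) : H.Computed l f := by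
  intro A hA
  obtain ⟨A', e, k'⟩ := hf A hA
  exact ⟨A', e.mono hkl, k'⟩

theorem Computed.prodMk {β γ : Type*} {k l : ℕ} {f : G.X → AnyTuple E dom → β}
    {g : G.X → AnyTuple E dom → γ} (hf : H.Computed k f) (hg : H.Computed l g) :
    H.Computed (k + l) fun x τ => (f x τ, g x τ) := by
  intro A hA
  obtain ⟨A₁, e1, k1⟩ := hf A hA
  obtain ⟨A₂, e2, k2⟩ := hg A₁ (hA.extends e1)
  refine ⟨A₂, e1.trans e2, fun x y i hxy τ hτ => ?_⟩
  exact Prod.ext (e2.knowsOn k1 x y i hxy τ hτ) (k2 x y i hxy τ hτ)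

theorem Computed.pi_finset {ι β : Type*} {k : ℕ} (f : ι → G.X → AnyTuple E dom → β) (S : Finset ι)
    (hf : ∀ j ∈ S, H.Computed k (f j)) :
    H.Computed (S.card * k) fun x τ (j : {j // j ∈ S}) => f j.1 x τ := by
  induction S using Finset.induction_on with
  | empty =>
    refine (Computed.const (fun _ (j : {j // j ∈ (∅ : Finset ι)}) =>
      (absurd j.2 (Finset.notMem_empty _) : β))).map ?_ |>.mono (by simp)
    intro x y τ _
    funext j
    exact absurd j.2 (Finset.notMem_empty _)
  | insert a S ha ih =>
    have h1 := (ih fun j hj => hf j (Finset.mem_insert_of_mem hj)).prodMk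
      (hf a (Finset.mem_insert_self _ _))
    rw [Finset.card_insert_of_notMem ha]
    refine (h1.map ?_).mono (by ring_nf; rfl)
    intro x y τ h
    have e1 := congrArg Prod.fst h
    have e2 := congrArg Prod.snd h
    simp only at e1 e2
    funext j
    rcases Finset.mem_insert.mp j.2 with hj | hj
    · rw [hj]; exact e2
    · exact congrFun e1 ⟨j.1, hj⟩

theorem Computed.pi {ι β : Type*} [Fintype ι] {k : ℕ} (f : ι → G.X → AnyTuple E dom → β)
    (hf : ∀ j, H.Computed k (f j)) : H.Computed (Fintype.card ι * k) fun x τ j => f j x τ :=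
  (Computed.pi_finset f Finset.univ fun j _ => hf j).map fun _ _ _ h =>
    funext fun j => congrFun h ⟨j, Finset.mem_univ j⟩

theorem exists_keySum (κ : AnyTuple E dom → K) {w : G.X → AnyTuple E dom → M}
    (hint : ∀ x (T : Finset (AnyTuple E dom)), IntOK c x (∑ τ ∈ T, w x τ))
    {A : Algorithm E dom ℕ p} (hA : H.Base A) (hw : G.KnowsOn A H.loc fun x _ => w x)
    (hw' : ∀ x i, ∀ τ ∈ H.loc x i, HoldsVal c A x i (w x τ)) :
    ∃ A', G.Extends (levelRounds m) A A' ∧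
      G.KnowsOn A' H.loc (fun x _ τ => keySum κ (H.items x) (w x) τ) ∧
      ∀ x i, ∀ τ ∈ H.loc x i, ∀ b, HoldsVal c A' x i (keySum κ (H.items x) (w x) τ b) := by
  have hb : ∀ x i, blockItems (H.loc x) m i = H.items x := by
    intro x i
    ext τ
    simp [blockItems, block_top, items]
  obtain ⟨o, hκ⟩ := exists_linearOrder_monotone κ
  have h := solves_level hκ hint H.load' m le_rfl H.n H.loc H.disj H.card_le H.load A hA.good
    ⟨hA.knows, hA.holds, hw, hw'⟩
  simpa only [hb] using h

/-- Integers as units. -/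
def natCode {V : Type u} (E : Query V) (dom : V → Type v) : UnitCode E dom ℕ where
  enc := Sum.inr
  enc_inj := Sum.inr_injective
  enc_zero := by simp
  enc_add := by simp

theorem Computed.keySum (κ : AnyTuple E dom → K) {k : ℕ} {w : G.X → AnyTuple E dom → ℕ}
    (hw : H.Computed k w)
    (hint : ∀ x (T : Finset (AnyTuple E dom)), ∑ τ ∈ T, w x τ < G.intBound x) :
    H.Computed (k + levelRounds m) fun x τ => keySum κ (H.items x) (w x) τ := by
  intro A hA
  obtain ⟨A₁, e1, k1⟩ := hw A hA
  obtain ⟨A₂, e2, k2, -⟩ := exists_keySum (c := natCode E dom) κ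
    (fun x T n hn => by cases hn; exact hint x T) (hA.extends e1) k1
    (fun x i τ _ σ hσ => by cases hσ)
  exact ⟨A₂, e1.trans e2, k2⟩

/-- Tuples, or nothing, as units. -/
noncomputable def tupleCode {V : Type u} (E : Query V) (dom : V → Type v)
    [LinearOrder (AnyTuple E dom)] : UnitCode E dom (Tropical (WithTop (AnyTuple E dom))) where
  enc a := match Tropical.untrop a with
    | ⊤ => Sum.inr 0
    | (τ : AnyTuple E dom) => Sum.inl τ
  enc_inj := by
    intro a b h
    apply Tropical.untrop_injective
    cases ha : Tropical.untrop a <;> cases hb : Tropical.untrop b <;> simp_all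
  enc_zero := by
    intro τ h
    simp at h
  enc_add := by
    intro a b τ h
    rw [Tropical.untrop_add] at h
    rcases min_choice (Tropical.untrop a) (Tropical.untrop b) with h' | h'
    · rw [h'] at h; exact Or.inl h
    · rw [h'] at h; exact Or.inr h

/-- The tuples of the relation `e` with the same key as `τ`. -/
noncomputable def partners (H : G.Home) (κ : AnyTuple E dom → K) (e : {e // e ∈ E}) (x : G.X)
    (τ : AnyTuple E dom) : Finset (AnyTuple E dom) :=
  (H.items x).filter fun σ => σ.1 = e ∧ κ σ = κ τ

/-- The nodes get copies of the partners of their tuples. -/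
theorem exists_fetch (κ : AnyTuple E dom → K) (e : {e // e ∈ E})
    (hκ : ∀ σ σ' : AnyTuple E dom, σ.1 = e → σ'.1 = e → κ σ = κ σ' → σ = σ')
    {A : Algorithm E dom ℕ p} (hA : H.Base A) :
    ∃ A', G.Extends (levelRounds m) A A' ∧ G.KnowsOn A' H.loc (fun x _ => H.partners κ e x) ∧
      ∀ x i, ∀ τ ∈ H.loc x i, ∀ σ ∈ H.partners κ e x τ, G.NodeHolds A' x i σ := by
  let _ : LinearOrder (AnyTuple E dom) := IsWellOrder.linearOrder WellOrderingRel
  -- Tropical addition is `min`. With weight `⊤` outside of `e`, the sum over equal keys is the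
  -- partner in `e` if there is one, which is unique by `hκ`; so the protocol for sums delivers
  -- tuples.
  let w : AnyTuple E dom → Tropical (WithTop (AnyTuple E dom)) := fun σ =>
    if σ.1 = e then Tropical.trop (σ : WithTop (AnyTuple E dom)) else 0
  have hw : ∀ σ ρ, (tupleCode E dom).enc (w σ) = Sum.inl ρ → σ = ρ := by
    intro σ ρ h
    simp only [w] at h
    split_ifs at h with h1
    · simpa [tupleCode] using h
    · exact absurd h ((tupleCode E dom).enc_zero ρ)
  have hnat : ∀ a n, (tupleCode E dom).enc a = Sum.inr n → n = 0 := by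
    intro a n h
    simp only [tupleCode] at h
    split at h
    · simpa using h.symm
    · cases h
  obtain ⟨A', e', k', h'⟩ := exists_keySum (c := tupleCode E dom) κ (w := fun _ => w)
    (fun x T n hn => by rw [hnat _ _ hn]; exact H.intBound_pos x) hA (fun _ _ _ _ _ _ => rfl)
    (fun x i τ hτ σ hσ => by
      rw [← hw τ σ hσ]
      exact hA.holds x i τ hτ)
  have hsum : ∀ x τ, Tropical.untrop (keySum κ (H.items x) w τ true) =
      ((H.items x).filter fun σ => κ σ = κ τ).inf fun σ => Tropical.untrop (w σ) := by
    intro x τ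
    simp only [keySum]
    exact Finset.untrop_sum' _ _
  have key : ∀ x τ (σ : AnyTuple E dom), σ ∈ H.partners κ e x τ ↔
      Tropical.untrop (keySum κ (H.items x) w τ true) = (σ : WithTop (AnyTuple E dom)) := by
    intro x τ σ
    rw [hsum]
    have hval : ∀ ρ, ρ ∈ (H.items x).filter (fun ρ => κ ρ = κ τ) → Tropical.untrop (w ρ) =
        if ρ.1 = e then (ρ : WithTop (AnyTuple E dom)) else ⊤ := by
      intro ρ _
      simp only [w]
      split_ifs <;> rfl
    rw [Finset.inf_congr rfl hval]
    constructor
    · intro hσ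
      simp only [partners, Finset.mem_filter] at hσ
      apply le_antisymm
      · refine (Finset.inf_le (b := σ) (by simp [hσ])).trans ?_
        rw [if_pos hσ.2.1]
      · apply Finset.le_inf
        intro ρ hρ
        split_ifs with hρe
        · rw [hκ σ ρ hσ.2.1 hρe (hσ.2.2.trans (Finset.mem_filter.mp hρ).2.symm)]
        · exact le_top
    · intro h
      have hne : ((H.items x).filter fun ρ => κ ρ = κ τ).Nonempty := by
        by_contra hc
        rw [Finset.not_nonempty_iff_eq_empty] at hc
        rw [hc] at h
        simp at h
      obtain ⟨ρ, hρ, hρ'⟩ := Finset.exists_mem_eq_inf _ hne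
        (fun ρ => if ρ.1 = e then (ρ : WithTop (AnyTuple E dom)) else ⊤)
      rw [hρ'] at h
      split_ifs at h with hρe
      · have : ρ = σ := by exact_mod_cast h
        subst this
        simp only [partners, Finset.mem_filter] at *
        exact ⟨hρ.1, hρe, hρ.2⟩
      · exact absurd h.symm WithTop.coe_ne_top
  refine ⟨A', e', ?_, ?_⟩
  · intro x y i hxy τ hτ
    have h1 := congrFun (k' x y i hxy τ hτ) true
    simp only at h1
    ext σ
    rw [key, key, h1]
  · intro x i τ hτ σ hσ
    apply h' x i τ hτ true σ
    rw [key] at hσ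
    simp [tupleCode, hσ]

end Home

end Env

end Computed


/-! ### Partial assignments and join results -/

section Assignments

variable {V : Type u} {E : Query V} {dom : V → Type v}

/-- An assignment of values to some of the attributes. -/
abbrev PartAssign {V : Type u} (dom : V → Type v) := ∀ x : V, Option (dom x)

/-- The restriction of an assignment to a set of attributes. -/
noncomputable def restrict (U : Finset V) (a : PartAssign dom) : PartAssign dom :=
  fun x => if x ∈ U then a x else none

/-- The restriction of an assignment to the attributes of a set of relations. -/
noncomputable def restrictAll (S : Finset {e // e ∈ E}) (a : PartAssign dom) : PartAssign dom :=
  fun x => if ∃ e ∈ S, x ∈ e.1 then a x else none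

/-- The assignment given by a tuple. -/
noncomputable def AnyTuple.assign (τ : AnyTuple E dom) : PartAssign dom :=
  fun x => if h : x ∈ τ.1.1 then some (τ.2 ⟨x, h⟩) else none

theorem restrict_apply_of_mem {U : Finset V} {x : V} (hx : x ∈ U) (a : PartAssign dom) :
    restrict U a x = a x := if_pos hx

theorem restrict_apply_of_notMem {U : Finset V} {x : V} (hx : x ∉ U) (a : PartAssign dom) :
    restrict U a x = none := if_neg hx

theorem restrict_restrict {U U' : Finset V} (h : U ⊆ U') (a : PartAssign dom) :
    restrict U (restrict U' a) = restrict U a := by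
  funext x
  by_cases hx : x ∈ U
  · rw [restrict_apply_of_mem hx, restrict_apply_of_mem hx, restrict_apply_of_mem (h hx)]
  · rw [restrict_apply_of_notMem hx, restrict_apply_of_notMem hx]

theorem restrict_restrictAll {U : Finset V} {S : Finset {e // e ∈ E}} {e : {e // e ∈ E}} (he : e ∈ S)
    (h : U ⊆ e.1) (a : PartAssign dom) : restrict U (restrictAll S a) = restrict U a := by
  funext x
  by_cases hx : x ∈ U
  · rw [restrict_apply_of_mem hx, restrict_apply_of_mem hx, restrictAll, if_pos ⟨e, he, h hx⟩]
  · rw [restrict_apply_of_notMem hx, restrict_apply_of_notMem hx]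

theorem restrict_assign (τ : AnyTuple E dom) : restrict τ.1.1 τ.assign = τ.assign := by
  funext x
  by_cases hx : x ∈ τ.1.1
  · rw [restrict_apply_of_mem hx]
  · rw [restrict_apply_of_notMem hx, AnyTuple.assign, dif_neg hx]

theorem assign_inj {σ τ : AnyTuple E dom} (h : σ.1 = τ.1) (h' : σ.assign = τ.assign) : σ = τ := by
  obtain ⟨e, s⟩ := σ
  obtain ⟨e', t⟩ := τ
  simp only at h
  subst h
  congr 1
  funext x
  have := congrFun h' x.1
  rw [AnyTuple.assign, AnyTuple.assign, dif_pos x.2, dif_pos x.2] at this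
  exact Option.some_injective _ this

/-- The assignments to the attributes of the relations in `F` whose restrictions to these relations
are tuples in `T`. -/
def Joins (T : Finset (AnyTuple E dom)) (F : Finset {e // e ∈ E}) : Set (PartAssign dom) :=
  {b | restrictAll F b = b ∧ ∀ e ∈ F, ∃ τ ∈ T, τ.1 = e ∧ τ.assign = restrict e.1 b}

/-- The partial join results over `S` that belong to a join result over `F` which extends `a`. -/
def Partials (T : Finset (AnyTuple E dom)) (F S : Finset {e // e ∈ E}) (U : Finset V)
    (a : PartAssign dom) : Set (PartAssign dom) :=
  restrictAll S '' {b | b ∈ Joins T F ∧ restrict U b = a}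

theorem eq_of_restrict_eq {S : Finset {e // e ∈ E}} {b b' : PartAssign dom}
    (hb : restrictAll S b = b) (hb' : restrictAll S b' = b')
    (h : ∀ e ∈ S, restrict e.1 b = restrict e.1 b') : b = b' := by
  funext x
  by_cases hx : ∃ e ∈ S, x ∈ e.1
  · obtain ⟨e, he, hxe⟩ := hx
    have := congrFun (h e he) x
    rwa [restrict_apply_of_mem hxe, restrict_apply_of_mem hxe] at this
  · rw [← hb, ← hb', restrictAll, restrictAll, if_neg hx, if_neg hx]

theorem restrictAll_idem (S : Finset {e // e ∈ E}) (b : PartAssign dom) :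
    restrictAll S (restrictAll S b) = restrictAll S b := by
  funext x
  by_cases hx : ∃ e ∈ S, x ∈ e.1
  · rw [restrictAll, if_pos hx]
  · rw [restrictAll, restrictAll, if_neg hx, if_neg hx]

/-- A partial result is determined by its restrictions to the relations in `S`, and each of these is
the assignment of a tuple in `T`. -/
theorem partials_finite_and_le {T : Finset (AnyTuple E dom)} {F S : Finset {e // e ∈ E}}
    (hS : S ⊆ F) (U : Finset V) (a : PartAssign dom) :
    (Partials T F S U a).Finite ∧ (Partials T F S U a).ncard ≤ T.card ^ S.card := by
  let P : Finset ({e // e ∈ S} → PartAssign dom) :=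
    Fintype.piFinset fun _ => T.image AnyTuple.assign
  let f : PartAssign dom → ({e // e ∈ S} → PartAssign dom) := fun b e => restrict e.1.1 b
  have hmaps : ∀ b ∈ Partials T F S U a, f b ∈ (P : Set _) := by
    rintro _ ⟨b, ⟨⟨_, hb⟩, _⟩, rfl⟩
    simp only [P, Finset.mem_coe, Fintype.mem_piFinset, Finset.mem_image, f]
    intro e
    obtain ⟨τ, h1, _, h2⟩ := hb e.1 (hS e.2)
    exact ⟨τ, h1, by rw [restrict_restrictAll e.2 subset_rfl, h2]⟩
  have hinj : Set.InjOn f (Partials T F S U a) := by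
    rintro _ ⟨b, _, rfl⟩ _ ⟨b', _, rfl⟩ h
    refine eq_of_restrict_eq (restrictAll_idem S b) (restrictAll_idem S b') fun e he => ?_
    exact congrFun h ⟨e, he⟩
  refine ⟨Set.Finite.of_injOn hmaps hinj P.finite_toSet, ?_⟩
  refine (Set.ncard_le_ncard_of_injOn f hmaps hinj P.finite_toSet).trans ?_
  rw [Set.ncard_coe_finset, Fintype.card_piFinset, Finset.prod_const, Finset.card_univ,
    Fintype.card_coe]
  exact Nat.pow_le_pow_left Finset.card_image_le _

theorem partials_mono {T : Finset (AnyTuple E dom)} {F S : Finset {e // e ∈ E}}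
    {U U' : Finset V} (hU : U ⊆ U') (b : PartAssign dom) :
    Partials T F S U' b ⊆ Partials T F S U (restrict U b) := by
  rintro _ ⟨c, ⟨hc, rfl⟩, rfl⟩
  exact ⟨c, ⟨hc, (restrict_restrict hU c).symm⟩, rfl⟩

/-- Since `e ∈ S` contains `U'`, a partial result over `S` fixes the values on `U'`, and the sets
for different `b` are disjoint. This breaks down for `S = ∅`, where `groupCount` truncates at one.
-/
theorem sum_ncard_partials_le {T : Finset (AnyTuple E dom)} {F S : Finset {e // e ∈ E}}
    {U U' : Finset V} (hU : U ⊆ U') (hS : S ⊆ F) {e : {e // e ∈ E}} (he : e ∈ S) (hUe : U' ⊆ e.1)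
    (a : PartAssign dom) {B : Finset (PartAssign dom)} (hB : ∀ b ∈ B, restrict U b = a) :
    ∑ b ∈ B, (Partials T F S U' b).ncard ≤ (Partials T F S U a).ncard := by
  have hfin := fun b => (partials_finite_and_le (T := T) hS U' b).1
  have hfin' := (partials_finite_and_le (T := T) hS U a).1
  calc ∑ b ∈ B, (Partials T F S U' b).ncard
      = ∑ b ∈ B, (hfin b).toFinset.card :=
        Finset.sum_congr rfl fun b _ => Set.ncard_eq_toFinset_card _ (hfin b)
    _ = (B.biUnion fun b => (hfin b).toFinset).card := by
        rw [Finset.card_biUnion]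
        intro b _ b' _ hbb
        rw [Function.onFun, Finset.disjoint_left]
        intro c hc hc'
        rw [Set.Finite.mem_toFinset] at hc hc'
        obtain ⟨d, ⟨_, rfl⟩, rfl⟩ := hc
        obtain ⟨d', ⟨_, rfl⟩, h⟩ := hc'
        apply hbb
        rw [← restrict_restrictAll he hUe d, ← restrict_restrictAll he hUe d', h]
    _ ≤ hfin'.toFinset.card := by
        apply Finset.card_le_card
        intro c hc
        obtain ⟨b, hb, hc⟩ := Finset.mem_biUnion.mp hc
        rw [Set.Finite.mem_toFinset] at *
        have := partials_mono hU b hc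
        rwa [hB b hb] at this
    _ = _ := (Set.ncard_eq_toFinset_card _ hfin').symm

theorem joins_of_subset {T : Finset (AnyTuple E dom)} {F F₁ : Finset {e // e ∈ E}} (h : F₁ ⊆ F)
    {b : PartAssign dom} (hb : b ∈ Joins T F) : restrictAll F₁ b ∈ Joins T F₁ := by
  refine ⟨restrictAll_idem _ _, fun e he => ?_⟩
  rw [restrict_restrictAll he subset_rfl]
  exact hb.2 e (h he)

/-- The two sets of relations share only attributes in `U`, whose values are fixed by `a`, so
results of both sides can be glued freely. -/
theorem ncard_partials_mul_le {T : Finset (AnyTuple E dom)} {F F₁ F₂ S S₁ S₂ : Finset {e // e ∈ E}}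
    {U : Finset V} (hF : ∀ e, e ∈ F ↔ e ∈ F₁ ∨ e ∈ F₂) (hS : S ⊆ F)
    (hS₁ : ∀ e, e ∈ S₁ ↔ e ∈ S ∧ e ∈ F₁) (hS₂ : ∀ e, e ∈ S₂ ↔ e ∈ S ∧ e ∈ F₂)
    (hU : ∀ e₁ ∈ F₁, ∀ e₂ ∈ F₂, ∀ v, v ∈ e₁.1 → v ∈ e₂.1 → v ∈ U) (a : PartAssign dom) :
    (Partials T F₁ S₁ U a).ncard * (Partials T F₂ S₂ U a).ncard ≤ (Partials T F S U a).ncard := by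
  rw [← Set.ncard_prod]
  let f : PartAssign dom × PartAssign dom → PartAssign dom := fun c v =>
    if ∃ e ∈ S₁, v ∈ e.1 then c.1 v else c.2 v
  apply Set.ncard_le_ncard_of_injOn f _ _ (partials_finite_and_le hS U a).1
  · rintro ⟨_, _⟩ ⟨⟨b₁, ⟨h₁, rfl⟩, rfl⟩, ⟨b₂, ⟨h₂, hb⟩, rfl⟩⟩
    let b : PartAssign dom := fun v => if ∃ e ∈ F₁, v ∈ e.1 then b₁ v else b₂ v
    have hb1 : ∀ e ∈ F₁, ∀ v ∈ e.1, b v = b₁ v := fun e he v hv => if_pos ⟨e, he, hv⟩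
    have hb2 : ∀ e ∈ F₂, ∀ v ∈ e.1, b v = b₂ v := by
      intro e he v hv
      by_cases h : ∃ e ∈ F₁, v ∈ e.1
      · obtain ⟨e', he', hv'⟩ := h
        have hvU := hU e' he' e he v hv' hv
        have := congrFun hb v
        rw [restrict_apply_of_mem hvU, restrict_apply_of_mem hvU] at this
        rw [hb1 e' he' v hv', this]
      · exact if_neg h
    have hbU : restrict U b = restrict U b₁ := by
      funext v
      by_cases hv : v ∈ U
      · rw [restrict_apply_of_mem hv, restrict_apply_of_mem hv]
        have := congrFun hb v
        rw [restrict_apply_of_mem hv, restrict_apply_of_mem hv] at this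
        simp only [b]
        split_ifs
        · rfl
        · exact this
      · rw [restrict_apply_of_notMem hv, restrict_apply_of_notMem hv]
    refine ⟨b, ⟨⟨?_, ?_⟩, hbU⟩, ?_⟩
    · funext v
      rw [restrictAll]
      split_ifs with h
      · rfl
      · push Not at h
        have h1 : ¬ ∃ e ∈ F₁, v ∈ e.1 := by
          rintro ⟨e, he, hv⟩
          exact h e ((hF e).mpr (Or.inl he)) hv
        have h2 : ¬ ∃ e ∈ F₂, v ∈ e.1 := by
          rintro ⟨e, he, hv⟩
          exact h e ((hF e).mpr (Or.inr he)) hv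
        simp only [b]
        rw [if_neg h1, ← h₂.1, restrictAll, if_neg h2]
    · intro e he
      rcases (hF e).mp he with he | he
      · obtain ⟨τ, hτ, h3, h4⟩ := h₁.2 e he
        refine ⟨τ, hτ, h3, h4.trans ?_⟩
        funext v
        by_cases hv : v ∈ e.1
        · rw [restrict_apply_of_mem hv, restrict_apply_of_mem hv, hb1 e he v hv]
        · rw [restrict_apply_of_notMem hv, restrict_apply_of_notMem hv]
      · obtain ⟨τ, hτ, h3, h4⟩ := h₂.2 e he
        refine ⟨τ, hτ, h3, h4.trans ?_⟩
        funext v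
        by_cases hv : v ∈ e.1
        · rw [restrict_apply_of_mem hv, restrict_apply_of_mem hv, hb2 e he v hv]
        · rw [restrict_apply_of_notMem hv, restrict_apply_of_notMem hv]
    · funext v
      simp only [f]
      by_cases h1 : ∃ e ∈ S₁, v ∈ e.1
      · rw [if_pos h1]
        obtain ⟨e, he, hv⟩ := h1
        rw [restrictAll, restrictAll, if_pos ⟨e, ((hS₁ e).mp he).1, hv⟩, if_pos ⟨e, he, hv⟩,
          hb1 e ((hS₁ e).mp he).2 v hv]
      · rw [if_neg h1]
        by_cases h2 : ∃ e ∈ S₂, v ∈ e.1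
        · obtain ⟨e, he, hv⟩ := h2
          rw [restrictAll, restrictAll, if_pos ⟨e, ((hS₂ e).mp he).1, hv⟩, if_pos ⟨e, he, hv⟩,
            hb2 e ((hS₂ e).mp he).2 v hv]
        · rw [restrictAll, restrictAll, if_neg h2, if_neg]
          rintro ⟨e, he, hv⟩
          rcases (hF e).mp (hS he) with h3 | h3
          · exact h1 ⟨e, (hS₁ e).mpr ⟨he, h3⟩, hv⟩
          · exact h2 ⟨e, (hS₂ e).mpr ⟨he, h3⟩, hv⟩
  · rintro ⟨_, _⟩ ⟨⟨b₁, ⟨h₁, ha₁⟩, rfl⟩, ⟨b₂, ⟨h₂, ha₂⟩, rfl⟩⟩ ⟨_, _⟩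
      ⟨⟨b₁', ⟨h₁', ha₁'⟩, rfl⟩, ⟨b₂', ⟨h₂', ha₂'⟩, rfl⟩⟩ h
    refine Prod.ext ?_ ?_
    · funext v
      have := congrFun h v
      simp only [f] at this
      by_cases h1 : ∃ e ∈ S₁, v ∈ e.1
      · rwa [if_pos h1, if_pos h1] at this
      · simp only [restrictAll]
        rw [if_neg h1, if_neg h1]
    · funext v
      have := congrFun h v
      simp only [f] at this
      by_cases h2 : ∃ e ∈ S₂, v ∈ e.1
      · by_cases h1 : ∃ e ∈ S₁, v ∈ e.1
        · simp only [restrictAll]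
          rw [if_pos h2, if_pos h2]
          obtain ⟨e, he, hv⟩ := h1
          obtain ⟨e', he', hv'⟩ := h2
          have hvU := hU e ((hS₁ e).mp he).2 e' ((hS₂ e').mp he').2 v hv hv'
          have := congrFun (ha₂.trans ha₂'.symm) v
          rwa [restrict_apply_of_mem hvU, restrict_apply_of_mem hvU] at this
        · rwa [if_neg h1, if_neg h1] at this
      · simp only [restrictAll]
        rw [if_neg h2, if_neg h2]

end Assignments


/-! ### Allocation of servers along a plan -/

section Packing

/-- Weights are placed one after the other on a line. At most three units of weight, where each weight
counts at most one, touch an interval of length one. -/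
theorem sum_min_one_le {β : Type*} [LinearOrder β] (B : Finset β) (ν : β → ℝ) (hν : ∀ b, 0 ≤ ν b)
    (c : ℕ) (Z : Finset β) (hZ : Z ⊆ B)
    (hc : ∀ b ∈ Z, ⌊∑ b' ∈ B.filter (· < b), ν b'⌋₊ ≤ c ∧
      c ≤ ⌊∑ b' ∈ B.filter (· < b), ν b'⌋₊ + ⌊ν b⌋₊) :
    ∑ b ∈ Z, min 1 (ν b) ≤ 3 * min 1 (∑ b ∈ B, ν b) := by
  have h0 : 0 ≤ ∑ b ∈ B, ν b := Finset.sum_nonneg fun b _ => hν b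
  have h1 : ∑ b ∈ Z, min 1 (ν b) ≤ ∑ b ∈ B, ν b :=
    (Finset.sum_le_sum fun b _ => min_le_right _ _).trans
      (Finset.sum_le_sum_of_subset_of_nonneg hZ fun b _ _ => hν b)
  -- If the total weight is below one, `h1` already bounds the sum by it.
  suffices h3 : ∑ b ∈ Z, min 1 (ν b) ≤ 3 by
    rcases le_total 1 (∑ b ∈ B, ν b) with h | h
    · rw [min_eq_left h]; linarith
    · rw [min_eq_right h]; linarith
  rcases Z.eq_empty_or_nonempty with rfl | hne
  · simp
  set b₀ := Z.min' hne
  set b₁ := Z.max' hne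
  have hb₀ : b₀ ∈ Z := Z.min'_mem hne
  have hb₁ : b₁ ∈ Z := Z.max'_mem hne
  by_cases h01 : b₀ = b₁
  · have : Z ⊆ {b₀} := by
      intro b hb
      have h1 := Z.min'_le b hb
      have h2 := Z.le_max' b hb
      rw [Finset.mem_singleton]
      exact le_antisymm (h2.trans h01.ge) h1
    calc ∑ b ∈ Z, min 1 (ν b) ≤ ∑ b ∈ {b₀}, min 1 (ν b) :=
          Finset.sum_le_sum_of_subset_of_nonneg this fun b _ _ => le_min zero_le_one (hν b)
      _ ≤ 1 := by simp
      _ ≤ 3 := by norm_num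
  have hlt : b₀ < b₁ := lt_of_le_of_ne (Z.min'_le _ hb₁) h01
  -- The first and the last weight count at most one each. The first ends at `c` or later and the
  -- last begins before `c + 1`, so those between weigh less than one.
  set Y := (Z.erase b₀).erase b₁ with hY
  have hb₁' : b₁ ∈ Z.erase b₀ := Finset.mem_erase.mpr ⟨Ne.symm h01, hb₁⟩
  have hsum : ∑ b ∈ Z, min 1 (ν b) ≤ 2 + ∑ b ∈ Y, ν b := by
    rw [← Finset.add_sum_erase Z _ hb₀, ← Finset.add_sum_erase _ _ hb₁', ← hY]
    have h2 := min_le_left 1 (ν b₀)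
    have h3 := min_le_left 1 (ν b₁)
    have h4 : ∑ b ∈ Y, min 1 (ν b) ≤ ∑ b ∈ Y, ν b :=
      Finset.sum_le_sum fun b _ => min_le_right _ _
    linarith
  have hx : ∑ b ∈ B.filter (· < b₀), ν b + ν b₀ + ∑ b ∈ Y, ν b ≤ ∑ b ∈ B.filter (· < b₁), ν b := by
    have hd1 : b₀ ∉ B.filter (· < b₀) := by simp
    have hY0 : ∀ b ∈ Y, b₀ < b ∧ b < b₁ ∧ b ∈ B := by
      intro b hb
      rw [hY, Finset.mem_erase, Finset.mem_erase] at hb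
      exact ⟨lt_of_le_of_ne (Z.min'_le b hb.2.2) (Ne.symm hb.2.1),
        lt_of_le_of_ne (Z.le_max' b hb.2.2) hb.1, hZ hb.2.2⟩
    have hd2 : Disjoint (insert b₀ (B.filter (· < b₀))) Y := by
      rw [Finset.disjoint_left]
      intro b hb hb'
      have := (hY0 b hb').1
      rw [Finset.mem_insert, Finset.mem_filter] at hb
      rcases hb with rfl | hb
      · exact lt_irrefl _ this
      · exact lt_asymm this hb.2
    rw [add_comm (∑ b ∈ B.filter (· < b₀), ν b), ← Finset.sum_insert hd1, ← Finset.sum_union hd2]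
    apply Finset.sum_le_sum_of_subset_of_nonneg
    · intro b hb
      rw [Finset.mem_union, Finset.mem_insert, Finset.mem_filter] at hb
      rw [Finset.mem_filter]
      rcases hb with (rfl | hb) | hb
      · exact ⟨hZ hb₀, hlt⟩
      · exact ⟨hb.1, hb.2.trans hlt⟩
      · exact ⟨(hY0 b hb).2.2, (hY0 b hb).2.1⟩
    · intro b _ _
      exact hν b
  have hs0 : 0 ≤ ∑ b ∈ B.filter (· < b₀), ν b := Finset.sum_nonneg fun b _ => hν b
  have hc0 : (c : ℝ) ≤ ∑ b ∈ B.filter (· < b₀), ν b + ν b₀ := by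
    have h2 := (hc b₀ hb₀).2
    have h3 := Nat.floor_le hs0
    have h4 := Nat.floor_le (hν b₀)
    have h5 : (c : ℝ) ≤ (⌊∑ b' ∈ B.filter (· < b₀), ν b'⌋₊ : ℝ) + (⌊ν b₀⌋₊ : ℝ) := by
      exact_mod_cast h2
    linarith
  have hc1 : ∑ b ∈ B.filter (· < b₁), ν b < c + 1 := by
    have h2 := (hc b₁ hb₁).1
    have h3 := Nat.lt_floor_add_one (∑ b ∈ B.filter (· < b₁), ν b)
    have h4 : (⌊∑ b' ∈ B.filter (· < b₁), ν b'⌋₊ : ℝ) ≤ c := by exact_mod_cast h2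
    linarith
  linarith

end Packing

/-! ### Plans, demands and slots -/

section Plans

variable {V : Type u} {E : Query V} {dom : V → Type v}

/-- `Plan U F`: the join of the relations in `F`, all of which contain the attributes `U`, can be
evaluated, for fixed values of the attributes `U`, by grouping by further common attributes and
Cartesian products. -/
inductive Plan {V : Type u} {E : Query V} : Finset V → Finset {e // e ∈ E} → Prop
  | leaf (e : {e // e ∈ E}) : Plan e.1 {e}
  | prod {U : Finset V} {F F₁ F₂ : Finset {e // e ∈ E}} (h₁ : Plan U F₁) (h₂ : Plan U F₂)
      (hF : ∀ e, e ∈ F ↔ e ∈ F₁ ∨ e ∈ F₂) (hd : Disjoint F₁ F₂)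
      (hU : ∀ e₁ ∈ F₁, ∀ e₂ ∈ F₂, ∀ v, v ∈ e₁.1 → v ∈ e₂.1 → v ∈ U) : Plan U F
  | group {U U' : Finset V} {F : Finset {e // e ∈ E}} (hU : U ⊆ U') (h : Plan U' F) : Plan U F

theorem Plan.subset {U : Finset V} {F : Finset {e // e ∈ E}} (h : Plan U F) :
    ∀ e ∈ F, U ⊆ e.1 := by
  induction h with
  | leaf e => intro e' he'; rw [Finset.mem_singleton.mp he']
  | prod h₁ h₂ hF hd hU ih₁ ih₂ =>
    intro e he
    rcases (hF e).mp he with he | he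
    · exact ih₁ e he
    · exact ih₂ e he
  | group hU h ih => exact fun e he => hU.trans (ih e he)

theorem Plan.nonempty {U : Finset V} {F : Finset {e // e ∈ E}} (h : Plan U F) : F.Nonempty := by
  induction h with
  | leaf e => exact ⟨e, Finset.mem_singleton_self e⟩
  | prod h₁ h₂ hF hd hU ih₁ ih₂ => exact ih₁.mono fun e he => (hF e).mpr (Or.inl he)
  | group hU h ih => exact ih

/-- The (fractional) number of servers needed, at load `L`, for the join with fixed values `a`. -/
noncomputable def need (N : Finset {e // e ∈ E} → PartAssign dom → ℕ) (F : Finset {e // e ∈ E})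
    (L : ℕ) (a : PartAssign dom) : ℝ :=
  ∑ S ∈ F.powerset.filter (·.Nonempty), (N S a : ℝ) / (L : ℝ) ^ S.card

theorem need_nonneg (N : Finset {e // e ∈ E} → PartAssign dom → ℕ) (F : Finset {e // e ∈ E})
    (L : ℕ) (a : PartAssign dom) : 0 ≤ need N F L a :=
  Finset.sum_nonneg fun _ _ => by positivity

theorem sum_powerset_eq (N : Finset {e // e ∈ E} → PartAssign dom → ℕ) (F : Finset {e // e ∈ E})
    (L : ℕ) (a : PartAssign dom) :
    ∑ S ∈ F.powerset, (N S a : ℝ) / (L : ℝ) ^ S.card = N ∅ a + need N F L a := by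
  have : F.powerset.filter (fun S => ¬ S.Nonempty) = {∅} := by
    ext S
    simp only [Finset.mem_filter, Finset.mem_powerset, Finset.not_nonempty_iff_eq_empty,
      Finset.mem_singleton]
    constructor
    · exact fun h => h.2
    · rintro rfl; simp
  rw [← Finset.sum_filter_add_sum_filter_not F.powerset (·.Nonempty), this, need, add_comm]
  simp

/-- With the term for `S = ∅` included, the sum over subsets is multiplicative for disjoint sets of
relations. Where that term is one, this says that `1 + need` is multiplicative. -/
theorem add_need_prod {N₁ N₂ : Finset {e // e ∈ E} → PartAssign dom → ℕ}
    {F F₁ F₂ : Finset {e // e ∈ E}} (hF : ∀ e, e ∈ F ↔ e ∈ F₁ ∨ e ∈ F₂) (hd : Disjoint F₁ F₂) (L : ℕ)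
    (a : PartAssign dom) :
    ((N₁ ∅ a * N₂ ∅ a : ℕ) : ℝ) +
      need (fun S a => N₁ (S.filter (· ∈ F₁)) a * N₂ (S.filter (· ∈ F₂)) a) F L a =
    (N₁ ∅ a + need N₁ F₁ L a) * (N₂ ∅ a + need N₂ F₂ L a) := by
  have h := sum_powerset_eq (fun S a => N₁ (S.filter (· ∈ F₁)) a * N₂ (S.filter (· ∈ F₂)) a) F L a
  simp only [Finset.filter_empty] at h
  rw [← h, ← sum_powerset_eq, ← sum_powerset_eq, Finset.sum_mul_sum, ← Finset.sum_product']
  have hF' : F = F₁ ∪ F₂ := by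
    ext e
    rw [hF, Finset.mem_union]
  have hf1 : ∀ S₁ S₂ : Finset {e // e ∈ E}, S₁ ⊆ F₁ → S₂ ⊆ F₂ →
      (S₁ ∪ S₂).filter (· ∈ F₁) = S₁ := by
    intro S₁ S₂ h1 h2
    ext e
    simp only [Finset.mem_filter, Finset.mem_union]
    constructor
    · rintro ⟨h3 | h3, h4⟩
      · exact h3
      · exact absurd (h2 h3) (Finset.disjoint_left.mp hd h4)
    · exact fun h3 => ⟨Or.inl h3, h1 h3⟩
  have hf2 : ∀ S₁ S₂ : Finset {e // e ∈ E}, S₁ ⊆ F₁ → S₂ ⊆ F₂ →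
      (S₁ ∪ S₂).filter (· ∈ F₂) = S₂ := by
    intro S₁ S₂ h1 h2
    ext e
    simp only [Finset.mem_filter, Finset.mem_union]
    constructor
    · rintro ⟨h3 | h3, h4⟩
      · exact absurd h4 (Finset.disjoint_left.mp hd (h1 h3))
      · exact h3
    · exact fun h3 => ⟨Or.inr h3, h2 h3⟩
  have hf : ∀ S ⊆ F, S.filter (· ∈ F₁) ∪ S.filter (· ∈ F₂) = S := by
    intro S hS
    ext e
    simp only [Finset.mem_filter, Finset.mem_union]
    constructor
    · rintro (h | h) <;> exact h.1
    · intro h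
      rcases (hF e).mp (hS h) with h' | h'
      · exact Or.inl ⟨h, h'⟩
      · exact Or.inr ⟨h, h'⟩
  refine Finset.sum_bij' (fun S _ => (S.filter (· ∈ F₁), S.filter (· ∈ F₂)))
    (fun P _ => P.1 ∪ P.2) ?_ ?_ ?_ ?_ ?_
  · intro S _
    simp only [Finset.mem_product, Finset.mem_powerset]
    exact ⟨fun e he => (Finset.mem_filter.mp he).2, fun e he => (Finset.mem_filter.mp he).2⟩
  · intro P hP
    simp only [Finset.mem_product, Finset.mem_powerset] at hP
    rw [Finset.mem_powerset, hF']
    exact Finset.union_subset_union hP.1 hP.2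
  · intro S hS
    exact hf S (Finset.mem_powerset.mp hS)
  · intro P hP
    simp only [Finset.mem_product, Finset.mem_powerset] at hP
    rw [hf1 _ _ hP.1 hP.2, hf2 _ _ hP.1 hP.2]
  · intro S hS
    have hc : S.card = (S.filter (· ∈ F₁)).card + (S.filter (· ∈ F₂)).card := by
      conv_lhs => rw [← hf S (Finset.mem_powerset.mp hS)]
      apply Finset.card_union_of_disjoint
      rw [Finset.disjoint_filter]
      intro e _ h1 h2
      exact Finset.disjoint_left.mp hd h1 h2
    rw [hc, pow_add, Nat.cast_mul, mul_div_mul_comm]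

/-- The properties of the numbers `N S a`, which count partial join results, and of the sets `Sl L τ`
of slots to which the tuples are sent, for the join of the relations in `F`, where the values `a` of
the attributes `U` are fixed and the aimed load is `L`. -/
structure Spec (T : Finset (AnyTuple E dom)) (U : Finset V) (F : Finset {e // e ∈ E}) (C : ℕ)
    (N : Finset {e // e ∈ E} → PartAssign dom → ℕ) (Sl : ℕ → AnyTuple E dom → Finset ℕ) : Prop where
  le_ncard : ∀ S ⊆ F, ∀ a, N S a ≤ (Partials T F S U a).ncard
  empty_le : ∀ a, N ∅ a ≤ 1
  eq_zero : ∀ a, N ∅ a = 0 → ∀ S, N S a = 0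
  alive : ∀ b ∈ Joins T F, N ∅ (restrict U b) = 1
  proj : ∀ S a, N S a ≠ 0 → ∀ e ∈ F, ∃ τ ∈ T, τ.1 = e ∧ restrict U τ.assign = a
  slot_le : ∀ L, 0 < L → ∀ τ : AnyTuple E dom, τ.1 ∈ F → ∀ c ∈ Sl L τ,
    c ≤ ⌊need N F L (restrict U τ.assign)⌋₊
  meet : ∀ L, 0 < L → ∀ b ∈ Joins T F, ∃ c ≤ ⌊need N F L (restrict U b)⌋₊,
    ∀ τ : AnyTuple E dom, τ.1 ∈ F → τ.assign = restrict τ.1.1 b → c ∈ Sl L τ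
  -- The factor `min 1 need` is what allows many groups of small demand to share a slot.
  load : ∀ L, 0 < L → ∀ a c, ∀ e ∈ F,
    ((T.filter fun τ => τ.1 = e ∧ restrict U τ.assign = a ∧ c ∈ Sl L τ).card : ℝ) ≤
      C * L * min 1 (need N F L a)

/-- With all attributes of `e` fixed there is at most one tuple. Its demand is `1 / L`, which allows
the load `L * min 1 (1 / L) = 1`. -/
theorem Spec.leaf (T : Finset (AnyTuple E dom)) (e : {e // e ∈ E}) :
    Spec T e.1 {e} 1 (fun _ a => if ∃ τ ∈ T, τ.1 = e ∧ τ.assign = a then 1 else 0)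
      (fun _ _ => {0}) := by
  have hneed : ∀ L a, need (fun _ a => if ∃ τ ∈ T, τ.1 = e ∧ τ.assign = a then 1 else 0) {e} L a =
      (if ∃ τ ∈ T, τ.1 = e ∧ τ.assign = a then 1 else 0) / (L : ℝ) := by
    intro L a
    have : (({e} : Finset {e // e ∈ E}).powerset.filter (·.Nonempty)) = {{e}} := by
      ext S
      simp only [Finset.mem_filter, Finset.mem_powerset, Finset.subset_singleton_iff,
        Finset.mem_singleton]
      constructor
      · rintro ⟨rfl | h, h'⟩
        · simp at h'
        · exact h
      · rintro rfl
        simp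
    rw [need, this, Finset.sum_singleton]
    simp
  constructor
  · intro S hS a
    split_ifs with h
    · obtain ⟨τ, hτ, rfl, rfl⟩ := h
      rw [Nat.one_le_iff_ne_zero, Ne, Set.ncard_eq_zero (partials_finite_and_le hS _ _).1,
        ← Ne, ← Set.nonempty_iff_ne_empty]
      refine ⟨_, τ.assign, ⟨⟨?_, ?_⟩, restrict_assign τ⟩, rfl⟩
      · funext x
        rw [restrictAll]
        split_ifs with h
        · rfl
        · rw [AnyTuple.assign, dif_neg]
          intro hx
          exact h ⟨τ.1, by simp, hx⟩
      · intro e' he'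
        rw [Finset.mem_singleton.mp he']
        exact ⟨τ, hτ, rfl, (restrict_assign τ).symm⟩
    · exact Nat.zero_le _
  · intro a
    split_ifs <;> simp
  · intro a h S
    exact h
  · intro b hb
    rw [if_pos]
    exact hb.2 e (by simp)
  · intro S a h e' he'
    rw [Finset.mem_singleton.mp he']
    split_ifs at h with h'
    · obtain ⟨τ, hτ, rfl, rfl⟩ := h'
      exact ⟨τ, hτ, rfl, restrict_assign τ⟩
    · exact absurd rfl h
  · intro L _ τ _ c hc
    rw [Finset.mem_singleton.mp hc]
    exact Nat.zero_le _
  · intro L _ b _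
    exact ⟨0, Nat.zero_le _, fun _ _ _ => Finset.mem_singleton_self 0⟩
  · intro L hL a c e' he'
    rw [Finset.mem_singleton.mp he', hneed]
    have hL' : (1 : ℝ) ≤ L := by exact_mod_cast hL
    have hcard : (T.filter fun τ => τ.1 = e ∧ restrict e.1 τ.assign = a ∧
        c ∈ ({0} : Finset ℕ)).card ≤ 1 := by
      rw [Finset.card_le_one]
      intro σ hσ τ hτ
      simp only [Finset.mem_filter] at hσ hτ
      obtain ⟨_, h1, h2, _⟩ := hσ
      obtain ⟨_, h3, h4, _⟩ := hτ
      refine assign_inj (h1.trans h3.symm) ?_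
      rw [← restrict_assign σ, ← restrict_assign τ, h1, h3, h2, h4]
    split_ifs with h
    · have h1 : min 1 (1 / (L : ℝ)) = 1 / L := min_eq_right (by
        rw [div_le_one (by linarith)]; exact hL')
      rw [h1]
      have h2 : ((1 : ℕ) : ℝ) * L * (1 / L) = 1 := by
        field_simp
        simp
      rw [h2]
      exact_mod_cast hcard
    · have : (T.filter fun τ => τ.1 = e ∧ restrict e.1 τ.assign = a ∧
          c ∈ ({0} : Finset ℕ)) = ∅ := by
        rw [Finset.filter_eq_empty_iff]
        rintro τ hτ ⟨h1, h2, _⟩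
        apply h
        refine ⟨τ, hτ, h1, ?_⟩
        rw [← h2, ← h1, restrict_assign]
      rw [this]
      simp

end Plans


/-! ### Slots for products and for groups -/

section SpecSteps

variable {V : Type u} {E : Query V} {dom : V → Type v}

/-- The slots of a tuple in a Cartesian product of two joins, arranged in a grid. -/
noncomputable def prodSlots (U : Finset V) (F₁ F₂ : Finset {e // e ∈ E})
    (N₁ N₂ : Finset {e // e ∈ E} → PartAssign dom → ℕ)
    (Sl₁ Sl₂ : ℕ → AnyTuple E dom → Finset ℕ) (L : ℕ) (τ : AnyTuple E dom) : Finset ℕ :=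
  if N₁ ∅ (restrict U τ.assign) * N₂ ∅ (restrict U τ.assign) = 1 then
    if τ.1 ∈ F₁ then
      (Sl₁ L τ ×ˢ Finset.range (⌊need N₂ F₂ L (restrict U τ.assign)⌋₊ + 1)).image
        fun c => c.1 + (⌊need N₁ F₁ L (restrict U τ.assign)⌋₊ + 1) * c.2
    else
      (Finset.range (⌊need N₁ F₁ L (restrict U τ.assign)⌋₊ + 1) ×ˢ Sl₂ L τ).image
        fun c => c.1 + (⌊need N₁ F₁ L (restrict U τ.assign)⌋₊ + 1) * c.2
  else ∅

theorem restrict_assign_eq {U : Finset V} {τ : AnyTuple E dom} (hU : U ⊆ τ.1.1) {b : PartAssign dom}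
    (h : τ.assign = restrict τ.1.1 b) : restrict U τ.assign = restrict U b := by
  rw [h, restrict_restrict hU]

/-- A tuple is copied to all cells of the grid whose coordinate on its own side is one of its slots.
For demands `n₁` and `n₂` the grid has `(⌊n₁⌋ + 1) * (⌊n₂⌋ + 1)` cells, at most `(1 + n₁) * (1 + n₂)
= 1 + need`. A cell gets no more from either side than a slot of that side does. -/
theorem Spec.prod {T : Finset (AnyTuple E dom)} {U : Finset V} {F F₁ F₂ : Finset {e // e ∈ E}}
    {C₁ C₂ : ℕ} {N₁ N₂ : Finset {e // e ∈ E} → PartAssign dom → ℕ}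
    {Sl₁ Sl₂ : ℕ → AnyTuple E dom → Finset ℕ} (h₁ : Spec T U F₁ C₁ N₁ Sl₁)
    (h₂ : Spec T U F₂ C₂ N₂ Sl₂) (hF : ∀ e, e ∈ F ↔ e ∈ F₁ ∨ e ∈ F₂) (hd : Disjoint F₁ F₂)
    (hU : ∀ e₁ ∈ F₁, ∀ e₂ ∈ F₂, ∀ v, v ∈ e₁.1 → v ∈ e₂.1 → v ∈ U)
    (hs₁ : ∀ e ∈ F₁, U ⊆ e.1) (hs₂ : ∀ e ∈ F₂, U ⊆ e.1) (hn₁ : F₁.Nonempty) (hn₂ : F₂.Nonempty) :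
    Spec T U F (C₁ + C₂) (fun S a => N₁ (S.filter (· ∈ F₁)) a * N₂ (S.filter (· ∈ F₂)) a)
      (prodSlots U F₁ F₂ N₁ N₂ Sl₁ Sl₂) := by
  have hneed : ∀ L a, N₁ ∅ a * N₂ ∅ a = 1 →
      1 + need (fun S a => N₁ (S.filter (· ∈ F₁)) a * N₂ (S.filter (· ∈ F₂)) a) F L a =
      (1 + need N₁ F₁ L a) * (1 + need N₂ F₂ L a) := by
    intro L a h
    have := add_need_prod (N₁ := N₁) (N₂ := N₂) hF hd L a
    obtain ⟨h1, h2⟩ := mul_eq_one.mp h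
    rw [h, h1, h2] at this
    exact_mod_cast this
  have hgrid : ∀ L a, N₁ ∅ a * N₂ ∅ a = 1 → ∀ c₁ c₂, c₁ ≤ ⌊need N₁ F₁ L a⌋₊ →
      c₂ ≤ ⌊need N₂ F₂ L a⌋₊ → c₁ + (⌊need N₁ F₁ L a⌋₊ + 1) * c₂ ≤
      ⌊need (fun S a => N₁ (S.filter (· ∈ F₁)) a * N₂ (S.filter (· ∈ F₂)) a) F L a⌋₊ := by
    intro L a h c₁ c₂ hc₁ hc₂
    apply Nat.le_floor
    have h1 := Nat.floor_le (need_nonneg N₁ F₁ L a)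
    have h2 := Nat.floor_le (need_nonneg N₂ F₂ L a)
    have h3 := hneed L a h
    have h4 : c₁ + (⌊need N₁ F₁ L a⌋₊ + 1) * c₂ + 1 ≤
        (1 + ⌊need N₁ F₁ L a⌋₊) * (1 + ⌊need N₂ F₂ L a⌋₊) := by nlinarith
    have h5 : ((c₁ + (⌊need N₁ F₁ L a⌋₊ + 1) * c₂ : ℕ) : ℝ) + 1 ≤
        (1 + (⌊need N₁ F₁ L a⌋₊ : ℝ)) * (1 + (⌊need N₂ F₂ L a⌋₊ : ℝ)) := by exact_mod_cast h4
    have h6 : (1 + (⌊need N₁ F₁ L a⌋₊ : ℝ)) * (1 + (⌊need N₂ F₂ L a⌋₊ : ℝ)) ≤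
        (1 + need N₁ F₁ L a) * (1 + need N₂ F₂ L a) := by
      apply mul_le_mul <;> linarith
    linarith
  have hmin : ∀ L a, N₁ ∅ a * N₂ ∅ a = 1 →
      need N₁ F₁ L a ≤ need (fun S a => N₁ (S.filter (· ∈ F₁)) a * N₂ (S.filter (· ∈ F₂)) a) F L a ∧
      need N₂ F₂ L a ≤
        need (fun S a => N₁ (S.filter (· ∈ F₁)) a * N₂ (S.filter (· ∈ F₂)) a) F L a := by
    intro L a h
    have h3 := hneed L a h
    have h1 := need_nonneg N₁ F₁ L a
    have h2 := need_nonneg N₂ F₂ L a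
    constructor <;> nlinarith
  have halive : ∀ b ∈ Joins T F, N₁ ∅ (restrict U b) = 1 ∧ N₂ ∅ (restrict U b) = 1 := by
    intro b hb
    obtain ⟨e₁, he₁⟩ := hn₁
    obtain ⟨e₂, he₂⟩ := hn₂
    have h3 := h₁.alive _ (joins_of_subset (fun e he => (hF e).mpr (Or.inl he)) hb)
    have h4 := h₂.alive _ (joins_of_subset (fun e he => (hF e).mpr (Or.inr he)) hb)
    rw [restrict_restrictAll he₁ (hs₁ e₁ he₁)] at h3
    rw [restrict_restrictAll he₂ (hs₂ e₂ he₂)] at h4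
    exact ⟨h3, h4⟩
  constructor
  · intro S hS a
    refine (Nat.mul_le_mul (h₁.le_ncard _ (fun e he => (Finset.mem_filter.mp he).2) a)
      (h₂.le_ncard _ (fun e he => (Finset.mem_filter.mp he).2) a)).trans ?_
    exact ncard_partials_mul_le hF hS (fun e => Finset.mem_filter) (fun e => Finset.mem_filter) hU a
  · intro a
    simp only [Finset.filter_empty]
    exact Nat.mul_le_mul (h₁.empty_le a) (h₂.empty_le a)
  · intro a h S
    simp only [Finset.filter_empty] at h
    rcases Nat.mul_eq_zero.mp h with h | h
    · rw [h₁.eq_zero a h, zero_mul]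
    · rw [h₂.eq_zero a h, mul_zero]
  · intro b hb
    simp only [Finset.filter_empty]
    rw [(halive b hb).1, (halive b hb).2]
  · intro S a h e he
    rcases (hF e).mp he with he | he
    · exact h₁.proj _ a (left_ne_zero_of_mul h) e he
    · exact h₂.proj _ a (right_ne_zero_of_mul h) e he
  · intro L hL τ hτ c hc
    rw [prodSlots] at hc
    split_ifs at hc with h3 h4
    · obtain ⟨⟨c₁, c₂⟩, hc', rfl⟩ := Finset.mem_image.mp hc
      rw [Finset.mem_product, Finset.mem_range] at hc'
      exact hgrid L _ h3 _ _ (h₁.slot_le L hL τ h4 _ hc'.1) (Nat.lt_succ_iff.mp hc'.2)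
    · obtain ⟨⟨c₁, c₂⟩, hc', rfl⟩ := Finset.mem_image.mp hc
      rw [Finset.mem_product, Finset.mem_range] at hc'
      exact hgrid L _ h3 _ _ (Nat.lt_succ_iff.mp hc'.1)
        (h₂.slot_le L hL τ (((hF _).mp hτ).resolve_left h4) _ hc'.2)
    · simp at hc
  · intro L hL b hb
    obtain ⟨e₁, he₁⟩ := hn₁
    obtain ⟨e₂, he₂⟩ := hn₂
    obtain ⟨c₁, hc₁, hm₁⟩ := h₁.meet L hL _
      (joins_of_subset (fun e he => (hF e).mpr (Or.inl he)) hb)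
    obtain ⟨c₂, hc₂, hm₂⟩ := h₂.meet L hL _
      (joins_of_subset (fun e he => (hF e).mpr (Or.inr he)) hb)
    rw [restrict_restrictAll he₁ (hs₁ e₁ he₁)] at hc₁
    rw [restrict_restrictAll he₂ (hs₂ e₂ he₂)] at hc₂
    have h1 : N₁ ∅ (restrict U b) * N₂ ∅ (restrict U b) = 1 := by
      rw [(halive b hb).1, (halive b hb).2]
    refine ⟨_, hgrid L _ h1 c₁ c₂ hc₁ hc₂, fun τ hτ hτb => ?_⟩
    rcases (hF _).mp hτ with h3 | h3
    · have hr := restrict_assign_eq (hs₁ _ h3) hτb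
      rw [prodSlots, hr, if_pos h1, if_pos h3, Finset.mem_image]
      refine ⟨(c₁, c₂), Finset.mem_product.mpr ⟨hm₁ τ h3 ?_, Finset.mem_range.mpr (by omega)⟩, rfl⟩
      rw [restrict_restrictAll h3 subset_rfl, hτb]
    · have hr := restrict_assign_eq (hs₂ _ h3) hτb
      have h4 : τ.1 ∉ F₁ := fun h => Finset.disjoint_left.mp hd h h3
      rw [prodSlots, hr, if_pos h1, if_neg h4, Finset.mem_image]
      refine ⟨(c₁, c₂), Finset.mem_product.mpr ⟨Finset.mem_range.mpr (by omega), hm₂ τ h3 ?_⟩, rfl⟩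
      rw [restrict_restrictAll h3 subset_rfl, hτb]
  · intro L hL a c e he
    have hL' : (0 : ℝ) ≤ L := by positivity
    have hC₁ : (0 : ℝ) ≤ C₁ := by positivity
    have hC₂ : (0 : ℝ) ≤ C₂ := by positivity
    by_cases h3 : N₁ ∅ a * N₂ ∅ a = 1
    · set ν := need (fun S a => N₁ (S.filter (· ∈ F₁)) a * N₂ (S.filter (· ∈ F₂)) a) F L a
      have hν : 0 ≤ min 1 ν := le_min zero_le_one (need_nonneg _ _ _ _)
      rcases (hF e).mp he with h4 | h4
      · have key := h₁.load L hL a (c % (⌊need N₁ F₁ L a⌋₊ + 1)) e h4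
        have hle : min 1 (need N₁ F₁ L a) ≤ min 1 ν := min_le_min le_rfl (hmin L a h3).1
        have hsub : (T.filter fun τ => τ.1 = e ∧ restrict U τ.assign = a ∧
            c ∈ prodSlots U F₁ F₂ N₁ N₂ Sl₁ Sl₂ L τ).card ≤ (T.filter fun τ => τ.1 = e ∧
            restrict U τ.assign = a ∧ c % (⌊need N₁ F₁ L a⌋₊ + 1) ∈ Sl₁ L τ).card := by
          apply Finset.card_le_card
          intro τ hτ
          rw [Finset.mem_filter] at hτ ⊢
          obtain ⟨h5, h6, h7, h8⟩ := hτ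
          refine ⟨h5, h6, h7, ?_⟩
          rw [prodSlots, h7, if_pos h3, if_pos (by rw [h6]; exact h4), Finset.mem_image] at h8
          obtain ⟨⟨c₁, c₂⟩, h9, rfl⟩ := h8
          rw [Finset.mem_product] at h9
          have h10 := h₁.slot_le L hL τ (by rw [h6]; exact h4) _ h9.1
          rw [h7] at h10
          simp only at *
          rw [Nat.add_mul_mod_self_left, Nat.mod_eq_of_lt (by omega)]
          exact h9.1
        calc _ ≤ (C₁ : ℝ) * L * min 1 (need N₁ F₁ L a) := le_trans (by exact_mod_cast hsub) key
          _ ≤ ((C₁ + C₂ : ℕ) : ℝ) * L * min 1 ν := by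
            push_cast
            have h0 : 0 ≤ min 1 (need N₁ F₁ L a) := le_min zero_le_one (need_nonneg _ _ _ _)
            apply mul_le_mul _ hle h0 (by positivity)
            apply mul_le_mul_of_nonneg_right _ hL'
            linarith
      · have key := h₂.load L hL a (c / (⌊need N₁ F₁ L a⌋₊ + 1)) e h4
        have hle : min 1 (need N₂ F₂ L a) ≤ min 1 ν := min_le_min le_rfl (hmin L a h3).2
        have hsub : (T.filter fun τ => τ.1 = e ∧ restrict U τ.assign = a ∧
            c ∈ prodSlots U F₁ F₂ N₁ N₂ Sl₁ Sl₂ L τ).card ≤ (T.filter fun τ => τ.1 = e ∧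
            restrict U τ.assign = a ∧ c / (⌊need N₁ F₁ L a⌋₊ + 1) ∈ Sl₂ L τ).card := by
          apply Finset.card_le_card
          intro τ hτ
          rw [Finset.mem_filter] at hτ ⊢
          obtain ⟨h5, h6, h7, h8⟩ := hτ
          refine ⟨h5, h6, h7, ?_⟩
          have h4' : τ.1 ∉ F₁ := by
            rw [h6]
            exact fun h => Finset.disjoint_left.mp hd h h4
          rw [prodSlots, h7, if_pos h3, if_neg h4', Finset.mem_image] at h8
          obtain ⟨⟨c₁, c₂⟩, h9, rfl⟩ := h8
          rw [Finset.mem_product, Finset.mem_range] at h9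
          simp only at *
          rw [Nat.add_mul_div_left _ _ (Nat.succ_pos _), Nat.div_eq_of_lt h9.1, zero_add]
          exact h9.2
        calc _ ≤ (C₂ : ℝ) * L * min 1 (need N₂ F₂ L a) := le_trans (by exact_mod_cast hsub) key
          _ ≤ ((C₁ + C₂ : ℕ) : ℝ) * L * min 1 ν := by
            push_cast
            have h0 : 0 ≤ min 1 (need N₂ F₂ L a) := le_min zero_le_one (need_nonneg _ _ _ _)
            apply mul_le_mul _ hle h0 (by positivity)
            apply mul_le_mul_of_nonneg_right _ hL'
            linarith
    · have : (T.filter fun τ => τ.1 = e ∧ restrict U τ.assign = a ∧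
          c ∈ prodSlots U F₁ F₂ N₁ N₂ Sl₁ Sl₂ L τ) = ∅ := by
        rw [Finset.filter_eq_empty_iff]
        rintro τ hτ ⟨h1, h2, h4⟩
        rw [prodSlots, h2, if_neg h3] at h4
        simp at h4
      rw [this, Finset.card_empty, Nat.cast_zero]
      have hν := need_nonneg (fun S a => N₁ (S.filter (· ∈ F₁)) a * N₂ (S.filter (· ∈ F₂)) a) F L a
      have : 0 ≤ min 1 (need (fun S a => N₁ (S.filter (· ∈ F₁)) a * N₂ (S.filter (· ∈ F₂)) a) F L a) :=
        le_min zero_le_one hν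
      positivity

/-! ### Grouping -/

/-- The projections to the attributes `U'` of the tuples of the relation `e`. -/
noncomputable def projections (T : Finset (AnyTuple E dom)) (e : {e // e ∈ E}) (U' : Finset V) :
    Finset (PartAssign dom) :=
  (T.filter fun τ => τ.1 = e).image fun τ => restrict U' τ.assign

theorem mem_projections {T : Finset (AnyTuple E dom)} {e : {e // e ∈ E}} {U' : Finset V}
    {b : PartAssign dom} :
    b ∈ projections T e U' ↔ ∃ τ ∈ T, τ.1 = e ∧ restrict U' τ.assign = b := by
  simp [projections, and_assoc]

/-- The projections in `projections T e U'` that are extensions of `a`. -/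
noncomputable def subgroups (T : Finset (AnyTuple E dom)) (e : {e // e ∈ E}) (U U' : Finset V)
    (a : PartAssign dom) : Finset (PartAssign dom) :=
  (projections T e U').filter fun b => restrict U b = a

theorem mem_subgroups {T : Finset (AnyTuple E dom)} {e : {e // e ∈ E}} {U U' : Finset V}
    {a b : PartAssign dom} :
    b ∈ subgroups T e U U' a ↔ b ∈ projections T e U' ∧ restrict U b = a := by
  simp only [subgroups, Finset.mem_filter]

/-- The counts for a group are the sums of the counts of its subgroups. -/
noncomputable def groupCount (T : Finset (AnyTuple E dom)) (e : {e // e ∈ E}) (U U' : Finset V)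
    (F : Finset {e // e ∈ E}) (N : Finset {e // e ∈ E} → PartAssign dom → ℕ)
    (S : Finset {e // e ∈ E}) (a : PartAssign dom) : ℕ :=
  if S = ∅ then
    min 1 (∑ b ∈ subgroups T e U U' a, if S ⊆ F then N S b else 0)
  else ∑ b ∈ subgroups T e U U' a, if S ⊆ F then N S b else 0

theorem Spec.card_le {T : Finset (AnyTuple E dom)} {U : Finset V} {F : Finset {e // e ∈ E}}
    {C : ℕ} {N : Finset {e // e ∈ E} → PartAssign dom → ℕ}
    {Sl : ℕ → AnyTuple E dom → Finset ℕ} (h : Spec T U F C N Sl) {L : ℕ} (hL : 0 < L)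
    {a : PartAssign dom} {c : ℕ} {e : {e // e ∈ E}} (he : e ∈ F) {W : Finset (AnyTuple E dom)}
    (hW : ∀ τ ∈ W, τ ∈ T ∧ τ.1 = e ∧ restrict U τ.assign = a ∧ c ∈ Sl L τ) :
    (W.card : ℝ) ≤ C * L * min 1 (need N F L a) := by
  refine le_trans ?_ (h.load L hL a c e he)
  exact_mod_cast Finset.card_le_card fun τ hτ => Finset.mem_filter.mpr (hW τ hτ)

variable [LinearOrder (PartAssign dom)]

/-- The slots of a tuple in its group: the subgroups are placed one after the other. -/
noncomputable def groupSlots (T : Finset (AnyTuple E dom)) (e : {e // e ∈ E}) (U U' : Finset V)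
    (F : Finset {e // e ∈ E}) (N : Finset {e // e ∈ E} → PartAssign dom → ℕ)
    (Sl : ℕ → AnyTuple E dom → Finset ℕ) (L : ℕ) (τ : AnyTuple E dom) : Finset ℕ :=
  (Sl L τ).image fun c => c + ⌊∑ b ∈ (subgroups T e U U' (restrict U τ.assign)).filter
    (· < restrict U' τ.assign), need N F L b⌋₊

/-- Demands of subgroups add up, so the subgroups are placed end to end on a line, each shifted by
the integer part of its offset. A slot may meet many of them; `sum_min_one_le` bounds their joint
load at the price of the factor 3. The relation `e₀` suffices to list the subgroups, because by
`proj` one that is absent from it has no demand. -/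
theorem Spec.group {T : Finset (AnyTuple E dom)} {U U' : Finset V} {F : Finset {e // e ∈ E}}
    {C : ℕ} {N : Finset {e // e ∈ E} → PartAssign dom → ℕ}
    {Sl : ℕ → AnyTuple E dom → Finset ℕ} (h : Spec T U' F C N Sl) (hU : U ⊆ U')
    (hs : ∀ e ∈ F, U' ⊆ e.1) {e₀ : {e // e ∈ E}} (he₀ : e₀ ∈ F) :
    Spec T U F (3 * C) (groupCount T e₀ U U' F N) (groupSlots T e₀ U U' F N Sl) := by
  obtain ⟨B, hB⟩ : ∃ B : PartAssign dom → Finset (PartAssign dom), 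
    B = subgroups T e₀ U U' := ⟨_, rfl⟩
  have hmemB : ∀ a b, b ∈ B a ↔ b ∈ projections T e₀ U' ∧ restrict U b = a := by
    intro a b
    rw [hB, mem_subgroups]
  have hN : ∀ S, S.Nonempty → S ⊆ F → ∀ a, groupCount T e₀ U U' F N S a = ∑ b ∈ B a, N S b := by
    intro S hS hSF a
    rw [groupCount, if_neg hS.ne_empty, hB]
    simp only [if_pos hSF]
  have hN0 : ∀ a, groupCount T e₀ U U' F N ∅ a = min 1 (∑ b ∈ B a, N ∅ b) := by
    intro a
    rw [groupCount, if_pos rfl, hB]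
    simp only [Finset.empty_subset, if_true]
  have hneed : ∀ L a, need (groupCount T e₀ U U' F N) F L a = ∑ b ∈ B a, need N F L b := by
    intro L a
    simp only [need]
    rw [Finset.sum_comm]
    refine Finset.sum_congr rfl fun S hS => ?_
    rw [Finset.mem_filter, Finset.mem_powerset] at hS
    rw [hN S hS.2 hS.1, Nat.cast_sum, Finset.sum_div]
  have hneed0 : ∀ L b, b ∉ projections T e₀ U' → need N F L b = 0 := by
    intro L b hb
    rw [need]
    refine Finset.sum_eq_zero fun S _ => ?_
    have : N S b = 0 := by
      by_contra hc
      exact hb (mem_projections.mpr (h.proj S b hc e₀ he₀))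
    rw [this]
    simp
  have hnn : ∀ L b, 0 ≤ need N F L b := need_nonneg N F
  have hslots : ∀ L τ, groupSlots T e₀ U U' F N Sl L τ = (Sl L τ).image fun c =>
      c + ⌊∑ b ∈ (B (restrict U τ.assign)).filter (· < restrict U' τ.assign), need N F L b⌋₊ := by
    intro L τ
    rw [groupSlots, hB]
  have hpos : ∀ L b c, c ≤ ⌊need N F L b⌋₊ →
      c + ⌊∑ b' ∈ (B (restrict U b)).filter (· < b), need N F L b'⌋₊ ≤
        ⌊need (groupCount T e₀ U U' F N) F L (restrict U b)⌋₊ := by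
    intro L b c hc
    apply Nat.le_floor
    rw [hneed]
    have hs0 : 0 ≤ ∑ b' ∈ (B (restrict U b)).filter (· < b), need N F L b' :=
      Finset.sum_nonneg fun b _ => hnn L b
    have h1 := Nat.floor_le hs0
    have h2 := Nat.floor_le (hnn L b)
    have h3 : (c : ℝ) ≤ ⌊need N F L b⌋₊ := by exact_mod_cast hc
    have h4 : ∑ b' ∈ (B (restrict U b)).filter (· < b), need N F L b' + need N F L b ≤
        ∑ b' ∈ B (restrict U b), need N F L b' := by
      by_cases hb : b ∈ B (restrict U b)
      · rw [add_comm, ← Finset.sum_insert (by simp)]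
        apply Finset.sum_le_sum_of_subset_of_nonneg
        · intro b' hb'
          rcases Finset.mem_insert.mp hb' with rfl | hb'
          · exact hb
          · exact (Finset.mem_filter.mp hb').1
        · exact fun b _ _ => hnn L b
      · rw [hneed0 L b (fun hc => hb ((hmemB _ _).mpr ⟨hc, rfl⟩)), add_zero]
        exact Finset.sum_le_sum_of_subset_of_nonneg (Finset.filter_subset _ _)
          fun b _ _ => hnn L b
    push_cast
    linarith
  constructor
  · intro S hS a
    rcases S.eq_empty_or_nonempty with rfl | hne
    · rw [hN0]
      by_cases h0 : ∑ b ∈ B a, N ∅ b = 0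
      · rw [h0]; simp
      · obtain ⟨b, hb, hb'⟩ := Finset.exists_ne_zero_of_sum_ne_zero h0
        have h1 := h.le_ncard ∅ (Finset.empty_subset _) b
        have h2 : (Partials T F ∅ U' b).ncard ≤ (Partials T F ∅ U a).ncard := by
          apply Set.ncard_le_ncard _ (partials_finite_and_le (Finset.empty_subset _) _ _).1
          rw [← ((hmemB _ _).mp hb).2]
          exact partials_mono hU b
        have h3 := min_le_left 1 (∑ b ∈ B a, N ∅ b)
        omega
    · obtain ⟨e, he⟩ := hne
      rw [hN S ⟨e, he⟩ hS]
      refine (Finset.sum_le_sum fun b _ => h.le_ncard S hS b).trans ?_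
      exact sum_ncard_partials_le hU hS he (hs e (hS he)) a fun b hb => ((hmemB _ _).mp hb).2
  · intro a
    rw [hN0]
    exact min_le_left _ _
  · intro a h0 S
    rw [hN0] at h0
    have h1 : ∑ b ∈ B a, N ∅ b = 0 := by
      by_contra hc
      have := Nat.one_le_iff_ne_zero.mpr hc
      rw [min_eq_left this] at h0
      omega
    have h2 : ∀ b ∈ B a, ∀ S, N S b = 0 := fun b hb =>
      h.eq_zero b (Finset.sum_eq_zero_iff.mp h1 b hb)
    rcases S.eq_empty_or_nonempty with rfl | hne
    · rw [hN0, h1]; simp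
    · by_cases hSF : S ⊆ F
      · rw [hN S hne hSF]
        exact Finset.sum_eq_zero fun b hb => h2 b hb S
      · rw [groupCount, if_neg hne.ne_empty]
        simp only [if_neg hSF, Finset.sum_const_zero]
  · intro b hb
    rw [hN0]
    have h1 := h.alive b hb
    have h2 : restrict U' b ∈ B (restrict U b) :=
      (hmemB _ _).mpr ⟨mem_projections.mpr (h.proj ∅ _ (by rw [h1]; simp) e₀ he₀),
        restrict_restrict hU b⟩
    have h3 : N ∅ (restrict U' b) ≤ ∑ b' ∈ B (restrict U b), N ∅ b' :=
      Finset.single_le_sum (f := fun b' => N ∅ b') (fun _ _ => Nat.zero_le _) h2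
    exact min_eq_left (h1.ge.trans h3)
  · intro S a hne e he
    have h1 : ∃ b ∈ B a, N S b ≠ 0 := by
      rcases S.eq_empty_or_nonempty with rfl | hS
      · rw [hN0] at hne
        apply Finset.exists_ne_zero_of_sum_ne_zero
        intro hc
        rw [hc] at hne
        simp at hne
      · by_cases hSF : S ⊆ F
        · rw [hN S hS hSF] at hne
          exact Finset.exists_ne_zero_of_sum_ne_zero hne
        · rw [groupCount, if_neg hS.ne_empty] at hne
          simp only [if_neg hSF, Finset.sum_const_zero, ne_eq, not_true_eq_false] at hne
    obtain ⟨b, hb, hb'⟩ := h1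
    obtain ⟨τ, hτ, h2, h3⟩ := h.proj S b hb' e he
    refine ⟨τ, hτ, h2, ?_⟩
    rw [← ((hmemB _ _).mp hb).2, ← h3, restrict_restrict hU]
  · intro L hL τ hτ c hc
    rw [hslots] at hc
    obtain ⟨c', hc', rfl⟩ := Finset.mem_image.mp hc
    have := hpos L (restrict U' τ.assign) c' (h.slot_le L hL τ hτ c' hc')
    rwa [restrict_restrict hU] at this
  · intro L hL b hb
    obtain ⟨c, hc, hm⟩ := h.meet L hL b hb
    have h1 := hpos L (restrict U' b) c hc
    rw [restrict_restrict hU] at h1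
    refine ⟨_, h1, fun τ hτ hτb => ?_⟩
    rw [hslots, restrict_assign_eq (hU.trans (hs _ hτ)) hτb, restrict_assign_eq (hs _ hτ) hτb]
    exact Finset.mem_image_of_mem _ (hm τ hτ hτb)
  · intro L hL a c e he
    suffices key : ∀ W : Finset (AnyTuple E dom), (∀ τ ∈ W, τ ∈ T ∧ τ.1 = e ∧
        restrict U τ.assign = a ∧ c ∈ groupSlots T e₀ U U' F N Sl L τ) →
        (W.card : ℝ) ≤ ((3 * C : ℕ) : ℝ) * L * min 1 (need (groupCount T e₀ U U' F N) F L a) from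
      key _ fun τ hτ => by simpa only [Finset.mem_filter] using hτ
    intro W hW
    let x : PartAssign dom → ℝ := fun b => ∑ b' ∈ (B a).filter (· < b), need N F L b'
    have hWx : ∀ τ ∈ W, τ ∈ T ∧ τ.1 = e ∧ restrict U τ.assign = a ∧
        ∃ c' ∈ Sl L τ, c = c' + ⌊x (restrict U' τ.assign)⌋₊ := by
      intro τ hτ
      obtain ⟨h1, h2, h3, h4⟩ := hW τ hτ
      rw [hslots, h3] at h4
      obtain ⟨c', hc', rfl⟩ := Finset.mem_image.mp h4
      exact ⟨h1, h2, h3, c', hc', rfl⟩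
    have hfib : ∀ b, ((W.filter fun τ => restrict U' τ.assign = b).card : ℝ) ≤
        C * L * min 1 (need N F L b) := by
      intro b
      refine h.card_le (c := c - ⌊x b⌋₊) hL he fun τ hτ => ?_
      rw [Finset.mem_filter] at hτ
      obtain ⟨h1, rfl⟩ := hτ
      obtain ⟨h2, h3, _, c', hc', hcc⟩ := hWx τ h1
      refine ⟨h2, h3, rfl, ?_⟩
      rw [hcc, Nat.add_sub_cancel]
      exact hc'
    have hsub : W.image (fun τ => restrict U' τ.assign) ⊆ B a := by
      intro b hb
      obtain ⟨τ, hτ, rfl⟩ := Finset.mem_image.mp hb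
      rw [hmemB]
      refine ⟨?_, ?_⟩
      · by_contra hc
        have h1 := hfib (restrict U' τ.assign)
        rw [hneed0 L _ hc] at h1
        have h2 : 0 < (W.filter fun σ => restrict U' σ.assign = restrict U' τ.assign).card :=
          Finset.card_pos.mpr ⟨τ, Finset.mem_filter.mpr ⟨hτ, rfl⟩⟩
        have h3 : (0 : ℝ) < (W.filter fun σ => restrict U' σ.assign = restrict U' τ.assign).card := by
          exact_mod_cast h2
        rw [min_eq_right zero_le_one, mul_zero] at h1
        linarith
      · rw [restrict_restrict hU]
        exact (hWx τ hτ).2.2.1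
    have hpack := sum_min_one_le (B a) (need N F L) (hnn L) c
      (W.image fun τ => restrict U' τ.assign) hsub (by
        intro b hb
        obtain ⟨τ, hτ, rfl⟩ := Finset.mem_image.mp hb
        obtain ⟨_, h2, _, c', hc', hcc⟩ := hWx τ hτ
        have h3 := h.slot_le L hL τ (by rw [h2]; exact he) c' hc'
        simp only [x] at hcc
        constructor <;> omega)
    rw [hneed, Finset.card_eq_sum_card_image (fun τ => restrict U' τ.assign) W, Nat.cast_sum]
    calc _ ≤ ∑ b ∈ W.image (fun τ => restrict U' τ.assign), C * L * min 1 (need N F L b) :=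
          Finset.sum_le_sum fun b _ => hfib b
      _ = C * L * ∑ b ∈ W.image (fun τ => restrict U' τ.assign), min 1 (need N F L b) := by
          rw [Finset.mul_sum]
      _ ≤ C * L * (3 * min 1 (∑ b ∈ B a, need N F L b)) :=
          mul_le_mul_of_nonneg_left hpack (by positivity)
      _ = _ := by push_cast; ring

end SpecSteps


/-! ### Computing the counts and the slots -/

section PlanRounds

variable {V : Type u} {E : Query V} {dom : V → Type v} {p m : ℕ} {G : Env E dom p m} {H : G.Home}

namespace Env.Home

/-- The tuples with the property `P` elect a representative for every key. -/
theorem Computed.exists_representatives {K : Type*} [LinearOrder K] (κ : AnyTuple E dom → K) {k : ℕ}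
    {P : G.X → AnyTuple E dom → Prop} (hP : H.Computed k P)
    (hPH : ∀ x τ, P x τ → τ ∈ H.items x) (hint : ∀ x, (H.items x).card < G.intBound x) :
    ∃ rep : G.X → AnyTuple E dom → Prop,
      H.Computed (k + (k + levelRounds m + (k + levelRounds m))) rep ∧ (∀ x τ, rep x τ → P x τ) ∧
      (∀ x σ τ, rep x σ → rep x τ → κ σ = κ τ → σ = τ) ∧
      ∀ x τ, P x τ → ∃ σ, rep x σ ∧ κ σ = κ τ := by
  let _ : LinearOrder (AnyTuple E dom) := IsWellOrder.linearOrder WellOrderingRel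
  -- Ties in `κ` are broken by the tuple itself. A tuple with `P` is the least of its key exactly
  -- when `κ'` puts no more such tuples below it than `κ`.
  let κ' : AnyTuple E dom → K ×ₗ AnyTuple E dom := fun τ => toLex (κ τ, τ)
  let w : G.X → AnyTuple E dom → ℕ := fun x τ => if P x τ then 1 else 0
  have hw : H.Computed k w := hP.map fun x y τ h => by simp only [w, h]
  have hsum : ∀ x (T : Finset (AnyTuple E dom)), ∑ τ ∈ T, w x τ < G.intBound x := by
    intro x T
    refine lt_of_le_of_lt ?_ (hint x)
    simp only [w, Finset.sum_boole, Nat.cast_id]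
    exact Finset.card_le_card fun τ hτ => hPH x τ (Finset.mem_filter.mp hτ).2
  have hlt : ∀ σ τ, κ' σ < κ' τ ↔ κ σ < κ τ ∨ κ σ = κ τ ∧ σ < τ := fun σ τ => Prod.Lex.lt_iff
  have hks : ∀ x τ, MPCJoin.keySum κ (H.items x) (w x) τ false =
      ((H.items x).filter fun σ => κ σ < κ τ ∧ P x σ).card := by
    intro x τ
    simp only [MPCJoin.keySum, w, Finset.sum_boole, Nat.cast_id,
      Finset.filter_filter]
  have hks' : ∀ x τ, MPCJoin.keySum κ' (H.items x) (w x) τ false =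
      ((H.items x).filter fun σ => κ' σ < κ' τ ∧ P x σ).card := by
    intro x τ
    simp only [MPCJoin.keySum, w, Finset.sum_boole, Nat.cast_id,
      Finset.filter_filter]
  refine ⟨fun x τ => P x τ ∧ MPCJoin.keySum κ' (H.items x) (w x) τ false =
    MPCJoin.keySum κ (H.items x) (w x) τ false, ?_, fun x τ h => h.1, ?_, ?_⟩
  · refine (hP.prodMk ((hw.keySum κ hsum).prodMk (hw.keySum κ' hsum))).map fun x y τ h => ?_
    have h1 := congrArg Prod.fst h
    have h2 := congrArg (fun z => z.2.1) h
    have h3 := congrArg (fun z => z.2.2) h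
    simp only at h1 h2 h3
    rw [h1, h2, h3]
  · have aux : ∀ x σ τ, P x σ → MPCJoin.keySum κ' (H.items x) (w x) τ false =
        MPCJoin.keySum κ (H.items x) (w x) τ false → κ σ = κ τ → ¬ σ < τ := by
      intro x σ τ hσ hτ hκ hστ
      rw [hks, hks'] at hτ
      refine hτ.not_gt (Finset.card_lt_card ?_)
      rw [Finset.ssubset_iff_of_subset]
      · refine ⟨σ, ?_, ?_⟩
        · rw [Finset.mem_filter, hlt]
          exact ⟨hPH x σ hσ, Or.inr ⟨hκ, hστ⟩, hσ⟩
        · rw [Finset.mem_filter]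
          rintro ⟨_, h, _⟩
          exact h.ne hκ
      · intro ρ hρ
        rw [Finset.mem_filter] at hρ ⊢
        rw [hlt]
        exact ⟨hρ.1, Or.inl hρ.2.1, hρ.2.2⟩
    intro x σ τ hσ hτ hκ
    rcases lt_trichotomy σ τ with h | h | h
    · exact absurd h (aux x σ τ hσ.1 hτ.2 hκ)
    · exact h
    · exact absurd h (aux x τ σ hτ.1 hσ.2 hκ.symm)
  · intro x τ hτ
    let Z := (H.items x).filter fun σ => P x σ ∧ κ σ = κ τ
    have hZ : Z.Nonempty := ⟨τ, Finset.mem_filter.mpr ⟨hPH x τ hτ, hτ, rfl⟩⟩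
    have hmem := (Finset.mem_filter.mp (Z.min'_mem hZ)).2
    refine ⟨Z.min' hZ, ⟨hmem.1, ?_⟩, hmem.2⟩
    rw [hks, hks']
    congr 1
    ext σ
    rw [Finset.mem_filter, Finset.mem_filter, hlt]
    constructor
    · rintro ⟨h1, h2 | h2, h3⟩
      · exact ⟨h1, h2, h3⟩
      · have : σ ∈ Z := Finset.mem_filter.mpr ⟨h1, h3, h2.1.trans hmem.2⟩
        exact absurd (Z.min'_le σ this) h2.2.not_ge
    · rintro ⟨h1, h2, h3⟩
      exact ⟨h1, Or.inl h2, h3⟩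

/-- The number of rounds for the sums over subgroups. -/
def groupRounds (m k l : ℕ) : ℕ :=
  let r := k + (k + levelRounds m + (k + levelRounds m)) + l + levelRounds m
  r + (r + r)

/-- A sum over distinct projections is a sum over one representative tuple for each. The offset
inside a group is a difference of two sums: over the lexicographically smaller pairs of projections,
and over the smaller groups. -/
theorem Computed.groupSum [LinearOrder (PartAssign dom)] {T : G.X → Finset (AnyTuple E dom)}
    (hTH : ∀ x, T x ⊆ H.items x) {k l : ℕ} (hT : H.Computed k fun x τ => τ ∈ T x)
    (hint : ∀ x, (H.items x).card < G.intBound x) (e : {e // e ∈ E}) {U U' : Finset V} (hU : U ⊆ U')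
    {g : G.X → PartAssign dom → ℕ} (hg : H.Computed l fun x τ => g x (restrict U' τ.assign))
    (hint' : ∀ x, ∑ b ∈ projections (T x) e U', g x b < G.intBound x) :
    H.Computed (groupRounds m k l) fun x τ =>
      (∑ b ∈ subgroups (T x) e U U' (restrict U τ.assign), g x b,
        ∑ b ∈ (subgroups (T x) e U U' (restrict U τ.assign)).filter (· < restrict U' τ.assign),
          g x b) := by
  have hP : H.Computed k fun x τ => τ ∈ T x ∧ τ.1 = e :=
    hT.map fun x y τ h => by rw [h]
  obtain ⟨rep, hrep, hrepP, hinj, hsurj⟩ := hP.exists_representatives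
    (fun τ => restrict U' τ.assign) (fun x τ h => hTH x h.1) hint
  have hw : H.Computed (k + (k + levelRounds m + (k + levelRounds m)) + l) fun x τ =>
      if rep x τ then g x (restrict U' τ.assign) else 0 := by
    refine (hrep.prodMk hg).map fun x y τ h => ?_
    have h1 := congrArg Prod.fst h
    have h2 := congrArg Prod.snd h
    simp only at h1 h2
    simp only [h1, h2]
  have hsum : ∀ x (T' : Finset (AnyTuple E dom)),
      ∑ τ ∈ T', (if rep x τ then g x (restrict U' τ.assign) else 0) < G.intBound x := by
    intro x T'
    refine lt_of_le_of_lt ?_ (hint' x)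
    rw [← Finset.sum_filter, ← Finset.sum_image (s := T'.filter fun τ => rep x τ)
      (g := fun τ => restrict U' τ.assign) (f := g x)]
    · refine Finset.sum_le_sum_of_subset fun b hb => ?_
      obtain ⟨τ, hτ, rfl⟩ := Finset.mem_image.mp hb
      have := hrepP x τ (Finset.mem_filter.mp hτ).2
      exact mem_projections.mpr ⟨τ, this.1, this.2, rfl⟩
    · intro σ hσ τ hτ h
      exact hinj x σ τ (Finset.mem_filter.mp hσ).2 (Finset.mem_filter.mp hτ).2 h
  have key : ∀ x (Q : AnyTuple E dom → Prop) [DecidablePred Q] (B : Finset (PartAssign dom)),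
      (∀ τ ∈ T x, τ.1 = e → (Q τ ↔ restrict U' τ.assign ∈ B)) → B ⊆ projections (T x) e U' →
      ∑ τ ∈ (H.items x).filter Q, (if rep x τ then g x (restrict U' τ.assign) else 0) =
        ∑ b ∈ B, g x b := by
    intro x Q _ B hQ hB
    rw [← Finset.sum_filter, Finset.filter_filter]
    refine Finset.sum_bij (fun τ _ => restrict U' τ.assign) ?_ ?_ ?_ ?_
    · intro τ hτ
      obtain ⟨_, h1, h2⟩ := Finset.mem_filter.mp hτ
      exact (hQ τ (hrepP x τ h2).1 (hrepP x τ h2).2).mp h1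
    · intro σ hσ τ hτ h
      exact hinj x σ τ (Finset.mem_filter.mp hσ).2.2 (Finset.mem_filter.mp hτ).2.2 h
    · intro b hb
      obtain ⟨τ, hτ, hτe, rfl⟩ := mem_projections.mp (hB hb)
      obtain ⟨σ, hσ, h⟩ := hsurj x τ ⟨hτ, hτe⟩
      have hσ' := hrepP x σ hσ
      refine ⟨σ, Finset.mem_filter.mpr ⟨hTH x hσ'.1, (hQ σ hσ'.1 hσ'.2).mpr ?_, hσ⟩, h⟩
      rw [h]
      exact hb
    · intro τ _
      rfl
  let κ₁ : AnyTuple E dom → PartAssign dom := fun τ => restrict U τ.assign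
  let κ₂ : AnyTuple E dom → PartAssign dom ×ₗ PartAssign dom := fun τ =>
    toLex (restrict U τ.assign, restrict U' τ.assign)
  have hks := (hw.keySum κ₁ hsum).prodMk ((hw.keySum κ₁ hsum).prodMk (hw.keySum κ₂ hsum))
  refine hks.map fun x y τ h => ?_
  have h1 := congrFun (congrArg Prod.fst h) true
  have h2 := congrFun (congrArg Prod.fst h) false
  have h3 := congrFun (congrArg (fun z => z.2.2) h) false
  simp only [MPCJoin.keySum] at h1 h2 h3
  have hlt : ∀ σ τ, κ₂ σ < κ₂ τ ↔ restrict U σ.assign < restrict U τ.assign ∨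
    restrict U σ.assign = restrict U τ.assign ∧ restrict U' σ.assign < restrict U' τ.assign :=
    fun σ τ => Prod.Lex.lt_iff
  have e1 : ∀ x, ∑ σ ∈ (H.items x).filter (fun σ => κ₁ σ = κ₁ τ),
      (if rep x σ then g x (restrict U' σ.assign) else 0) =
      ∑ b ∈ subgroups (T x) e U U' (restrict U τ.assign), g x b := by
    intro x
    apply key
    · intro σ hσ hσe
      rw [mem_subgroups, restrict_restrict hU]
      exact ⟨fun h => ⟨mem_projections.mpr ⟨σ, hσ, hσe, rfl⟩, h⟩, fun h => h.2⟩
    · exact fun b hb => (mem_subgroups.mp hb).1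
  have e2 : ∀ x, ∑ σ ∈ (H.items x).filter (fun σ => κ₂ σ < κ₂ τ),
      (if rep x σ then g x (restrict U' σ.assign) else 0) =
      ∑ σ ∈ (H.items x).filter (fun σ => κ₁ σ < κ₁ τ),
        (if rep x σ then g x (restrict U' σ.assign) else 0) +
      ∑ b ∈ (subgroups (T x) e U U' (restrict U τ.assign)).filter (· < restrict U' τ.assign),
        g x b := by
    intro x
    rw [← key x (fun σ => restrict U σ.assign = restrict U τ.assign ∧
      restrict U' σ.assign < restrict U' τ.assign), ← Finset.sum_union]
    · refine Finset.sum_congr ?_ fun _ _ => rfl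
      ext σ
      simp only [Finset.mem_filter, Finset.mem_union, hlt, κ₁]
      tauto
    · rw [Finset.disjoint_left]
      intro σ hσ hσ'
      exact (Finset.mem_filter.mp hσ).2.ne (Finset.mem_filter.mp hσ').2.1
    · intro σ hσ hσe
      rw [Finset.mem_filter, mem_subgroups, restrict_restrict hU]
      exact ⟨fun h => ⟨⟨mem_projections.mpr ⟨σ, hσ, hσe, rfl⟩, h.1⟩, h.2⟩, fun h => ⟨h.1.2, h.2⟩⟩
    · exact fun b hb => (mem_subgroups.mp (Finset.mem_filter.mp hb).1).1
  refine Prod.ext ?_ ?_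
  · rw [e1, e1] at h1
    exact h1
  · rw [e2, e2, h2] at h3
    exact Nat.add_left_cancel h3

end Env.Home

end PlanRounds


/-! ### Evaluating a plan in constantly many rounds -/

section PlanSpec

variable {V : Type u} {E : Query V}

/-- The sums sent as integers stay polynomial in the input size: they are bounded by a number of
partial results or, for `S = ∅`, of projections. -/
theorem Spec.sum_projections_lt {dom : V → Type v} {T : Finset (AnyTuple E dom)} {U : Finset V}
    {F : Finset {e // e ∈ E}} {C : ℕ} {N : Finset {e // e ∈ E} → PartAssign dom → ℕ}
    {Sl : ℕ → AnyTuple E dom → Finset ℕ} (h : Spec T U F C N Sl) (hs : ∀ e ∈ F, U ⊆ e.1)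
    (e : {e // e ∈ E}) {S : Finset {e // e ∈ E}} (hS : S ⊆ F) :
    ∑ b ∈ projections T e U, N S b < (T.card + 1) ^ (E.card + 1) := by
  rcases S.eq_empty_or_nonempty with rfl | hne
  · have h1 : ∑ b ∈ projections T e U, N ∅ b ≤ T.card := by
      refine (Finset.sum_le_sum fun b _ => h.empty_le b).trans ?_
      rw [Finset.sum_const, smul_eq_mul, mul_one]
      exact Finset.card_image_le.trans (Finset.card_filter_le _ _)
    calc _ < T.card + 1 := by omega
      _ ≤ _ := Nat.le_self_pow (by omega) _
  · obtain ⟨e', he'⟩ := id hne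
    have h1 : ∑ b ∈ projections T e U, N S b ≤
        (Partials T F S ∅ (fun _ => none)).ncard := by
      refine (Finset.sum_le_sum fun b _ => h.le_ncard S hS b).trans ?_
      refine sum_ncard_partials_le (Finset.empty_subset _) hS he' (hs e' (hS he')) _ fun b _ => ?_
      funext x
      exact restrict_apply_of_notMem (Finset.notMem_empty x) b
    have h2 := (partials_finite_and_le (T := T) hS ∅ (fun _ => none)).2
    have h3 : S.card ≤ E.card := by
      have := Finset.card_le_univ S
      rwa [Fintype.card_coe] at this
    calc _ ≤ T.card ^ S.card := h1.trans h2
      _ < (T.card + 1) ^ S.card := Nat.pow_lt_pow_left (Nat.lt_succ_self _) (by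
          have := hne.card_pos; omega)
      _ ≤ _ := Nat.pow_le_pow_right (Nat.succ_pos _) (by omega)

/-- Along a plan, the counts and the slots can be computed in a constant number of rounds. -/
theorem Plan.exists_spec {U : Finset V} {F : Finset {e // e ∈ E}} (h : Plan U F) (m r : ℕ) :
    ∃ k C : ℕ, ∀ {dom : V → Type v} [LinearOrder (PartAssign dom)] {p : ℕ} {G : Env E dom p m}
      (H : G.Home) (T : G.X → Finset (AnyTuple E dom)), (∀ x, T x ⊆ H.items x) →
      (H.Computed r fun x τ => τ ∈ T x) →
      (∀ x, ((H.items x).card + 1) ^ (E.card + 1) ≤ G.intBound x) →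
      ∃ (N : G.X → Finset {e // e ∈ E} → PartAssign dom → ℕ)
        (Sl : G.X → ℕ → AnyTuple E dom → Finset ℕ),
        (H.Computed k fun x τ S => N x S (restrict U τ.assign)) ∧
        (H.Computed k fun x τ L => Sl x L τ) ∧ ∀ x, Spec (T x) U F C (N x) (Sl x) := by
  have hcard : ∀ {dom : V → Type v} {p : ℕ} {G : Env E dom p m} {H : G.Home},
      (∀ x, ((H.items x).card + 1) ^ (E.card + 1) ≤ G.intBound x) →
      ∀ x, (H.items x).card < G.intBound x := by
    intro dom p G H hint x
    calc _ < (H.items x).card + 1 := Nat.lt_succ_self _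
      _ ≤ ((H.items x).card + 1) ^ (E.card + 1) := Nat.le_self_pow (by omega) _
      _ ≤ _ := hint x
  induction h with
  | leaf e =>
    refine ⟨r + Env.levelRounds m, 1, fun {dom _ p G} H T hTH hT hint => ?_⟩
    refine ⟨_, _, ?_, ?_, fun x => Spec.leaf (T x) e⟩
    swap
    · exact (Env.Home.Computed.const (H := H) fun _ (_ : ℕ) => ({0} : Finset ℕ)).mono (Nat.zero_le _)
    -- Each tuple, of whatever relation, learns whether `T` contains a tuple of `e` with its values
    -- on `e` by counting the tuples with equal key.
    have hw : H.Computed r fun x τ => if τ ∈ T x ∧ τ.1 = e then 1 else 0 := hT.map fun x y τ h => by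
      simp only [h]
    have hsum : ∀ x (W : Finset (AnyTuple E dom)),
        ∑ τ ∈ W, (if τ ∈ T x ∧ τ.1 = e then 1 else 0) < G.intBound x := by
      intro x W
      refine lt_of_le_of_lt ?_ (hcard hint x)
      rw [Finset.sum_boole, Nat.cast_id]
      exact Finset.card_le_card fun τ hτ => hTH x (Finset.mem_filter.mp hτ).2.1
    refine (hw.keySum (fun τ => restrict e.1 τ.assign) hsum).map fun x y τ h => ?_
    have key : ∀ x, (∃ σ ∈ T x, σ.1 = e ∧ σ.assign = restrict e.1 τ.assign) ↔
        keySum (fun τ => restrict e.1 τ.assign) (H.items x)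
          (fun τ => if τ ∈ T x ∧ τ.1 = e then 1 else 0) τ true ≠ 0 := by
      intro x
      simp only [keySum, ne_eq, Finset.sum_eq_zero_iff, Finset.mem_filter, not_forall,
        ite_eq_right_iff, one_ne_zero, imp_false, not_not, exists_prop]
      constructor
      · rintro ⟨σ, hσ, rfl, h⟩
        exact ⟨σ, ⟨hTH x hσ, (restrict_assign σ).trans h⟩, hσ, rfl⟩
      · rintro ⟨σ, ⟨_, h⟩, hσ, rfl⟩
        exact ⟨σ, hσ, rfl, (restrict_assign σ).symm.trans h⟩
    funext S
    have hiff := (key x).trans (Iff.trans (by rw [congrFun h true]) (key y).symm)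
    by_cases hx : ∃ σ ∈ T x, σ.1 = e ∧ σ.assign = restrict e.1 τ.assign
    · rw [if_pos hx, if_pos (hiff.mp hx)]
    · rw [if_neg hx, if_neg fun hy => hx (hiff.mpr hy)]
  | @prod U F F₁ F₂ h₁ h₂ hF hd hU ih₁ ih₂ =>
    obtain ⟨k₁, C₁, ih₁⟩ := ih₁
    obtain ⟨k₂, C₂, ih₂⟩ := ih₂
    refine ⟨k₁ + k₂ + (k₁ + k₂), C₁ + C₂, fun {dom _ p G} H T hTH hT hint => ?_⟩
    obtain ⟨N₁, Sl₁, hN₁, hSl₁, hs₁⟩ := ih₁ H T hTH hT hint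
    obtain ⟨N₂, Sl₂, hN₂, hSl₂, hs₂⟩ := ih₂ H T hTH hT hint
    refine ⟨_, _, ?_, ?_, fun x => (hs₁ x).prod (hs₂ x) hF hd hU h₁.subset h₂.subset h₁.nonempty
      h₂.nonempty⟩
    · refine ((hN₁.prodMk hN₂).map fun x y τ h => ?_).mono (Nat.le_add_right _ _)
      have e1 := congrArg Prod.fst h
      have e2 := congrArg Prod.snd h
      funext S
      exact congrArg₂ (· * ·) (congrFun e1 _) (congrFun e2 _)
    -- The slots are computed as functions of `L`: the target load can be chosen only when the
    -- counts at the root of the plan are known.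
    · refine ((hN₁.prodMk hN₂).prodMk (hSl₁.prodMk hSl₂)).map fun x y τ h => ?_
      have e1 := congrFun (congrArg (fun z => z.1.1) h)
      have e2 := congrFun (congrArg (fun z => z.1.2) h)
      have e3 := congrFun (congrArg (fun z => z.2.1) h)
      have e4 := congrFun (congrArg (fun z => z.2.2) h)
      simp only at e1 e2 e3 e4
      funext L
      simp only [prodSlots, need, e1, e2, e3, e4]
  | @group U U' F hU h ih =>
    obtain ⟨k, C, ih⟩ := ih
    obtain ⟨e₀, he₀⟩ := h.nonempty
    refine ⟨k + Fintype.card (Finset {e // e ∈ E}) * Env.Home.groupRounds m r k, 3 * C,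
      fun {dom _ p G} H T hTH hT hint => ?_⟩
    obtain ⟨N, Sl, hN, hSl, hs⟩ := ih H T hTH hT hint
    have hsums := Env.Home.Computed.pi (H := H) (k := Env.Home.groupRounds m r k) (fun (S : Finset {e // e ∈ E}) x τ =>
      (∑ b ∈ subgroups (T x) e₀ U U' (restrict U τ.assign), if S ⊆ F then N x S b else 0,
        ∑ b ∈ (subgroups (T x) e₀ U U' (restrict U τ.assign)).filter (· < restrict U' τ.assign),
          if S ⊆ F then N x S b else 0)) (fun S => by
        refine Env.Home.Computed.groupSum hTH hT (hcard hint) e₀ hU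
          (g := fun x b => if S ⊆ F then N x S b else 0) ?_ ?_
        · refine hN.map fun x y τ h => ?_
          simp only [congrFun h S]
        · intro x
          by_cases hS : S ⊆ F
          · simp only [if_pos hS]
            refine ((hs x).sum_projections_lt h.subset e₀ hS).trans_le (le_trans ?_ (hint x))
            exact Nat.pow_le_pow_left (Nat.succ_le_succ (Finset.card_le_card (hTH x))) _
          · simp only [if_neg hS, Finset.sum_const_zero]
            exact H.intBound_pos x)
    refine ⟨fun x => groupCount (T x) e₀ U U' F (N x), fun x => groupSlots (T x) e₀ U U' F (N x) (Sl x),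
      ?_, ?_, fun x => (hs x).group hU h.subset he₀⟩
    · refine (hsums.map fun x y τ h => ?_).mono (Nat.le_add_left _ _)
      funext S
      have e1 := congrArg Prod.fst (congrFun h S)
      simp only at e1
      simp only [groupCount, e1]
    · refine (hSl.prodMk hsums).map fun x y τ h => ?_
      funext L
      have e1 := congrFun (congrArg Prod.fst h) L
      have e2 : ∀ S, _ := fun S => congrArg Prod.snd (congrFun (congrArg Prod.snd h) S)
      simp only at e1 e2
      -- Only the integer offsets, one for each `S`, are communicated; the fractional offset is put
      -- together locally for any `L`.
      have key : ∀ x, ∑ b ∈ (subgroups (T x) e₀ U U' (restrict U τ.assign)).filter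
          (· < restrict U' τ.assign), need (N x) F L b =
          ∑ S ∈ F.powerset.filter (·.Nonempty),
            ((∑ b ∈ (subgroups (T x) e₀ U U' (restrict U τ.assign)).filter
              (· < restrict U' τ.assign), if S ⊆ F then N x S b else 0 : ℕ) : ℝ) /
                (L : ℝ) ^ S.card := by
        intro x
        simp only [need]
        rw [Finset.sum_comm]
        refine Finset.sum_congr rfl fun S hS => ?_
        rw [Finset.mem_filter, Finset.mem_powerset] at hS
        rw [Nat.cast_sum, Finset.sum_div]
        simp only [if_pos hS.1]
      simp only [groupSlots, e1, key, e2]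

end PlanSpec


/-! ### Plans for hierarchical joins -/

section Hierarchical

variable {V : Type u} {E : Query V}

theorem exists_cover_of_reduce [DecidableEq V] {E' : Query V}
    (h : Relation.ReflTransGen Query.ReduceStep E E') :
    E' ⊆ E ∧ ∀ e ∈ E, ∃ e' ∈ E', e ⊆ e' := by
  induction h with
  | refl => exact ⟨subset_rfl, fun e he => ⟨e, he, subset_rfl⟩⟩
  | tail _ hstep ih =>
    obtain ⟨e, _, e', he', hne, hsub, rfl⟩ := hstep
    refine ⟨fun f hf => ih.1 (Finset.mem_of_mem_erase hf), fun f hf => ?_⟩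
    obtain ⟨g, hg, hfg⟩ := ih.2 f hf
    by_cases hge : g = e
    · exact ⟨e', Finset.mem_erase.mpr ⟨hne.symm, he'⟩, hfg.trans (hge ▸ hsub)⟩
    · exact ⟨g, Finset.mem_erase.mpr ⟨hge, hg⟩, hfg⟩

/-- Hierarchical sets of relations have plans. -/
theorem Plan.exists_of_hierarchical [Fintype V] (n : ℕ) (U : Finset V) (F : Finset {e // e ∈ E})
    (hn : F.card + ∑ e ∈ F, (e.1 \ U).card ≤ n) (hF : F.Nonempty) (hU : ∀ e ∈ F, U ⊆ e.1)
    (hh : ∀ x y : V, (∀ e ∈ F, x ∈ e.1 → y ∈ e.1) ∨ (∀ e ∈ F, y ∈ e.1 → x ∈ e.1) ∨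
      ∀ e ∈ F, x ∈ e.1 → y ∉ e.1) : Plan U F := by
  induction n generalizing U F with
  | zero => exact absurd hF.card_pos (by omega)
  | succ n ih =>
    by_cases hc : ∃ x, x ∉ U ∧ ∀ e ∈ F, x ∈ e.1
    · obtain ⟨x, hx, hxF⟩ := hc
      refine Plan.group (Finset.subset_insert x U) (ih _ F ?_ hF (fun e he =>
        Finset.insert_subset (hxF e he) (hU e he)) hh)
      have hlt : ∑ e ∈ F, (e.1 \ insert x U).card < ∑ e ∈ F, (e.1 \ U).card := by
        refine Finset.sum_lt_sum_of_nonempty hF fun e he => Finset.card_lt_card ?_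
        refine (Finset.ssubset_iff_of_subset
          (Finset.sdiff_subset_sdiff subset_rfl (Finset.subset_insert x U))).mpr ⟨x, ?_, ?_⟩
        · exact Finset.mem_sdiff.mpr ⟨hxF e he, hx⟩
        · simp
      omega
    · push Not at hc
      by_cases ha : ∃ x, x ∉ U ∧ ∃ e ∈ F, x ∈ e.1
      -- Take `x` in as many relations as possible. If a relation with `x` and one without it shared
      -- some `v ∉ U`, the hierarchy would force `v` to occur wherever `x` does, and at least once
      -- more, against maximality. So these two kinds of relations form a product.
      · obtain ⟨x, hx, hmax⟩ := Finset.exists_max_image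
          (Finset.univ.filter fun x => x ∉ U ∧ ∃ e ∈ F, x ∈ e.1)
          (fun x => (F.filter fun e : {e // e ∈ E} => x ∈ e.1).card)
          (ha.imp fun x hx => Finset.mem_filter.mpr ⟨Finset.mem_univ _, hx⟩)
        obtain ⟨hxU, e₁, he₁, hxe₁⟩ := (Finset.mem_filter.mp hx).2
        obtain ⟨e₂, he₂, hxe₂⟩ := hc x hxU
        have hle : ∀ F' : Finset {e // e ∈ E}, F' ⊂ F →
            F'.card + ∑ e ∈ F', (e.1 \ U).card ≤ n := by
          intro F' hF'
          have h1 := Finset.card_lt_card hF'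
          have h2 : ∑ e ∈ F', (e.1 \ U).card ≤ ∑ e ∈ F, (e.1 \ U).card :=
            Finset.sum_le_sum_of_subset hF'.1
          omega
        have hsub : ∀ F' : Finset {e // e ∈ E}, F' ⊂ F → F'.Nonempty → Plan U F' := by
          intro F' hF' hne
          refine ih U F' (hle F' hF') hne (fun e he => hU e (hF'.1 he)) fun x y => ?_
          rcases hh x y with h | h | h
          · exact Or.inl fun e he => h e (hF'.1 he)
          · exact Or.inr (Or.inl fun e he => h e (hF'.1 he))
          · exact Or.inr (Or.inr fun e he => h e (hF'.1 he))
        refine Plan.prod (F₁ := F.filter fun e => x ∈ e.1) (F₂ := F.filter fun e => x ∉ e.1)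
          (hsub _ ?_ ⟨e₁, Finset.mem_filter.mpr ⟨he₁, hxe₁⟩⟩)
          (hsub _ ?_ ⟨e₂, Finset.mem_filter.mpr ⟨he₂, hxe₂⟩⟩) ?_ ?_ ?_
        · rw [Finset.filter_ssubset]
          exact ⟨e₂, he₂, hxe₂⟩
        · rw [Finset.filter_ssubset]
          exact ⟨e₁, he₁, not_not.mpr hxe₁⟩
        · intro e
          simp only [Finset.mem_filter]
          tauto
        · exact Finset.disjoint_filter_filter_not F F _
        · intro f₁ hf₁ f₂ hf₂ v hv₁ hv₂
          rw [Finset.mem_filter] at hf₁ hf₂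
          by_contra hvU
          rcases hh x v with h | h | h
          · have h1 := hmax v (Finset.mem_filter.mpr ⟨Finset.mem_univ _, hvU, f₁, hf₁.1, hv₁⟩)
            refine h1.not_gt (Finset.card_lt_card ?_)
            refine (Finset.ssubset_iff_of_subset ?_).mpr ⟨f₂, ?_, ?_⟩
            · intro e he
              rw [Finset.mem_filter] at he ⊢
              exact ⟨he.1, h e he.1 he.2⟩
            · exact Finset.mem_filter.mpr ⟨hf₂.1, hv₂⟩
            · exact fun he => hf₂.2 (Finset.mem_filter.mp he).2
          · exact hf₂.2 (h f₂ hf₂.1 hv₂)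
          · exact h f₁ hf₁.1 hf₁.2 hv₁
      · push Not at ha
        obtain ⟨e, he⟩ := hF
        have heq : ∀ f ∈ F, f.1 = U := fun f hf =>
          subset_antisymm (fun x hx => by
            by_contra hxU
            exact ha x hxU f hf hx) (hU f hf)
        have hFe : F = {e} := by
          ext f
          rw [Finset.mem_singleton]
          constructor
          · exact fun hf => Subtype.ext ((heq f hf).trans (heq e he).symm)
          · rintro rfl
            exact he
        rw [hFe, ← heq e he]
        exact Plan.leaf e

/-- An r-hierarchical join has a set of relations with a plan such that each relation is contained in
one of them. -/
theorem Query.RHierarchical.exists_plan [Fintype V] [DecidableEq V] (hE : E.RHierarchical)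
    (hne : E.Nonempty) :
    ∃ F : Finset {e // e ∈ E}, Plan ∅ F ∧ ∀ e : {e // e ∈ E}, ∃ f ∈ F, e.1 ⊆ f.1 := by
  obtain ⟨E', hEE', -, hh⟩ := hE
  obtain ⟨hsub, hcov⟩ := exists_cover_of_reduce hEE'
  let F : Finset {e // e ∈ E} := Finset.univ.filter fun e => e.1 ∈ E'
  have hcovF : ∀ e : {e // e ∈ E}, ∃ f ∈ F, e.1 ⊆ f.1 := by
    intro e
    obtain ⟨f, hf, hef⟩ := hcov e.1 e.2
    exact ⟨⟨f, hsub hf⟩, Finset.mem_filter.mpr ⟨Finset.mem_univ _, hf⟩, hef⟩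
  have hF : F.Nonempty := by
    obtain ⟨e, he⟩ := hne
    obtain ⟨f, hf, -⟩ := hcovF ⟨e, he⟩
    exact ⟨f, hf⟩
  refine ⟨F, Plan.exists_of_hierarchical _ ∅ F le_rfl hF (fun e _ => Finset.empty_subset _) ?_,
    hcovF⟩
  have hF' : ∀ e ∈ F, e.1 ∈ E' := fun e he => (Finset.mem_filter.mp he).2
  intro x y
  rcases hh x y with h | h | h
  · exact Or.inl fun e he hx => (h ⟨hF' e he, hx⟩).2
  · exact Or.inr (Or.inl fun e he hy => (h ⟨hF' e he, hy⟩).2)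
  · refine Or.inr (Or.inr fun e he hx hy => ?_)
    have : e.1 ∈ Query.edgesAt E' x ∩ Query.edgesAt E' y := ⟨⟨hF' e he, hx⟩, ⟨hF' e he, hy⟩⟩
    rw [h] at this
    exact this

end Hierarchical


/-! ### The lower bound -/

section LowerBound

variable {V : Type u} {E : Query V} {dom : V → Type v} {Γ : Type w} {p : ℕ}

/-- The set of all input tuples. -/
def Instance.tuples (R : Instance E dom) : Finset (AnyTuple E dom) := Finset.univ.sigma R.rel

theorem Instance.mem_tuples {R : Instance E dom} {τ : AnyTuple E dom} :
    τ ∈ R.tuples ↔ τ.2 ∈ R.rel τ.1 := by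
  simp [Instance.tuples]

theorem Instance.card_tuples (R : Instance E dom) : R.tuples.card = R.size :=
  Finset.card_sigma _ _

theorem Instance.EvenlyDistributed.biUnion_eq {R : Instance E dom}
    {D : Fin p → Finset (AnyTuple E dom)} (hD : R.EvenlyDistributed D) :
    Finset.univ.biUnion D = R.tuples := by
  ext τ
  rw [Instance.mem_tuples, hD.1]
  simp

namespace Algorithm

/-- The tuples which a server gets to see. -/
noncomputable def seen (A : Algorithm E dom Γ p) (D : Fin p → Finset (AnyTuple E dom)) (i : Fin p) :
    Finset (AnyTuple E dom) :=
  D i ∪ (Finset.range A.rounds).biUnion fun t => Finset.univ.biUnion fun j =>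
    ((A.message D t j i).filterMap Sum.getLeft?).toFinset

theorem card_le_tupleLoad (A : Algorithm E dom Γ p) (D : Fin p → Finset (AnyTuple E dom))
    (i : Fin p) : (D i).card ≤ A.tupleLoad D :=
  le_trans (le_max_left _ _) (Finset.le_sup (f := fun i : Fin p => max (D i).card
    ((Finset.range A.rounds).sup fun t => ∑ j, (A.message D t j i).countP Sum.isLeft))
    (Finset.mem_univ i))

theorem sum_countP_le_tupleLoad (A : Algorithm E dom Γ p) (D : Fin p → Finset (AnyTuple E dom))
    {t : ℕ} (ht : t < A.rounds) (i : Fin p) :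
    ∑ j, (A.message D t j i).countP Sum.isLeft ≤ A.tupleLoad D :=
  ((Finset.le_sup (f := fun t => ∑ j, (A.message D t j i).countP Sum.isLeft)
    (Finset.mem_range.mpr ht)).trans (le_max_right (D i).card _)).trans
    (Finset.le_sup (f := fun i : Fin p => max (D i).card
      ((Finset.range A.rounds).sup fun t => ∑ j, (A.message D t j i).countP Sum.isLeft))
      (Finset.mem_univ i))

theorem card_seen_le (A : Algorithm E dom Γ p) (D : Fin p → Finset (AnyTuple E dom)) (i : Fin p) :
    (A.seen D i).card ≤ (A.rounds + 1) * A.tupleLoad D := by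
  have hlen : ∀ l : List (AnyTuple E dom ⊕ Γ),
      (l.filterMap Sum.getLeft?).length = l.countP Sum.isLeft := by
    intro l
    induction l with
    | nil => rfl
    | cons a l ih => cases a <;> simp [List.countP_cons, List.filterMap_cons, ih]
  have h : ∀ t ∈ Finset.range A.rounds, (Finset.univ.biUnion fun j =>
      ((A.message D t j i).filterMap Sum.getLeft?).toFinset).card ≤ A.tupleLoad D := by
    intro t ht
    refine Finset.card_biUnion_le.trans (le_trans (Finset.sum_le_sum fun j _ => ?_)
      (A.sum_countP_le_tupleLoad D (Finset.mem_range.mp ht) i))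
    rw [← hlen]
    exact List.toFinset_card_le _
  have h' := Finset.card_biUnion_le_card_mul _ _ _ h
  rw [Finset.card_range] at h'
  calc _ ≤ _ := Finset.card_union_le _ _
    _ ≤ A.tupleLoad D + A.rounds * A.tupleLoad D := Nat.add_le_add (A.card_le_tupleLoad D i) h'
    _ = _ := by ring

theorem mem_seen_of_holds (A : Algorithm E dom Γ p) (D : Fin p → Finset (AnyTuple E dom))
    {s : ℕ} (hs : s ≤ A.rounds) {i : Fin p} {τ : AnyTuple E dom} (h : (A.history D s i).Holds τ) :
    τ ∈ A.seen D i := by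
  rw [seen, Finset.mem_union]
  induction s with
  | zero =>
    rcases h with h | ⟨m, hm, _⟩
    · exact Or.inl h
    · simp [history] at hm
  | succ s ih =>
    rcases h with h | ⟨m, hm, j, hj⟩
    · exact Or.inl h
    · simp only [history, List.mem_append, List.mem_singleton] at hm
      rcases hm with hm | rfl
      · exact ih (by omega) (Or.inr ⟨m, hm, j, hj⟩)
      · right
        refine Finset.mem_biUnion.mpr ⟨s, Finset.mem_range.mpr (by omega),
          Finset.mem_biUnion.mpr ⟨j, Finset.mem_univ j, ?_⟩⟩
        rw [List.mem_toFinset, List.mem_filterMap]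
        exact ⟨_, hj, rfl⟩

/-- The tuples of a join result are all seen by one server, and a server that sees `n` tuples covers
at most `n ^ |S|` choices for `S`. Only tuples are counted, so other information is of no help. -/
theorem Computes.ncard_partialResults_le {A : Algorithm E dom Γ p} {R : Instance E dom}
    {D : Fin p → Finset (AnyTuple E dom)} (h : A.Computes R D) (S : Finset {e // e ∈ E}) :
    (R.partialResults S).ncard ≤ p * ((A.rounds + 1) * A.tupleLoad D) ^ S.card := by
  let P : Finset ({e // e ∈ S} → AnyTuple E dom) :=
    Finset.univ.biUnion fun i => Fintype.piFinset fun _ => A.seen D i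
  let f : (∀ e : {e // e ∈ S}, Tuple dom e.1.1) → {e // e ∈ S} → AnyTuple E dom :=
    fun s e => ⟨e.1, s e⟩
  have hmaps : ∀ s ∈ R.partialResults S, f s ∈ (P : Set _) := by
    rintro s ⟨_, _, t, ht, hts⟩
    obtain ⟨i, n, hn, hi⟩ := h t ht
    refine Finset.mem_biUnion.mpr ⟨i, Finset.mem_univ i, Fintype.mem_piFinset.mpr fun e => ?_⟩
    simp only [f]
    rw [← hts e]
    exact A.mem_seen_of_holds D hn (hi e.1)
  have hinj : Set.InjOn f (R.partialResults S) := by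
    intro s _ s' _ hss
    funext e
    have := congrFun hss e
    simp only [f, Sigma.mk.injEq, heq_eq_eq, true_and] at this
    exact this
  refine (Set.ncard_le_ncard_of_injOn f hmaps hinj P.finite_toSet).trans ?_
  rw [Set.ncard_coe_finset]
  refine (Finset.card_biUnion_le_card_mul _ _ (((A.rounds + 1) * A.tupleLoad D) ^ S.card)
    fun i _ => ?_).trans (by rw [Finset.card_univ, Fintype.card_fin])
  rw [Fintype.card_piFinset, Finset.prod_const, Finset.card_univ, Fintype.card_coe]
  exact Nat.pow_le_pow_left (A.card_seen_le D i) _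

theorem Computes.lInstance_le {A : Algorithm E dom Γ p} {R : Instance E dom}
    {D : Fin p → Finset (AnyTuple E dom)} (h : A.Computes R D) (hp : 0 < p) :
    (R.lInstance p : ℝ) ≤ ((A.rounds + 1 : ℕ) : ℝ) * (A.tupleLoad D : ℝ) := by
  have : R.lInstance p ≤ ((A.rounds + 1 : ℕ) : ℝ≥0) * (A.tupleLoad D : ℝ≥0) := by
    refine Finset.sup_le fun S hS => ?_
    have hS' : 0 < S.card := (Finset.mem_filter.mp hS).2.card_pos
    rw [one_div, NNReal.rpow_inv_le_iff (by exact_mod_cast hS'), NNReal.rpow_natCast,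
      div_le_iff₀ (by exact_mod_cast hp), mul_comm]
    exact_mod_cast h.ncard_partialResults_le S
  exact_mod_cast this

theorem size_div_le_tupleLoad (A : Algorithm E dom Γ p) {R : Instance E dom}
    {D : Fin p → Finset (AnyTuple E dom)} (hD : R.EvenlyDistributed D) (hp : 0 < p) :
    (R.size : ℝ) / p ≤ A.tupleLoad D := by
  rw [div_le_iff₀ (by exact_mod_cast hp), mul_comm]
  rw [← R.card_tuples, ← hD.biUnion_eq]
  have := Finset.card_biUnion_le_card_mul Finset.univ D (A.tupleLoad D)
    fun i _ => A.card_le_tupleLoad D i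
  rw [Finset.card_univ, Fintype.card_fin] at this
  exact_mod_cast this

end Algorithm

end LowerBound


/-! ### Tuples and their companions -/

section Companions

variable {V : Type u} {E : Query V} {dom : V → Type v} {p m : ℕ} {G : Env E dom p m}

namespace Env.Home

theorem Computed.mem_items (H : G.Home) : H.Computed 0 fun x τ => τ ∈ H.items x := by
  refine fun A hA => ⟨A, Extends.refl hA.good, fun x y i hxy τ hτ => ?_⟩
  have hτ' : τ ∈ H.loc y i := by rwa [← hA.knows x y i hxy]
  exact propext ⟨fun _ => Finset.mem_biUnion.mpr ⟨i, Finset.mem_univ i, hτ'⟩,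
    fun _ => Finset.mem_biUnion.mpr ⟨i, Finset.mem_univ i, hτ⟩⟩

/-- The restrictions of `τ`, among the tuples, to the relations contained in that of `τ`. -/
noncomputable def companions (H : G.Home) (x : G.X) (τ : AnyTuple E dom) :
    Finset (AnyTuple E dom) :=
  (H.items x).filter fun σ => σ.1.1 ⊆ τ.1.1 ∧ σ.assign = restrict σ.1.1 τ.assign

theorem mem_companions {H : G.Home} {x : G.X} {σ τ : AnyTuple E dom} :
    σ ∈ H.companions x τ ↔
      σ ∈ H.items x ∧ σ.1.1 ⊆ τ.1.1 ∧ σ.assign = restrict σ.1.1 τ.assign := by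
  rw [companions, Finset.mem_filter]

theorem card_companions_le (H : G.Home) (x : G.X) (τ : AnyTuple E dom) :
    (H.companions x τ).card ≤ E.card := by
  rw [← Fintype.card_coe E, ← Finset.card_univ]
  refine Finset.card_le_card_of_injOn (fun σ => σ.1) (fun _ _ => Finset.mem_univ _) ?_
  intro σ hσ σ' hσ' h
  have h1 := (mem_companions.mp hσ).2.2
  have h2 := (mem_companions.mp hσ').2.2
  refine assign_inj h ?_
  simp only at h
  rw [h1, h2, h]

/-- The tuples that have a companion in each relation contained in theirs. -/
noncomputable def complete (H : G.Home) (x : G.X) : Finset (AnyTuple E dom) :=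
  (H.items x).filter fun τ => ∀ e : {e // e ∈ E}, e.1 ⊆ τ.1.1 → ∃ σ ∈ H.companions x τ, σ.1 = e

theorem mem_complete {H : G.Home} {x : G.X} {τ : AnyTuple E dom} :
    τ ∈ H.complete x ↔ τ ∈ H.items x ∧
      ∀ e : {e // e ∈ E}, e.1 ⊆ τ.1.1 → ∃ σ ∈ H.companions x τ, σ.1 = e := by
  rw [complete, Finset.mem_filter]

/-- The nodes get copies of the companions of their tuples. -/
theorem exists_companions {H : G.Home} {A : Algorithm E dom ℕ p} (hA : H.Base A) :
    ∃ A', G.Extends (E.card * levelRounds m) A A' ∧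
      G.KnowsOn A' H.loc (fun x _ => H.companions x) ∧
      ∀ x i, ∀ τ ∈ H.loc x i, ∀ σ ∈ H.companions x τ, G.NodeHolds A' x i σ := by
  let _ : LinearOrder (PartAssign dom) := IsWellOrder.linearOrder WellOrderingRel
  -- With the restriction to `e` as key, a tuple of `e` is determined by its key, so `exists_fetch`
  -- applies to one relation after the other.
  let κ : {e // e ∈ E} → AnyTuple E dom → PartAssign dom := fun e τ => restrict e.1 τ.assign
  have hκ : ∀ e (σ σ' : AnyTuple E dom), σ.1 = e → σ'.1 = e → κ e σ = κ e σ' → σ = σ' := by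
    rintro _ σ σ' rfl h h'
    refine assign_inj h.symm ?_
    simp only [κ] at h'
    rwa [restrict_assign, ← h, restrict_assign] at h'
  have hmem : ∀ e x τ σ, σ ∈ H.partners (κ e) e x τ ↔
      σ ∈ H.items x ∧ σ.1 = e ∧ σ.assign = restrict e.1 τ.assign := by
    intro e x τ σ
    rw [partners, Finset.mem_filter]
    refine and_congr_right fun _ => and_congr_right fun h => ?_
    subst h
    simp only [κ]
    rw [restrict_assign]
  have key : ∀ S : Finset {e // e ∈ E}, ∃ A', G.Extends (S.card * levelRounds m) A A' ∧
      ∀ e ∈ S, G.KnowsOn A' H.loc (fun x _ => H.partners (κ e) e x) ∧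
        ∀ x i, ∀ τ ∈ H.loc x i, ∀ σ ∈ H.partners (κ e) e x τ, G.NodeHolds A' x i σ := by
    intro S
    induction S using Finset.induction_on with
    | empty => exact ⟨A, (Extends.refl hA.good).mono (Nat.zero_le _), by simp⟩
    | insert e S he ih =>
      obtain ⟨A₁, e1, h1⟩ := ih
      obtain ⟨A₂, e2, k2, h2⟩ := exists_fetch (κ e) e (hκ e) (hA.extends e1)
      refine ⟨A₂, (e1.trans e2).mono ?_, fun f hf => ?_⟩
      · rw [Finset.card_insert_of_notMem he, Nat.succ_mul]
      · rcases Finset.mem_insert.mp hf with rfl | hf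
        · exact ⟨k2, h2⟩
        · exact ⟨e2.knowsOn (h1 f hf).1, fun x i τ hτ σ hσ => e2.nodeHolds ((h1 f hf).2 x i τ hτ σ hσ)⟩
  obtain ⟨A', e', h'⟩ := key Finset.univ
  rw [Finset.card_univ, Fintype.card_coe] at e'
  have hcomp : ∀ x τ σ, σ ∈ H.companions x τ ↔ σ.1.1 ⊆ τ.1.1 ∧ σ ∈ H.partners (κ σ.1) σ.1 x τ := by
    intro x τ σ
    rw [mem_companions, hmem]
    tauto
  refine ⟨A', e', fun x y i hxy τ hτ => ?_, fun x i τ hτ σ hσ => ?_⟩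
  · ext σ
    rw [hcomp, hcomp]
    have := (h' σ.1 (Finset.mem_univ _)).1 x y i hxy τ hτ
    beta_reduce at this
    rw [this]
  · exact (h' σ.1 (Finset.mem_univ _)).2 x i τ hτ σ ((hcomp _ _ _).mp hσ).2

theorem Computed.companions (H : G.Home) :
    H.Computed (E.card * levelRounds m) H.companions := by
  intro A hA
  obtain ⟨A', h1, h2, -⟩ := exists_companions hA
  exact ⟨A', h1, h2⟩

theorem Computed.mem_complete (H : G.Home) :
    H.Computed (E.card * levelRounds m) fun x τ => τ ∈ H.complete x := by
  refine (((mem_items H).prodMk (Computed.companions H)).map fun x y τ h => ?_).mono (by omega)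
  have h1 := congrArg Prod.fst h
  have h2 := congrArg Prod.snd h
  simp only at h1 h2
  simp only [Home.mem_complete]
  rw [h1, h2]

end Env.Home

/-! ### Counting join results -/

theorem Instance.finite_partialResults (R : Instance E dom) (S : Finset {e // e ∈ E}) :
    (R.partialResults S).Finite := by
  refine (Fintype.piFinset fun e : {e // e ∈ S} => R.rel e.1).finite_toSet.subset ?_
  intro s hs
  simpa using hs.1

variable {H : G.Home} {F S : Finset {e // e ∈ E}} {R : Instance E dom} {x : G.X}

/-- Relations outside of `F` lie inside members of `F`, and completeness supplies their tuples.
Hence the counts over `F` are bounded by numbers of genuine partial results. -/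
theorem exists_joinResult (hcov : ∀ e : {e // e ∈ E}, ∃ f ∈ F, e.1 ⊆ f.1)
    (hR : H.items x = R.tuples) {b : PartAssign dom} (hb : b ∈ Joins (H.complete x) F) :
    ∃ t ∈ R.joinResults, ∀ (e : {e // e ∈ E}) v (hv : v ∈ e.1), b v = some (t e ⟨v, hv⟩) := by
  have key : ∀ e : {e // e ∈ E}, ∃ t ∈ R.rel e, ∀ v (hv : v ∈ e.1), b v = some (t ⟨v, hv⟩) := by
    intro e
    obtain ⟨f, hf, hef⟩ := hcov e
    obtain ⟨τ, hτ, rfl, hτb⟩ := hb.2 f hf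
    obtain ⟨σ, hσ, rfl⟩ := (Env.Home.mem_complete.mp hτ).2 e hef
    obtain ⟨h1, h2, h3⟩ := Env.Home.mem_companions.mp hσ
    rw [hR, Instance.mem_tuples] at h1
    refine ⟨σ.2, h1, fun v hv => ?_⟩
    have := congrFun h3 v
    rw [restrict_apply_of_mem hv, hτb, restrict_apply_of_mem (h2 hv), AnyTuple.assign,
      dif_pos hv] at this
    exact this.symm
  choose t ht htb using key
  refine ⟨t, ⟨ht, fun e e' v hv hv' => ?_⟩, htb⟩
  exact Option.some_injective _ ((htb e v hv).symm.trans (htb e' v hv'))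

theorem ncard_partials_le_partialResults (hcov : ∀ e : {e // e ∈ E}, ∃ f ∈ F, e.1 ⊆ f.1)
    (hR : H.items x = R.tuples) (U : Finset V) (a : PartAssign dom) :
    (Partials (H.complete x) F S U a).ncard ≤ (R.partialResults S).ncard := by
  let g : (∀ e : {e // e ∈ S}, Tuple dom e.1.1) → PartAssign dom := fun s v =>
    if h : ∃ e : {e // e ∈ S}, v ∈ e.1.1 then some (s h.choose ⟨v, h.choose_spec⟩) else none
  have hsub : Partials (H.complete x) F S U a ⊆ g '' R.partialResults S := by
    rintro _ ⟨b, ⟨hb, -⟩, rfl⟩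
    obtain ⟨t, ht, htb⟩ := exists_joinResult hcov hR hb
    refine ⟨fun e => t e.1, ⟨fun e => ht.1 e.1, fun e e' => ht.2 e.1 e'.1, t, ht, fun _ => rfl⟩, ?_⟩
    funext v
    simp only [g]
    by_cases h : ∃ e : {e // e ∈ S}, v ∈ e.1.1
    · rw [dif_pos h, restrictAll, if_pos ⟨h.choose.1, h.choose.2, h.choose_spec⟩, htb h.choose.1]
    · rw [dif_neg h, restrictAll, if_neg]
      rintro ⟨e, he, hv⟩
      exact h ⟨⟨e, he⟩, hv⟩
  have hfin := R.finite_partialResults S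
  exact (Set.ncard_le_ncard hsub (hfin.image g)).trans (Set.ncard_image_le hfin)

/-- Every join result is found by the complete tuples. -/
theorem exists_mem_joins (hcov : ∀ e : {e // e ∈ E}, ∃ f ∈ F, e.1 ⊆ f.1)
    (hR : H.items x = R.tuples) {t : ∀ e : {e // e ∈ E}, Tuple dom e.1} (ht : t ∈ R.joinResults) :
    ∃ b ∈ Joins (H.complete x) F, ∀ e, AnyTuple.assign (E := E) ⟨e, t e⟩ = restrict e.1 b := by
  let b : PartAssign dom := fun v =>
    if h : ∃ e : {e // e ∈ E}, v ∈ e.1 then some (t h.choose ⟨v, h.choose_spec⟩) else none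
  have hb : ∀ e, AnyTuple.assign (E := E) ⟨e, t e⟩ = restrict e.1 b := by
    intro e
    funext v
    by_cases hv : v ∈ e.1
    · have h : ∃ e : {e // e ∈ E}, v ∈ e.1 := ⟨e, hv⟩
      rw [restrict_apply_of_mem hv, AnyTuple.assign, dif_pos hv]
      simp only [b]
      rw [dif_pos h, ht.2 e h.choose v hv h.choose_spec]
    · rw [restrict_apply_of_notMem hv, AnyTuple.assign, dif_neg hv]
  have hitems : ∀ e, (⟨e, t e⟩ : AnyTuple E dom) ∈ H.items x := by
    intro e
    rw [hR, Instance.mem_tuples]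
    exact ht.1 e
  refine ⟨b, ⟨?_, fun e _ => ⟨⟨e, t e⟩, ?_, rfl, hb e⟩⟩, hb⟩
  · funext v
    rw [restrictAll]
    split_ifs with h
    · rfl
    · simp only [b]
      rw [dif_neg]
      rintro ⟨e, hv⟩
      obtain ⟨f, hf, hef⟩ := hcov e
      exact h ⟨f, hf, hef hv⟩
  · refine Env.Home.mem_complete.mpr ⟨hitems e, fun e' he' => ⟨⟨e', t e'⟩, ?_, rfl⟩⟩
    refine Env.Home.mem_companions.mpr ⟨hitems e', he', ?_⟩
    rw [hb, hb, restrict_restrict he']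

theorem Instance.ncard_partialResults_le_lInstance (R : Instance E dom) (hp : 0 < p)
    (hS : S.Nonempty) :
    ((R.partialResults S).ncard : ℝ) ≤ p * (R.lInstance p : ℝ) ^ S.card := by
  have h : (((R.partialResults S).ncard : ℝ≥0) / (p : ℝ≥0)) ^ (1 / (S.card : ℝ)) ≤
      R.lInstance p :=
    Finset.le_sup (f := fun S : Finset {e // e ∈ E} =>
      (((R.partialResults S).ncard : ℝ≥0) / (p : ℝ≥0)) ^ (1 / (S.card : ℝ)))
      (Finset.mem_filter.mpr ⟨Finset.mem_univ S, hS⟩)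
  rw [one_div, NNReal.rpow_inv_le_iff (by exact_mod_cast hS.card_pos), NNReal.rpow_natCast,
    div_le_iff₀ (by exact_mod_cast hp), mul_comm] at h
  exact_mod_cast h

/-- Since `|S| ≥ 1`, each summand is at most `q / 2 ^ |F|`, and there are fewer than `2 ^ |F|`
nonempty `S`. -/
theorem need_lt {N : Finset {e // e ∈ E} → PartAssign dom → ℕ} {a : PartAssign dom} {q M : ℕ}
    {c ℓ : ℝ} (hc : 1 ≤ c) (hℓ : 0 ≤ ℓ) (hq : 0 < q) (hM : 0 < M)
    (hN : ∀ S ⊆ F, S.Nonempty → (N S a : ℝ) ≤ c * q * ℓ ^ S.card)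
    (h : c * 2 ^ F.card * ℓ ≤ M) : need N F M a < q := by
  have hM' : (0 : ℝ) < M := by exact_mod_cast hM
  have hq' : (0 : ℝ) < q := by exact_mod_cast hq
  have hK : (1 : ℝ) ≤ 2 ^ F.card := one_le_pow₀ (by norm_num)
  have hcK : 1 ≤ c * 2 ^ F.card := one_le_mul_of_one_le_of_one_le hc hK
  have hterm : ∀ S ∈ F.powerset.filter (·.Nonempty),
      (N S a : ℝ) / (M : ℝ) ^ S.card ≤ q / 2 ^ F.card := by
    intro S hS
    rw [Finset.mem_filter, Finset.mem_powerset] at hS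
    have hr : ℓ / M ≤ 1 / (c * 2 ^ F.card) := by
      rw [div_le_div_iff₀ hM' (by positivity)]
      linarith
    have h1 : (ℓ / M) ^ S.card ≤ 1 / (c * 2 ^ F.card) := by
      calc (ℓ / M) ^ S.card ≤ (1 / (c * 2 ^ F.card)) ^ S.card :=
            pow_le_pow_left₀ (by positivity) hr _
        _ ≤ 1 / (c * 2 ^ F.card) :=
            pow_le_of_le_one (by positivity) ((div_le_one (by positivity)).mpr hcK)
              hS.2.card_pos.ne'
    calc (N S a : ℝ) / (M : ℝ) ^ S.card ≤ c * q * ℓ ^ S.card / (M : ℝ) ^ S.card :=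
          div_le_div_of_nonneg_right (hN S hS.1 hS.2) (by positivity)
      _ = c * q * (ℓ / M) ^ S.card := by rw [div_pow]; ring
      _ ≤ c * q * (1 / (c * 2 ^ F.card)) := mul_le_mul_of_nonneg_left h1 (by positivity)
      _ = q / 2 ^ F.card := by field_simp
  have hcard : (F.powerset.filter (·.Nonempty)).card < 2 ^ F.card := by
    rw [← Finset.card_powerset]
    refine Finset.card_lt_card ((Finset.filter_ssubset).mpr ⟨∅, Finset.empty_mem_powerset F, by simp⟩)
  have hcard' : ((F.powerset.filter (·.Nonempty)).card : ℝ) < 2 ^ F.card := by exact_mod_cast hcard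
  calc need N F M a ≤ ∑ S ∈ F.powerset.filter (·.Nonempty), (q : ℝ) / 2 ^ F.card :=
        Finset.sum_le_sum hterm
    _ = (F.powerset.filter (·.Nonempty)).card * ((q : ℝ) / 2 ^ F.card) := by
        rw [Finset.sum_const, nsmul_eq_mul]
    _ < 2 ^ F.card * ((q : ℝ) / 2 ^ F.card) := mul_lt_mul_of_pos_right hcard' (by positivity)
    _ = q := by field_simp

end Companions


/-! ### The join phase -/

section JoinPhase

variable {V : Type u} {E : Query V}

/-- From an even distribution of the input over the nodes, the join can be computed in a constant
number of rounds. -/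
theorem Plan.exists_join {F : Finset {e // e ∈ E}} (hF : Plan ∅ F)
    (hcov : ∀ e : {e // e ∈ E}, ∃ f ∈ F, e.1 ⊆ f.1) (m : ℕ) :
    ∃ k C : ℕ, ∀ {dom : V → Type v} {p : ℕ} {G : Env E dom p m} (H : G.Home)
      (R : G.X → Instance E dom), (∀ x, H.items x = (R x).tuples) →
      (∀ x, ((H.items x).card + 1) ^ (E.card + 1) ≤ G.intBound x) → 0 < p → p ≤ 2 ^ m * G.s ^ m →
      (∀ x, C * (⌈2 ^ m * 2 ^ F.card * ((R x).lInstance p : ℝ)⌉₊ + 1) ≤ G.maxLoad x) →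
      ∀ A, H.Base A → ∃ A', G.Extends k A A' ∧
        ∀ x, ∀ t ∈ (R x).joinResults, ∃ i, ∀ e, G.NodeHolds A' x i ⟨e, t e⟩ := by
  obtain ⟨k, C, hspec⟩ := hF.exists_spec.{u, v} m (E.card * Env.levelRounds m)
  refine ⟨E.card * Env.levelRounds m + (E.card * Env.levelRounds m + k + k) + 1,
    E.card * (E.card * C), fun {dom p G} H R hR hint hp hpq hload A hA => ?_⟩
  let _ : LinearOrder (PartAssign dom) := IsWellOrder.linearOrder WellOrderingRel
  obtain ⟨N, Sl, hN, hSl, hs⟩ := hspec H H.complete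
    (fun x τ hτ => (Env.Home.mem_complete.mp hτ).1) (Env.Home.Computed.mem_complete H) hint
  let a : PartAssign dom := fun _ => none
  have ha : ∀ b : PartAssign dom, restrict ∅ b = a := fun b =>
    funext fun v => restrict_apply_of_notMem (Finset.notMem_empty v) b
  simp only [ha] at hN
  have hq : 0 < G.s ^ m := by
    by_contra hc
    have : G.s ^ m = 0 := by omega
    rw [this] at hpq
    omega
  have hM : ∀ x, need (N x) F (⌈2 ^ m * 2 ^ F.card * ((R x).lInstance p : ℝ)⌉₊ + 1) a <
      (G.s ^ m : ℕ) := by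
    intro x
    -- The grid may have fewer than `p` nodes; the factor `2 ^ m` makes up for that.
    refine need_lt (c := 2 ^ m) (ℓ := (R x).lInstance p) (one_le_pow₀ (by norm_num))
      NNReal.zero_le_coe hq (Nat.succ_pos _) (fun S hS hne => ?_) ?_
    · have h1 := ((hs x).le_ncard S hS a).trans
        (ncard_partials_le_partialResults (S := S) hcov (hR x) ∅ a)
      have h2 := (R x).ncard_partialResults_le_lInstance hp hne
      have h3 : ((N x S a : ℕ) : ℝ) ≤ ((R x).partialResults S).ncard := by exact_mod_cast h1
      have h4 : (p : ℝ) ≤ 2 ^ m * (G.s ^ m : ℕ) := by exact_mod_cast hpq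
      exact (h3.trans h2).trans (mul_le_mul_of_nonneg_right h4 (by positivity))
    · push_cast
      have := Nat.le_ceil ((2 : ℝ) ^ m * 2 ^ F.card * ((R x).lInstance p : ℝ))
      linarith
  have hex : ∀ x, ∃ L, 0 < L ∧ need (N x) F L a < (G.s ^ m : ℕ) :=
    fun x => ⟨_, Nat.succ_pos _, hM x⟩
  -- The nodes do not know `L_instance`. They take the least load at which the demand fits into the
  -- grid. It depends only on the counts at the root, which belong to the empty assignment `a` and
  -- are thus known along with any tuple.
  let L : G.X → ℕ := fun x => Nat.find (hex x)
  have hL : ∀ x, 0 < L x ∧ need (N x) F (L x) a < (G.s ^ m : ℕ) := fun x => Nat.find_spec (hex x)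
  have hLM : ∀ x, L x ≤ ⌈2 ^ m * 2 ^ F.card * ((R x).lInstance p : ℝ)⌉₊ + 1 :=
    fun x => Nat.find_min' (hex x) ⟨Nat.succ_pos _, hM x⟩
  have hLdet : ∀ x y, (∀ S, N x S a = N y S a) → L x = L y := by
    intro x y h
    have h' : ∀ l, need (N x) F l a = need (N y) F l a := fun l => by simp only [need, h]
    simp only [L, h']
  have hcomp : H.Computed (E.card * Env.levelRounds m + k + k) fun x τ =>
      (τ ∈ H.complete x, Sl x (L x) τ) := by
    refine (((Env.Home.Computed.mem_complete H).prodMk hN).prodMk hSl).map fun x y τ h => ?_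
    have h1 := congrArg (fun z => z.1.1) h
    have h2 := congrFun (congrArg (fun z => z.1.2) h)
    have h3 := congrFun (congrArg Prod.snd h)
    simp only at h1 h2 h3
    rw [h1, hLdet x y h2, h3]
  obtain ⟨A₁, e1, k1, h1⟩ := Env.Home.exists_companions hA
  obtain ⟨A₂, e2, k2⟩ := hcomp A₁ (hA.extends e1)
  have hA₂ := (hA.extends e1).extends e2
  let sent : G.X → G.Node → G.Node → Finset (AnyTuple E dom) := fun x i j =>
    (H.loc x i).filter fun τ => τ.1 ∈ F ∧ τ ∈ H.complete x ∧
      (finFunctionFinEquiv j : ℕ) ∈ Sl x (L x) τ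
  have hmem : ∀ x i j τ, τ ∈ sent x i j ↔ τ ∈ H.loc x i ∧ τ.1 ∈ F ∧ τ ∈ H.complete x ∧
      (finFunctionFinEquiv j : ℕ) ∈ Sl x (L x) τ := fun x i j τ => by
    simp only [sent, Finset.mem_filter]
  have hsent : G.Knows A₂ sent := by
    intro x y i hxy
    have hloc : H.loc x i = H.loc y i := hA₂.knows x y i hxy
    funext j
    ext τ
    rw [hmem, hmem, ← hloc]
    refine and_congr_right fun hτ => ?_
    have h := k2 x y i hxy τ hτ
    have h3 := congrArg Prod.fst h
    have h4 := congrArg Prod.snd h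
    simp only at h3 h4
    rw [h3, h4]
  have hload1 : ∀ x j, ∑ i, (sent x i j).card ≤ E.card * (C * L x) := by
    intro x j
    rw [← Finset.card_biUnion (fun i _ i' _ hii => Finset.disjoint_left.mpr fun τ hτ hτ' =>
      Finset.disjoint_left.mp (H.disj x i i' hii) ((hmem _ _ _ _).mp hτ).1 ((hmem _ _ _ _).mp hτ').1)]
    have hFc : F.card ≤ E.card := by
      have := Finset.card_le_univ F
      rwa [Fintype.card_coe] at this
    refine le_trans ?_ (Nat.mul_le_mul_right _ hFc)
    refine Finset.card_le_mul_card_image_of_maps_to (f := fun τ : AnyTuple E dom => τ.1)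
      (t := F) ?_ _ ?_ |>.trans_eq (mul_comm _ _)
    · intro τ hτ
      obtain ⟨i, _, hτ⟩ := Finset.mem_biUnion.mp hτ
      exact ((hmem _ _ _ _).mp hτ).2.1
    · intro e he
      have h3 := (hs x).card_le (hL x).1 (a := a) (c := (finFunctionFinEquiv j : ℕ)) he
        (W := (Finset.univ.biUnion fun i => sent x i j).filter fun τ => τ.1 = e) (by
          intro τ hτ
          obtain ⟨hτ, hτe⟩ := Finset.mem_filter.mp hτ
          obtain ⟨i, _, hτ⟩ := Finset.mem_biUnion.mp hτ
          obtain ⟨_, _, h5, h6⟩ := (hmem _ _ _ _).mp hτ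
          exact ⟨h5, hτe, ha _, h6⟩)
      have h4 : (C : ℝ) * L x * min 1 (need (N x) F (L x) a) ≤ C * L x :=
        mul_le_of_le_one_right (by positivity) (min_le_left _ _)
      exact_mod_cast h3.trans h4
  -- Companions travel along, at most `E.card` per tuple. They include the tuple itself and supply
  -- the relations outside of `F`.
  let msg : G.X → G.Node → G.Node → Finset (AnyTuple E dom) := fun x i j =>
    (sent x i j).biUnion (H.companions x)
  have hmsg : G.Knows A₂ msg := by
    intro x y i hxy
    funext j
    have h3 : sent x i j = sent y i j := congrFun (hsent x y i hxy) j
    simp only [msg, ← h3]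
    ext σ
    simp only [Finset.mem_biUnion]
    refine exists_congr fun τ => and_congr_right fun hτ => ?_
    have := e2.knowsOn k1 x y i hxy τ ((hmem _ _ _ _).mp hτ).1
    beta_reduce at this
    rw [this]
  have hheld : ∀ x i j, ∀ σ ∈ msg x i j, G.NodeHolds A₂ x i σ := by
    intro x i j σ hσ
    obtain ⟨τ, hτ, hσ⟩ := Finset.mem_biUnion.mp hσ
    exact e2.nodeHolds (h1 x i τ ((hmem _ _ _ _).mp hτ).1 σ hσ)
  have hload2 : ∀ x j, ∑ i, (msg x i j).card ≤ G.maxLoad x := by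
    intro x j
    refine le_trans ?_ (hload x)
    calc ∑ i, (msg x i j).card ≤ ∑ i, (sent x i j).card * E.card :=
          Finset.sum_le_sum fun i _ =>
            Finset.card_biUnion_le_card_mul _ _ _ fun τ _ => H.card_companions_le x τ
      _ = E.card * ∑ i, (sent x i j).card := by rw [← Finset.sum_mul, mul_comm]
      _ ≤ E.card * (E.card * (C * L x)) := Nat.mul_le_mul_left _ (hload1 x j)
      _ = E.card * (E.card * C) * L x := by ring
      _ ≤ _ := Nat.mul_le_mul_left _ (hLM x)
  obtain ⟨A₃, e3, -, h3⟩ := Env.exists_tuple_round hA₂.good msg hmsg hheld hload2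
  refine ⟨A₃, (e1.trans e2).trans e3, fun x t ht => ?_⟩
  obtain ⟨b, hb, hbt⟩ := exists_mem_joins hcov (hR x) ht
  obtain ⟨c, hc, hmeet⟩ := (hs x).meet (L x) (hL x).1 b hb
  rw [ha] at hc
  have hcq : c < G.s ^ m := by
    have h4 := (Nat.floor_le (need_nonneg (N x) F (L x) a)).trans_lt (hL x).2
    exact lt_of_le_of_lt hc (by exact_mod_cast h4)
  refine ⟨finFunctionFinEquiv.symm ⟨c, hcq⟩, fun e => ?_⟩
  obtain ⟨f, hf, hef⟩ := hcov e
  have hitem : ∀ e, (⟨e, t e⟩ : AnyTuple E dom) ∈ H.items x := by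
    intro e
    rw [hR x, Instance.mem_tuples]
    exact ht.1 e
  obtain ⟨i, -, hi⟩ := Finset.mem_biUnion.mp (hitem f)
  refine h3 x _ i _ (Finset.mem_biUnion.mpr ⟨⟨f, t f⟩, (hmem _ _ _ _).mpr ⟨hi, hf, ?_, ?_⟩, ?_⟩)
  · obtain ⟨τ, hτ, hτf, hτb⟩ := hb.2 f hf
    have : τ = ⟨f, t f⟩ := assign_inj hτf (hτb.trans (hbt f).symm)
    rwa [this] at hτ
  · rw [Equiv.apply_symm_apply]
    exact hmeet ⟨f, t f⟩ hf (hbt f)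
  · refine Env.Home.mem_companions.mpr ⟨hitem e, hef, ?_⟩
    rw [hbt, hbt, restrict_restrict hef]

end JoinPhase


/-! ### The algorithm -/

section Main

variable {V : Type u} {E : Query V} {dom : V → Type v}

/-- `s` is the integer part of `p ^ (1 / m)`: rounding loses at most a factor 2 per dimension, and
`2 / m ≤ ε` gives `s ^ 2 ≤ p ^ ε`. -/
theorem exists_grid_side {ε : ℝ} {m : ℕ} (hm : 0 < m) (hmε : 2 ≤ ε * m) {p : ℕ} (hp : 0 < p) :
    ∃ s : ℕ, 0 < s ∧ s ^ m ≤ p ∧ p ≤ 2 ^ m * s ^ m ∧ ((s * s : ℕ) : ℝ) ≤ (p : ℝ) ^ ε := by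
  have hp' : (1 : ℝ) ≤ p := by exact_mod_cast hp
  have hm' : (0 : ℝ) < m := by exact_mod_cast hm
  set r : ℝ := (p : ℝ) ^ ((m : ℝ)⁻¹) with hr
  have hr1 : 1 ≤ r := Real.one_le_rpow hp' (by positivity)
  have hrm : r ^ m = p := Real.rpow_inv_natCast_pow (by positivity) hm.ne'
  have hs1 : 1 ≤ ⌊r⌋₊ := Nat.le_floor (by simpa using hr1)
  have hsr : (⌊r⌋₊ : ℝ) ≤ r := Nat.floor_le (by linarith)
  refine ⟨⌊r⌋₊, hs1, ?_, ?_, ?_⟩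
  · have h : (⌊r⌋₊ : ℝ) ^ m ≤ p := hrm ▸ pow_le_pow_left₀ (by positivity) hsr m
    exact_mod_cast h
  · have h1 : r ≤ 2 * (⌊r⌋₊ : ℝ) := by
      have h2 := Nat.lt_floor_add_one r
      have h3 : (1 : ℝ) ≤ ⌊r⌋₊ := by exact_mod_cast hs1
      linarith
    have h : (p : ℝ) ≤ 2 ^ m * (⌊r⌋₊ : ℝ) ^ m := by
      rw [← hrm, ← mul_pow]
      exact pow_le_pow_left₀ (by linarith) h1 m
    exact_mod_cast h
  · calc ((⌊r⌋₊ * ⌊r⌋₊ : ℕ) : ℝ) = (⌊r⌋₊ : ℝ) * ⌊r⌋₊ := by push_cast; ring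
      _ ≤ r * r := mul_le_mul hsr hsr (by positivity) (by linarith)
      _ = (p : ℝ) ^ ((m : ℝ)⁻¹ + (m : ℝ)⁻¹) := by rw [Real.rpow_add (by linarith)]
      _ ≤ (p : ℝ) ^ ε := by
        refine Real.rpow_le_rpow_of_exponent_le hp' ?_
        rw [← mul_le_mul_iff_left₀ hm']
        have : (m : ℝ)⁻¹ * m = 1 := inv_mul_cancel₀ hm'.ne'
        nlinarith

/-- The algorithm without communication. -/
def Algorithm.idle {V : Type u} (E : Query V) (dom : V → Type v) (p : ℕ) :
    Algorithm E dom ℕ p where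
  rounds := 0
  send _ _ _ := []
  tupleBased := by simp

theorem Env.good_idle {p m : ℕ} (G : Env E dom p m) : G.Good (Algorithm.idle E dom p) :=
  fun _ => ⟨fun _ ht => absurd ht (Nat.not_lt_zero _), fun _ ht => absurd ht (Nat.not_lt_zero _)⟩

/-- In one round, the input is moved to the nodes. -/
theorem Env.Home.exists_base {p m : ℕ} {G : Env E dom p m} (H : G.Home) (dest : Fin p → G.Node)
    (hloc : ∀ x i, H.loc x i = (Finset.univ.filter fun j => dest j = i).biUnion (G.D x)) {β : G.X → ℕ}
    (hβ : ∀ x j, (G.D x j).card ≤ β x) {γ : ℕ}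
    (hdest : ∀ i, (Finset.univ.filter fun j => dest j = i).card ≤ γ)
    (hload : ∀ x, γ * β x ≤ G.maxLoad x) :
    ∃ A, A.rounds ≤ 1 ∧ H.Base A := by
  let msg : G.X → Fin p → Fin p → Message E dom ℕ := fun x j i =>
    if G.emb (dest j) = i then (G.D x j).toList.map Sum.inl else []
  have hmsg : ∀ x i j τ, Sum.inl τ ∈ msg x i j → τ ∈ G.D x i := by
    intro x i j τ h
    simp only [msg] at h
    split_ifs at h
    · obtain ⟨σ, hσ, e⟩ := List.mem_map.mp h
      cases e
      exact Finset.mem_toList.mp hσ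
    · simp at h
  have k1 : ∀ x y i, G.final (Algorithm.idle E dom p) x i = G.final (Algorithm.idle E dom p) y i →
      msg x i = msg y i := by
    intro x y i h
    simp only [msg, initial_eq_of_final_eq h]
  have k2 : ∀ x i j τ, Sum.inl τ ∈ msg x i j → (G.final (Algorithm.idle E dom p) x i).Holds τ :=
    fun x i j τ h => Or.inl (hmsg x i j τ h)
  have k3 : ∀ x i, ∑ j, (msg x j i).length ≤ G.maxLoad x := by
    intro x i
    refine le_trans ?_ (hload x)
    by_cases hi : ∃ i', G.emb i' = i
    · obtain ⟨i', rfl⟩ := hi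
      calc ∑ j, (msg x j (G.emb i')).length
          = ∑ j ∈ Finset.univ.filter (fun j => dest j = i'), (G.D x j).card := by
            rw [Finset.sum_filter]
            refine Finset.sum_congr rfl fun j _ => ?_
            simp only [msg]
            by_cases hj : dest j = i'
            · rw [if_pos (by rw [hj]), if_pos hj, List.length_map, Finset.length_toList]
            · rw [if_neg fun h => hj (G.emb_inj h), if_neg hj, List.length_nil]
        _ ≤ ∑ j ∈ Finset.univ.filter (fun j => dest j = i'), β x :=
            Finset.sum_le_sum fun j _ => hβ x j
        _ ≤ γ * β x := by
            rw [Finset.sum_const, smul_eq_mul]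
            exact Nat.mul_le_mul_right _ (hdest i')
    · have : ∀ j, msg x j i = [] := fun j => if_neg fun h => hi ⟨_, h⟩
      simp [this]
  have k4 : ∀ x i j n, Sum.inr n ∈ msg x i j → n < G.intBound x := by
    intro x i j n h
    simp only [msg] at h
    split_ifs at h
    · obtain ⟨σ, hσ, e⟩ := List.mem_map.mp h
      cases e
    · simp at h
  obtain ⟨A, h1, h2, h3⟩ := exists_round G.good_idle msg k1 k2 k3 k4
  refine ⟨A, by simpa [Algorithm.idle] using h1.rounds_le, h1.good, ?_, ?_⟩
  · intro x y i hxy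
    rw [hloc, hloc]
    refine Finset.biUnion_congr rfl fun j hj => ?_
    have hj' := (Finset.mem_filter.mp hj).2
    have h := h2 x y _ hxy j
    simp only [msg] at h
    rw [if_pos (by rw [hj']), if_pos (by rw [hj'])] at h
    have h5 := List.map_injective_iff.mpr Sum.inl_injective h
    rw [← Finset.toList_toFinset (G.D x j), ← Finset.toList_toFinset (G.D y j), h5]
  · intro x i τ hτ
    rw [hloc] at hτ
    obtain ⟨j, hj, hτ⟩ := Finset.mem_biUnion.mp hτ
    refine h3 x _ j τ ?_
    simp only [msg]
    rw [if_pos (by rw [(Finset.mem_filter.mp hj).2])]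
    exact List.mem_map_of_mem (Finset.mem_toList.mpr hτ)

theorem Query.RHierarchical.exists_algorithm [Fintype V] [DecidableEq V] (hE : E.RHierarchical)
    (hne : E.Nonempty) {ε : ℝ} (hε : 0 < ε) :
    ∃ (k c : ℕ) (C : ℝ), 0 ≤ C ∧ ∀ p : ℕ, 0 < p → ∀ dom : V → Type v,
      ∃ A : Algorithm E dom ℕ p, A.rounds ≤ k ∧
        ∀ R : Instance E dom, (p : ℝ) ^ (1 + ε) ≤ (R.size : ℝ) →
          ∀ D : Fin p → Finset (AnyTuple E dom), R.EvenlyDistributed D →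
            A.Computes R D ∧ A.IntegersBelow D ((R.size + 1) ^ c) ∧
            (A.load D : ℝ) ≤ C * ((R.size : ℝ) / (p : ℝ) + (R.lInstance p : ℝ)) := by
  obtain ⟨F, hF, hcov⟩ := hE.exists_plan hne
  obtain ⟨m, hm⟩ := exists_nat_gt (2 / ε)
  have hm0 : 0 < m := by
    have h : (0 : ℝ) < m := lt_trans (by positivity) hm
    exact_mod_cast h
  have hmε : 2 ≤ ε * m := by
    rw [div_lt_iff₀ hε] at hm
    linarith
  obtain ⟨k, C, hjoin⟩ := hF.exists_join.{u, v} hcov m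
  -- In units of `⌈IN / p⌉ ≥ s ^ 2`: `2 ^ m` for the tuples of a node and `m * (5 * m + 1)` for what
  -- the levels add, doubled since values return in pairs, and 2 for the class totals, `s * (2 * s)`
  -- units.
  let K : ℕ := (2 ^ m + m * (5 * m + 1)) * 2 + 2
  refine ⟨1 + k, E.card + 1, 2 * K + 2 * C + C * (2 ^ m * 2 ^ F.card), by positivity,
    fun p hp dom => ?_⟩
  have hp' : (1 : ℝ) ≤ p := by exact_mod_cast hp
  obtain ⟨s, hs0, hsp, hps, hss⟩ := exists_grid_side hm0 hmε hp
  let β : Instance E dom → ℕ := fun R => ⌈(R.size : ℝ) / (p : ℝ)⌉₊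
  let load : Instance E dom → ℕ := fun R =>
    K * β R + C * (⌈2 ^ m * 2 ^ F.card * (R.lInstance p : ℝ)⌉₊ + 1)
  -- All admissible instances and distributions together form the inputs, so a single algorithm
  -- serves them all.
  let G : Env E dom p m :=
    { X := {x : Instance E dom × (Fin p → Finset (AnyTuple E dom)) //
        (p : ℝ) ^ (1 + ε) ≤ (x.1.size : ℝ) ∧ x.1.EvenlyDistributed x.2}
      D := fun x => x.1.2
      maxLoad := fun x => load x.1.1
      intBound := fun x => (x.1.1.size + 1) ^ (E.card + 1)
      s := s
      emb := fun i => Fin.castLE hsp (finFunctionFinEquiv i)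
      emb_inj := (Fin.castLE_injective hsp).comp finFunctionFinEquiv.injective }
  have hsize : ∀ x : G.X, (p : ℝ) ^ ε ≤ (x.1.1.size : ℝ) / p := by
    intro x
    rw [le_div_iff₀ (by linarith), mul_comm, ← Real.rpow_one_add' (by linarith) (by positivity)]
    exact x.2.1
  have hβs : ∀ x : G.X, s * s ≤ β x.1.1 := by
    intro x
    have : ((s * s : ℕ) : ℝ) ≤ β x.1.1 := (hss.trans (hsize x)).trans (Nat.le_ceil _)
    exact_mod_cast this
  -- Servers are folded onto the nodes modulo `s ^ m`, at most `2 ^ m` to a node.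
  let dest : Fin p → G.Node := fun j =>
    finFunctionFinEquiv.symm ⟨j.1 % s ^ m, Nat.mod_lt _ (by positivity)⟩
  have hdest : ∀ i, (Finset.univ.filter fun j => dest j = i).card ≤ 2 ^ m := by
    intro i
    rw [← Finset.card_range (2 ^ m)]
    refine Finset.card_le_card_of_injOn (fun j => j.1 / s ^ m) ?_ ?_
    · intro j _
      simp only [Finset.coe_range, Set.mem_Iio]
      rw [Nat.div_lt_iff_lt_mul (by positivity)]
      exact j.2.trans_le hps
    · intro j hj j' hj' h
      have h1 := (Finset.mem_filter.mp hj).2.trans (Finset.mem_filter.mp hj').2.symm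
      have h2 := congrArg Fin.val (finFunctionFinEquiv.symm.injective h1)
      simp only at h h2
      apply Fin.ext
      rw [← Nat.div_add_mod j.1 (s ^ m), ← Nat.div_add_mod j'.1 (s ^ m), h, h2]
  have hKβ : ∀ x : G.X, K * β x.1.1 ≤ G.maxLoad x := fun x => Nat.le_add_right _ _
  have hβK : ∀ x : G.X, (2 ^ m * β x.1.1 + m * ((5 * m + 1) * (s * s))) * 2 + s * (2 * s) ≤
      K * β x.1.1 := by
    intro x
    have h1 := Nat.mul_le_mul_left (m * (5 * m + 1)) (hβs x)
    have h2 := hβs x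
    calc _ = (2 ^ m * β x.1.1 + m * (5 * m + 1) * (s * s)) * 2 + 2 * (s * s) := by ring
      _ ≤ (2 ^ m * β x.1.1 + m * (5 * m + 1) * β x.1.1) * 2 + 2 * β x.1.1 := by omega
      _ = K * β x.1.1 := by simp only [K]; ring
  let H : G.Home :=
    { loc := fun x i => (Finset.univ.filter fun j => dest j = i).biUnion (G.D x)
      n := fun x => 2 ^ m * β x.1.1
      disj := by
        intro x i i' hii
        rw [Finset.disjoint_left]
        intro τ hτ hτ'
        obtain ⟨j, hj, hτ⟩ := Finset.mem_biUnion.mp hτ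
        obtain ⟨j', hj', hτ'⟩ := Finset.mem_biUnion.mp hτ'
        refine x.2.2.2.1 j j' ?_ τ hτ hτ'
        rintro rfl
        exact hii ((Finset.mem_filter.mp hj).2.symm.trans (Finset.mem_filter.mp hj').2)
      card_le := fun x i => (Finset.card_biUnion_le_card_mul _ _ _
        fun j _ => x.2.2.2.2 j).trans (Nat.mul_le_mul_right _ (hdest i))
      load := fun x => ((Nat.le_add_right _ _).trans (hβK x)).trans (hKβ x)
      load' := fun x => ((Nat.le_add_left _ _).trans (hβK x)).trans (hKβ x)
      intBound_pos := fun x => Nat.pow_pos (Nat.succ_pos _) }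
  have hitems : ∀ x, H.items x = x.1.1.tuples := by
    intro x
    rw [← x.2.2.biUnion_eq]
    ext τ
    simp only [Env.Home.items, H, G, Finset.mem_biUnion, Finset.mem_filter, Finset.mem_univ, true_and]
    exact ⟨fun ⟨_, j, _, h⟩ => ⟨j, h⟩, fun ⟨j, h⟩ => ⟨_, j, rfl, h⟩⟩
  obtain ⟨A₁, hA₁, hbase⟩ := H.exists_base dest (fun x i => by simp only [H]; congr!) (β := fun x => β x.1.1)
    (fun x j => x.2.2.2.2 j) hdest (fun x => by
      have h1 := hβK x
      have h2 := hKβ x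
      omega)
  obtain ⟨A, hA, hres⟩ := hjoin H (fun x => x.1.1) hitems
    (fun x => by rw [hitems, Instance.card_tuples]) hp hps (fun x => Nat.le_add_left _ _) A₁ hbase
  refine ⟨A, hA.rounds_le.trans (by omega), fun R hR D hD => ?_⟩
  let x : G.X := ⟨(R, D), hR, hD⟩
  refine ⟨fun t ht => ?_, (hA.good x).2, ?_⟩
  · obtain ⟨i, hi⟩ := hres x t ht
    exact ⟨G.emb i, A.rounds, le_rfl, hi⟩
  · have h1 : A.load D ≤ load R := by
      refine Finset.sup_le fun i _ => max_le ?_ (Finset.sup_le fun t ht => ?_)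
      · refine (hD.2.2 i).trans (le_trans ?_ (hKβ x))
        exact Nat.le_mul_of_pos_left _ (by omega)
      · exact (hA.good x).1 t (Finset.mem_range.mp ht) i
    -- `IN / p ≥ 1` absorbs the additive constants from rounding up.
    have h2 : (1 : ℝ) ≤ (R.size : ℝ) / p := (Real.one_le_rpow hp' hε.le).trans (hsize x)
    have h3 : (β R : ℝ) ≤ 2 * ((R.size : ℝ) / p) := by
      have := (Nat.ceil_lt_add_one (a := (R.size : ℝ) / p) (by positivity)).le
      linarith
    set ℓ : ℝ := (R.lInstance p : ℝ) with hℓ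
    have hℓ0 : 0 ≤ ℓ := NNReal.zero_le_coe
    have h4 : ((⌈2 ^ m * 2 ^ F.card * ℓ⌉₊ : ℕ) : ℝ) + 1 ≤
        2 ^ m * 2 ^ F.card * ℓ + 2 * ((R.size : ℝ) / p) := by
      have := (Nat.ceil_lt_add_one (a := 2 ^ m * 2 ^ F.card * ℓ) (by positivity)).le
      linarith
    have h5 : (load R : ℝ) = K * β R + C * (((⌈2 ^ m * 2 ^ F.card * ℓ⌉₊ : ℕ) : ℝ) + 1) := by
      simp only [load, ← hℓ]
      push_cast
      ring
    have hK0 : (0 : ℝ) ≤ K := by positivity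
    have hC0 : (0 : ℝ) ≤ C := by positivity
    calc (A.load D : ℝ) ≤ load R := by exact_mod_cast h1
      _ = K * β R + C * (((⌈2 ^ m * 2 ^ F.card * ℓ⌉₊ : ℕ) : ℝ) + 1) := h5
      _ ≤ K * (2 * ((R.size : ℝ) / p)) + C * (2 ^ m * 2 ^ F.card * ℓ + 2 * ((R.size : ℝ) / p)) :=
          add_le_add (mul_le_mul_of_nonneg_left h3 hK0) (mul_le_mul_of_nonneg_left h4 hC0)
      _ ≤ (2 * K + 2 * C + C * (2 ^ m * 2 ^ F.card)) * ((R.size : ℝ) / p + ℓ) := by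
          have h6 : 0 ≤ (2 * (K : ℝ) + 2 * C) * ℓ := by positivity
          have h7 : 0 ≤ (C : ℝ) * (2 ^ m * 2 ^ F.card) * ((R.size : ℝ) / p) := by positivity
          nlinarith

end Main

end MPCJoin

/-! ### Upper and lower bound combined -/

theorem mainTheorem3 {V : Type u} [Fintype V] [DecidableEq V] (E : Query V)
    (hE : E.RHierarchical) (ε : ℝ) (hε : 0 < ε) :
    ∃ (k c : ℕ) (C : ℝ) (C₁ C₂ : ℕ → ℝ),
      ∀ (p : ℕ), 0 < p → ∀ (dom : V → Type v),
        ∃ A : Algorithm E dom ℕ p, A.rounds ≤ k ∧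
          ∀ R : Instance E dom, (p : ℝ) ^ (1 + ε) ≤ (R.size : ℝ) →
            ∀ D : Fin p → Finset (AnyTuple E dom), R.EvenlyDistributed D →
              -- `A` computes the join, with integers of `O(log IN)` bits, within the load bound
              A.Computes R D ∧
              A.IntegersBelow D ((R.size + 1) ^ c) ∧
              (A.load D : ℝ) ≤ C * ((R.size : ℝ) / (p : ℝ) + (R.lInstance p : ℝ)) ∧
              -- `L_instance` is a lower bound for every algorithm on this instance,
              -- and `A` is instance-optimal
              ∀ (Γ : Type w) (A' : Algorithm E dom Γ p) (D' : Fin p → Finset (AnyTuple E dom)),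
                R.EvenlyDistributed D' → A'.Computes R D' →
                  (R.lInstance p : ℝ) ≤ C₁ A'.rounds * (A'.tupleLoad D' : ℝ) ∧
                  (A.load D : ℝ) ≤ C₂ A'.rounds * (A'.tupleLoad D' : ℝ) := by
  rcases E.eq_empty_or_nonempty with rfl | hne
  -- Without relations `IN = 0`, which is less than `p ^ (1 + ε)`: no instance qualifies.
  · refine ⟨0, 0, 0, 0, 0, fun p hp dom => ⟨Algorithm.idle _ dom p, le_rfl, fun R hR => ?_⟩⟩
    have h1 : R.size = 0 := Finset.sum_eq_zero fun e _ => absurd e.2 (Finset.notMem_empty _)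
    have h2 : (0 : ℝ) < (p : ℝ) ^ (1 + ε) := Real.rpow_pos_of_pos (by exact_mod_cast hp) _
    rw [h1, Nat.cast_zero] at hR
    exact absurd hR h2.not_ge
  · obtain ⟨k, c, C, hC, h⟩ := hE.exists_algorithm.{u, v} hne hε
    -- `r + 1` counts the initial tuples as one more batch besides the `r` rounds; the summand 1 in
    -- `C₂` comes from `IN / p ≤ L'`.
    refine ⟨k, c, C, fun r => ((r + 1 : ℕ) : ℝ), fun r => C * (1 + ((r + 1 : ℕ) : ℝ)),
      fun p hp dom => ?_⟩
    obtain ⟨A, hA, hA'⟩ := h p hp dom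
    refine ⟨A, hA, fun R hR D hD => ?_⟩
    obtain ⟨h1, h2, h3⟩ := hA' R hR D hD
    refine ⟨h1, h2, h3, fun Γ A' D' hD' hc => ?_⟩
    have h4 := hc.lInstance_le hp
    refine ⟨h4, h3.trans ?_⟩
    have h5 := A'.size_div_le_tupleLoad hD' hp
    calc C * ((R.size : ℝ) / p + R.lInstance p)
        ≤ C * (A'.tupleLoad D' + ((A'.rounds + 1 : ℕ) : ℝ) * A'.tupleLoad D') :=
          mul_le_mul_of_nonneg_left (add_le_add h5 h4) hC
      _ = _ := by ring
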